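/- Let $(N_1,g_1)$ and $(N_2,g_2)$ be smooth Riemannian manifolds of dimensions $n_1,n_2$, let $f:N_1\to(0,\infty)$ be smooth, and let $M^n=N_1\times_fN_2$, $n=n_1+n_2$, be the warped product, i.e. $N_1\times N_2$ with the metric $g=g_1+f^2g_2$. Let $\varphi:M^n\to\tilde M^m(c)$ be a smooth isometric immersion into a Riemannian manifold of constant sectional curvature $c$, with second fundamental form $h$, shape operators $A_\xi$ (where $g(A_\xi X,Y)=\tilde g(h(X,Y),\xi)$) and mean curvature vector $\vec H=\frac1n\sum_i h(e_i,e_i)$. Let $\Delta f=\sum_a\big((\nabla_{e_a}e_a)f-e_ae_af\big)$ be the Laplacian of $f$ on $N_1$ (minus the trace of the Hessian). Let $x\in M^n$, and regard $T_xN_1$ and $T_xN_2$ as orthogonal subspaces of $T_xM^n$. Let $K$ be the sectional curvature of $M^n$. For a subspace $L\subset T_xM^n$ with orthonormal basis $(e_i)$ put $\tau(L)=\sum_{i<j}K(e_i\wedge e_j)$ and $\delta(L)=\tau(L)-\inf\{K(\pi):\pi\subset L,\ \dim\pi=2\}$, and write $\delta_{N_i}(x)=\delta(T_xN_i)$. (i)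 Suppose $n_1\ge2$. Then $\delta_{N_1}(x)$ equals the intrinsic first Chen invariant of $(N_1,g_1)$ at the first component of $x$, and $$\delta_{N_1}(x)\le B_1:=\frac{n^2}{2}\|\vec H\|^2-\frac{n_2\,\Delta f}{f}+\frac12n_1(n_1+2n_2-1)c-c .$$ In particular $\tau(T_xN_1)-K(\pi_1)\le B_1$ for every plane $\pi_1\subset T_xN_1$. For such a plane, $\tau(T_xN_1)-K(\pi_1)=B_1$ holds if and only if there are orthonormal bases $e_1,\dots,e_{n_1}$ of $T_xN_1$, $e_{n_1+1},\dots,e_n$ of $T_xN_2$ and $e_{n+1},\dots,e_m$ of the normal space $T_x^\perp M^n$ such that $\pi_1=\mathrm{Span}\{e_1,e_2\}$ and, with respect to $e_1,\dots,e_n$, $$A_{e_r}=\begin{pmatrix}P_r&0\\0&Q_r\end{pmatrix},\qquad \operatorname{tr}P_r=\operatorname{tr}Q_r=0,\qquad r=n+1,\dots,m,$$ where the $n_1\times n_1$ blocks have the form $$P_{n+1}=\begin{pmatrix}\mu_1&a\\a&\mu_2\end{pmatrix}\oplus\mu I_{n_1-2},\quad\mu=\mu_1+\mu_2,\qquad P_r=\begin{pmatrix}b_r&a_r\\a_r&-b_r\end{pmatrix}\oplus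 0_{n_1-2}\quad(r\ge n+2),$$ with real numbers $\mu_1,\mu_2,a,a_r,b_r$. Moreover $\delta_{N_1}(x)=B_1$ if and only if such bases exist for some plane $\pi_1\subset T_xN_1$. (ii) Suppose $n_2\ge2$. Then $$\delta_{N_2}(x)\le B_2:=\frac{n^2}{2}\|\vec H\|^2-\frac{n_2\,\Delta f}{f}+\frac12n_2(n_2+2n_1-1)c-c ,$$ in particular $\tau(T_xN_2)-K(\pi_2)\le B_2$ for every plane $\pi_2\subset T_xN_2$. For such a plane, $\tau(T_xN_2)-K(\pi_2)=B_2$ holds if and only if there are orthonormal bases of $T_xN_1$, $T_xN_2$ and $T^\perp_xM^n$ as in (i) such that $\pi_2=\mathrm{Span}\{e_{n_1+1},e_{n_1+2}\}$, all $A_{e_r}$ are block diagonal with blocks $P_r,Q_r$ of trace zero, and the $n_2\times n_2$ blocks $Q_r$ (instead of the $P_r$) have the form displayed in (i), with $n_2$ in place of $n_1$. Moreover $\delta_{N_2}(x)=B_2$ if and only if such bases exist for some plane $\pi_2\subset T_xN_2$. (iii) If $n_1\ge2$ and $\delta_{N_1}(x)=B_1$, or $n_2\ge2$ and $\delta_{N_2}(x)=B_2$,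 then at $x$ the immersion is mixed totally geodesic ($h(X,Z)=0$ for all $X\in T_xN_1$, $Z\in T_xN_2$), the traces of $h$ over $T_xN_1$ and over $T_xN_2$ both vanish ($\mathfrak D_1$- and $\mathfrak D_2$-minimality), and hence $\vec H=0$. -/

import Mathlib

open Manifold Bundle
open scoped ContDiff

noncomputable section

namespace WarpedChen

/-! ## Coordinate formulas on an open subset of a vector space

`G y` is the Gram form of the metric at the coordinate point `y`. -/

section Coordinates

variable {E : Type*} [NormedAddCommGroup E] [NormedSpace ℝ E]

/-- The functional `w ↦ (∂_u G(v, w) + ∂_v G(u, w) - ∂_w G(u, v)) / 2`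
(Christoffel symbols of the first kind). -/
def christoffelFirst (G : E → E →L[ℝ] E →L[ℝ] ℝ) (y u v : E) : E →L[ℝ] ℝ :=
  (1 / 2 : ℝ) • (fderiv ℝ G y u v + fderiv ℝ G y v u - ((fderiv ℝ G y).flip u).flip v)

/-- The vector `Γ_y(u, v)` determined by `G y (Γ_y(u, v)) w = christoffelFirst G y u v w`; it is
the Levi-Civita derivative `∇_u v` at `y` of constant coordinate vector fields. -/
def christoffel (G : E → E →L[ℝ] E →L[ℝ] ℝ) (y u v : E) : E :=
  (G y).inverse (christoffelFirst G y u v)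

/-- The curvature `R(u, v) w = ∇_u ∇_v w - ∇_v ∇_u w` at `y` of constant coordinate vector
fields. -/
def coordCurvature (G : E → E →L[ℝ] E →L[ℝ] ℝ) (y u v w : E) : E :=
  fderiv ℝ (fun z ↦ christoffel G z v w) y u - fderiv ℝ (fun z ↦ christoffel G z u w) y v
    + christoffel G y u (christoffel G y v w) - christoffel G y v (christoffel G y u w)

/-- The pullback `(v, w) ↦ B (A v) (A w)` of a bilinear form. -/
def pullback {F : Type*} [NormedAddCommGroup F] [NormedSpace ℝ F] (B : F →L[ℝ] F →L[ℝ] ℝ)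
    (A : E →L[ℝ] F) : E →L[ℝ] E →L[ℝ] ℝ :=
  B.bilinearComp A A

end Coordinates

/-! ## Linear algebra: orthonormal frames and traces -/

section Frames

variable {V : Type*} [AddCommGroup V] [Module ℝ V] [TopologicalSpace V]

/-- The family `e` is an orthonormal basis of the subspace `L` for the bilinear form `B`. -/
def IsFrame (B : V →L[ℝ] V →L[ℝ] ℝ) (L : Submodule ℝ V) {k : ℕ} (e : Fin k → V) : Prop :=
  (∀ i j, B (e i) (e j) = if i = j then 1 else 0) ∧ Submodule.span ℝ (Set.range e) = L

open Classical in
/-- Some orthonormal basis of `L` (there is one whenever `B` is an inner product and `V` is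
finite-dimensional; everything below that uses it does not depend on the choice). -/
def frameOf (B : V →L[ℝ] V →L[ℝ] ℝ) (L : Submodule ℝ V) : Fin (Module.finrank ℝ L) → V :=
  if h : ∃ e : Fin (Module.finrank ℝ L) → V, IsFrame B L e then h.choose else 0

/-- The trace over `L` of a vector-valued bilinear map `b`: the sum of `b (e_i) (e_i)` over an
orthonormal basis of `L`. -/
def traceOn (B : V →L[ℝ] V →L[ℝ] ℝ) (L : Submodule ℝ V) {W : Type*} [AddCommGroup W]
    (b : V → V → W) : W :=
  ∑ i, b (frameOf B L i) (frameOf B L i)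

end Frames

/-! ## Riemannian geometry of a manifold without boundary

The tangent space at `p` is the model vector space, a tangent vector being identified with its
coordinates in the preferred chart at `p`. All quantities at `p` are computed in that chart. -/

section Intrinsic

variable {E : Type*} [NormedAddCommGroup E] [NormedSpace ℝ E]
  {H : Type*} [TopologicalSpace H] (I : ModelWithCorners ℝ E H)
  {M : Type*} [TopologicalSpace M] [ChartedSpace H M]
  (g : ∀ p : M, TangentSpace I p →L[ℝ] TangentSpace I p →L[ℝ] ℝ)

/-- The Gram form of `g` in the preferred chart at `p`: the pullback of `g` under the inverse
of the chart. -/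
def chartMetric (p : M) (y : E) : E →L[ℝ] E →L[ℝ] ℝ :=
  pullback (E := E) (F := E) (g ((extChartAt I p).symm y))
    (mfderivWithin 𝓘(ℝ, E) I (extChartAt I p).symm (Set.range I) y)

/-- The Riemann curvature `R(u, v) w` of `g` at `p`. -/
def curvature (p : M) (u v w : TangentSpace I p) : TangentSpace I p :=
  coordCurvature (E := E) (chartMetric I g p) (extChartAt I p p) u v w

/-- The sectional curvature of the plane spanned by `u` and `v`. -/
def sectional (p : M) (u v : TangentSpace I p) : ℝ :=
  g p (curvature I g p u v v) u / (g p u u * g p v v - g p u v ^ 2)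

/-- The scalar curvature `∑_{i < j} K(e_i ∧ e_j)` of a subspace `L` of the tangent space, where
`(e_i)` is an orthonormal basis of `L` and `K` is the sectional curvature of the manifold. -/
def scalarOn (p : M) (L : Submodule ℝ (TangentSpace I p)) : ℝ :=
  ∑ i, ∑ j ∈ Finset.Ioi i, sectional I g p (frameOf (g p) L i) (frameOf (g p) L j)

/-- The first Chen invariant of a subspace `L` of the tangent space: the scalar curvature of `L`
minus the infimum of the sectional curvatures of the planes in `L`. For `L = ⊤` it is the first
Chen invariant of the manifold at `p`. -/
def chenInvariant (p : M) (L : Submodule ℝ (TangentSpace I p)) : ℝ :=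
  scalarOn I g p L - sInf {κ : ℝ | ∃ u ∈ L, ∃ v ∈ L,
    LinearIndependent ℝ ![u, v] ∧ κ = sectional I g p u v}

/-- The manifold has constant sectional curvature `c`. -/
def IsSpaceForm (c : ℝ) : Prop :=
  ∀ (p : M) (u v : TangentSpace I p), LinearIndependent ℝ ![u, v] → sectional I g p u v = c

/-- The Hessian `u (v ψ) - (∇_u v) ψ` of a function at `p`. -/
def hessian (ψ : M → ℝ) (p : M) (u v : TangentSpace I p) : ℝ :=
  fderiv ℝ (fun z ↦ fderiv ℝ (ψ ∘ (extChartAt I p).symm) z v) (extChartAt I p p) u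
    - fderiv ℝ (ψ ∘ (extChartAt I p).symm) (extChartAt I p p)
        (christoffel (chartMetric I g p) (extChartAt I p p) u v)

/-- The Laplacian with the sign convention `Δψ = ∑ ((∇_{e_i} e_i) ψ - e_i e_i ψ)`. -/
def laplacian (ψ : M → ℝ) (p : M) : ℝ :=
  -traceOn (g p) ⊤ (hessian I g ψ p)

end Intrinsic

/-! ## Isometric immersions -/

section Immersion

variable {E : Type*} [NormedAddCommGroup E] [NormedSpace ℝ E]
  {H : Type*} [TopologicalSpace H] (I : ModelWithCorners ℝ E H)
  {M : Type*} [TopologicalSpace M] [ChartedSpace H M]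
  (g : ∀ p : M, TangentSpace I p →L[ℝ] TangentSpace I p →L[ℝ] ℝ)
  {E' : Type*} [NormedAddCommGroup E'] [NormedSpace ℝ E']
  {H' : Type*} [TopologicalSpace H'] (I' : ModelWithCorners ℝ E' H')
  {M' : Type*} [TopologicalSpace M'] [ChartedSpace H' M']
  (g' : ∀ p : M', TangentSpace I' p →L[ℝ] TangentSpace I' p →L[ℝ] ℝ)
  (φ : M → M')

/-- `φ` is a smooth isometric immersion of `(M, g)` into `(M', g')`. -/
def IsIsometricImmersion : Prop :=
  ContMDiff I I' ∞ φ ∧ ∀ (x : M) (u v : TangentSpace I x),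
    g' (φ x) (mfderiv I I' φ x u) (mfderiv I I' φ x v) = g x u v

/-- The second fundamental form, by the Gauss formula
`h(u, v) = ∇'_u (dφ v) - dφ (∇_u v)`, where `∇'` and `∇` are the Levi-Civita connections of `g'`
and `g`, evaluated in the preferred charts at `x` and `φ x`. -/
def secondFundamentalForm (x : M) (u v : TangentSpace I x) : TangentSpace I' (φ x) :=
  letI F : E → E' := writtenInExtChartAt I I' x φ
  letI y : E := extChartAt I x x
  (fderiv ℝ (fun z ↦ fderiv ℝ F z v) y u
    + christoffel (chartMetric I' g' (φ x)) (F y) (fderiv ℝ F y u) (fderiv ℝ F y v)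
    - fderiv ℝ F y (christoffel (chartMetric I g x) y u v) : E')

/-- The mean curvature vector `H = (1/n) ∑ h(e_i, e_i)`, with `n` the dimension of `M`. -/
def meanCurvature (x : M) : TangentSpace I' (φ x) :=
  (1 / (Module.finrank ℝ E : ℝ)) •
    traceOn (g x) ⊤ (secondFundamentalForm I g I' g' φ x)

/-- The normal space at `x`: the vectors orthogonal to the image of the differential of `φ`. -/
def normalSpace (x : M) : Submodule ℝ (TangentSpace I' (φ x)) where
  carrier := {ξ | ∀ u : TangentSpace I x, g' (φ x) (mfderiv I I' φ x u) ξ = 0}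
  add_mem' := fun ha hb u ↦ by rw [map_add, ha u, hb u, add_zero]
  zero_mem' := fun u ↦ map_zero _
  smul_mem' := fun c a ha u ↦ by rw [map_smul, ha u, smul_zero]

/-- The matrix `(g'(h(e_i, e_j), ξ))` of the shape operator `A_ξ`, which is defined by
`g(A_ξ X, Y) = g'(h(X, Y), ξ)`, in an orthonormal basis `e` of the tangent space. -/
def shapeMatrix (x : M) {ι : Type*} (e : ι → TangentSpace I x) (ξ : TangentSpace I' (φ x)) :
    Matrix ι ι ℝ :=
  Matrix.of fun i j ↦ g' (φ x) (secondFundamentalForm I g I' g' φ x (e i) (e j)) ξ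

end Immersion

/-! ## Warped products -/

section Warped

variable {E₁ : Type*} [NormedAddCommGroup E₁] [NormedSpace ℝ E₁]
  {H₁ : Type*} [TopologicalSpace H₁] (I₁ : ModelWithCorners ℝ E₁ H₁)
  {N₁ : Type*} [TopologicalSpace N₁] [ChartedSpace H₁ N₁]
  {E₂ : Type*} [NormedAddCommGroup E₂] [NormedSpace ℝ E₂]
  {H₂ : Type*} [TopologicalSpace H₂] (I₂ : ModelWithCorners ℝ E₂ H₂)
  {N₂ : Type*} [TopologicalSpace N₂] [ChartedSpace H₂ N₂]

/-- The warped product metric `π₁^* g₁ + (f ∘ π₁)² π₂^* g₂` on `N₁ × N₂`. -/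
def warpedMetric (g₁ : ∀ p : N₁, TangentSpace I₁ p →L[ℝ] TangentSpace I₁ p →L[ℝ] ℝ)
    (g₂ : ∀ p : N₂, TangentSpace I₂ p →L[ℝ] TangentSpace I₂ p →L[ℝ] ℝ) (f : N₁ → ℝ)
    (x : N₁ × N₂) :
    TangentSpace (I₁.prod I₂) x →L[ℝ] TangentSpace (I₁.prod I₂) x →L[ℝ] ℝ :=
  pullback (E := E₁ × E₂) (F := E₁) (g₁ x.1) (mfderiv (I₁.prod I₂) I₁ Prod.fst x)
    + f x.1 ^ 2 •
      pullback (E := E₁ × E₂) (F := E₂) (g₂ x.2) (mfderiv (I₁.prod I₂) I₂ Prod.snd x)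

/-- The tangent space of the first factor `N₁`, as a subspace of the tangent space of
`N₁ × N₂`. -/
def leaf (x : N₁ × N₂) : Submodule ℝ (TangentSpace (I₁.prod I₂) x) :=
  LinearMap.ker (mfderiv (I₁.prod I₂) I₂ Prod.snd x).toLinearMap

/-- The tangent space of the second factor `N₂`, as a subspace of the tangent space of
`N₁ × N₂`. -/
def fiber (x : N₁ × N₂) : Submodule ℝ (TangentSpace (I₁.prod I₂) x) :=
  LinearMap.ker (mfderiv (I₁.prod I₂) I₁ Prod.fst x).toLinearMap

end Warped

/-- The `k × k` matrix with upper left `2 × 2` corner `(μ₁, a; a, μ₂)`, with all remaining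
diagonal entries equal to `μ` and with all other entries zero. -/
def cornerMatrix (k : ℕ) (μ₁ μ₂ a μ : ℝ) : Matrix (Fin k) (Fin k) ℝ :=
  Matrix.of fun i j ↦
    if i.val = 0 ∧ j.val = 0 then μ₁
    else if i.val = 1 ∧ j.val = 1 then μ₂
    else if (i.val = 0 ∧ j.val = 1) ∨ (i.val = 1 ∧ j.val = 0) then a
    else if i = j then μ else 0

/-- The distinguished diagonal block of the `r`-th shape operator, `r = 0` being the first normal
direction: there the remaining diagonal entries are `μ₁ + μ₂`; for the other normal directions
the corner has trace zero and the remaining entries vanish. -/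
def IsCornerBlock {k : ℕ} (r : ℕ) (P : Matrix (Fin k) (Fin k) ℝ) : Prop :=
  if r = 0 then ∃ μ₁ μ₂ a : ℝ, P = cornerMatrix k μ₁ μ₂ a (μ₁ + μ₂)
  else ∃ b a : ℝ, P = cornerMatrix k b (-b) a 0

/-! ## The equality case for an immersed warped product -/

section Submanifold

variable {n₁ n₂ m : ℕ}
  {N₁ : Type*} [TopologicalSpace N₁] [ChartedSpace (EuclideanSpace ℝ (Fin n₁)) N₁]
  {N₂ : Type*} [TopologicalSpace N₂] [ChartedSpace (EuclideanSpace ℝ (Fin n₂)) N₂]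
  {M' : Type*} [TopologicalSpace M'] [ChartedSpace (EuclideanSpace ℝ (Fin m)) M']
  (g : ∀ x : N₁ × N₂, TangentSpace ((𝓡 n₁).prod (𝓡 n₂)) x →L[ℝ]
    TangentSpace ((𝓡 n₁).prod (𝓡 n₂)) x →L[ℝ] ℝ)
  (g' : ∀ p : M', TangentSpace (𝓡 m) p →L[ℝ] TangentSpace (𝓡 m) p →L[ℝ] ℝ)
  (φ : N₁ × N₂ → M') (x : N₁ × N₂)

/-- `e₁`, `e₂` and `ξ` are orthonormal bases of the tangent spaces of the two factors and of the
normal space at `x`. -/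
def IsAdaptedFrame (e₁ : Fin n₁ → TangentSpace ((𝓡 n₁).prod (𝓡 n₂)) x)
    (e₂ : Fin n₂ → TangentSpace ((𝓡 n₁).prod (𝓡 n₂)) x)
    (ξ : Fin (m - (n₁ + n₂)) → TangentSpace (𝓡 m) (φ x)) : Prop :=
  IsFrame (g x) (leaf (𝓡 n₁) (𝓡 n₂) x) e₁ ∧ IsFrame (g x) (fiber (𝓡 n₁) (𝓡 n₂) x) e₂ ∧
    IsFrame (g' (φ x)) (normalSpace ((𝓡 n₁).prod (𝓡 n₂)) (𝓡 m) g' φ x) ξ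

/-- In the given bases all shape operators are block diagonal, the block of the first factor is a
corner block, and both diagonal blocks have trace zero. -/
def ShapeForms₁ (e₁ : Fin n₁ → TangentSpace ((𝓡 n₁).prod (𝓡 n₂)) x)
    (e₂ : Fin n₂ → TangentSpace ((𝓡 n₁).prod (𝓡 n₂)) x)
    (ξ : Fin (m - (n₁ + n₂)) → TangentSpace (𝓡 m) (φ x)) : Prop :=
  ∀ r : Fin (m - (n₁ + n₂)), ∃ (P : Matrix (Fin n₁) (Fin n₁) ℝ) (Q : Matrix (Fin n₂) (Fin n₂) ℝ),
    shapeMatrix ((𝓡 n₁).prod (𝓡 n₂)) g (𝓡 m) g' φ x (Sum.elim e₁ e₂) (ξ r)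
        = Matrix.fromBlocks P 0 0 Q ∧
      IsCornerBlock r.val P ∧ P.trace = 0 ∧ Q.trace = 0

/-- The same with the corner block in the block of the second factor. -/
def ShapeForms₂ (e₁ : Fin n₁ → TangentSpace ((𝓡 n₁).prod (𝓡 n₂)) x)
    (e₂ : Fin n₂ → TangentSpace ((𝓡 n₁).prod (𝓡 n₂)) x)
    (ξ : Fin (m - (n₁ + n₂)) → TangentSpace (𝓡 m) (φ x)) : Prop :=
  ∀ r : Fin (m - (n₁ + n₂)), ∃ (P : Matrix (Fin n₁) (Fin n₁) ℝ) (Q : Matrix (Fin n₂) (Fin n₂) ℝ),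
    shapeMatrix ((𝓡 n₁).prod (𝓡 n₂)) g (𝓡 m) g' φ x (Sum.elim e₁ e₂) (ξ r)
        = Matrix.fromBlocks P 0 0 Q ∧
      IsCornerBlock r.val Q ∧ P.trace = 0 ∧ Q.trace = 0

/-- `h(X, Z) = 0` at `x` for `X` tangent to the first and `Z` tangent to the second factor. -/
def IsMixedTotallyGeodesicAt : Prop :=
  ∀ u ∈ leaf (𝓡 n₁) (𝓡 n₂) x, ∀ v ∈ fiber (𝓡 n₁) (𝓡 n₂) x,
    secondFundamentalForm ((𝓡 n₁).prod (𝓡 n₂)) g (𝓡 m) g' φ x u v = 0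

/-- The trace of the second fundamental form over the subspace `D` vanishes at `x`. -/
def IsMinimalAlong (D : Submodule ℝ (TangentSpace ((𝓡 n₁).prod (𝓡 n₂)) x)) : Prop :=
  traceOn (g x) D (secondFundamentalForm ((𝓡 n₁).prod (𝓡 n₂)) g (𝓡 m) g' φ x) = 0

/-- At `x` the immersion is mixed totally geodesic, minimal along each factor, and minimal. -/
def IsEqualityGeometry : Prop :=
  IsMixedTotallyGeodesicAt g g' φ x ∧
    IsMinimalAlong g g' φ x (leaf (𝓡 n₁) (𝓡 n₂) x) ∧
    IsMinimalAlong g g' φ x (fiber (𝓡 n₁) (𝓡 n₂) x) ∧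
    meanCurvature ((𝓡 n₁).prod (𝓡 n₂)) g (𝓡 m) g' φ x = 0

/-- `(n²/2) |H|² - n₂ Δf / f + (1/2) k (k + 2 l - 1) c - c` at `x`, where `n = n₁ + n₂`. -/
def chenBound (g₁ : ∀ p : N₁, TangentSpace (𝓡 n₁) p →L[ℝ] TangentSpace (𝓡 n₁) p →L[ℝ] ℝ)
    (f : N₁ → ℝ) (c : ℝ) (k l : ℕ) : ℝ :=
  ((n₁ : ℝ) + n₂) ^ 2 / 2 *
      g' (φ x) (meanCurvature ((𝓡 n₁).prod (𝓡 n₂)) g (𝓡 m) g' φ x)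
        (meanCurvature ((𝓡 n₁).prod (𝓡 n₂)) g (𝓡 m) g' φ x)
    - n₂ * laplacian (𝓡 n₁) g₁ f x.1 / f x.1
    + 1 / 2 * k * ((k : ℝ) + 2 * l - 1) * c - c

end Submanifold

end WarpedChen

end

/-! Take orthonormal bases e_i of T_xN_1 and e_s of T_xN_2 with e_1, e_2 spanning π_1, and let t_1,
t_2 be the traces of h over the two factors. The Gauss equation gives 2τ(T_xN_1) = n_1(n_1-1)c +
|t_1|² - Σ|h(e_i,e_j)|². The warped structure supplies a second relation: K(X∧Z) = -Hess f(X,X)/f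
for unit X, Z tangent to the two factors, so the mixed curvatures add up to n_2 Δf/f, while by Gauss
the same sum is n_1 n_2 c + ⟨t_1,t_2⟩ - Σ|h(e_i,e_s)|². Inserting both into n²|H|² = |t_1+t_2|²
removes the cross term and leaves B_1 - (τ - K(π_1)) as the sum of ½|t_2|², Σ|h(e_i,e_s)|²,
½|h(e_1,e_1)+h(e_2,e_2)|² and ½Σ|h(e_i,e_j)|² over the pairs i, j not both in {1,2}. This is
`IsSplitGauss.defect_eq`; the inequality, the equality case and the vanishing of both traces are
read off from it (`frame_le`, `plane`, `chen`).

Pairing the vanishing conditions with a normal frame gives the shape matrices (`isChenIdeal_iff`).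
The first normal direction turns out not to be special: its block has trace (n_1-1)μ, so trace zero
forces μ = 0. To pass from planes to δ, the infimum must be attained, which holds by compactness of
the set of orthonormal pairs (`exists_min_curv`). The mixed sum is symmetric in the factors, so part
(ii) is the same algebra with the factors exchanged (`swap`) and the same term n_2 Δf/f.

The geometric inputs are proved in coordinates: the Gauss equation (`gauss_equation`), the curvature
of mixed planes (`curvature_mixed`) and that of planes tangent to the leaves (`curvature_leaf`), the
last for the comparison with the intrinsic invariant. `exists_isSplitGauss` collects what the
algebra needs at one point. -/

noncomputable section

namespace WarpedChen

/-! ### Levi-Civita connection and curvature of a metric in coordinates. -/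

section Coordinates

variable {E : Type*} [NormedAddCommGroup E] [NormedSpace ℝ E]

instance bilinNormedAddCommGroup : NormedAddCommGroup (E →L[ℝ] E →L[ℝ] ℝ) :=
  ContinuousLinearMap.toNormedAddCommGroup

instance bilinNormedSpace : NormedSpace ℝ (E →L[ℝ] E →L[ℝ] ℝ) :=
  ContinuousLinearMap.toNormedSpace

instance trilinNormedAddCommGroup : NormedAddCommGroup (E →L[ℝ] E →L[ℝ] E →L[ℝ] ℝ) :=
  ContinuousLinearMap.toNormedAddCommGroup

instance trilinNormedSpace : NormedSpace ℝ (E →L[ℝ] E →L[ℝ] E →L[ℝ] ℝ) :=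
  ContinuousLinearMap.toNormedSpace

instance sharpNormedAddCommGroup : NormedAddCommGroup ((E →L[ℝ] ℝ) →L[ℝ] E) :=
  ContinuousLinearMap.toNormedAddCommGroup

instance sharpNormedSpace : NormedSpace ℝ ((E →L[ℝ] ℝ) →L[ℝ] E) :=
  ContinuousLinearMap.toNormedSpace

/-- `G` is, near `y`, the smooth Gram form of a Riemannian metric. -/
structure IsLocalMetric (G : E → E →L[ℝ] E →L[ℝ] ℝ) (y : E) : Prop where
  smooth : ContDiffAt ℝ 2 G y
  symm : ∀ᶠ z in nhds y, ∀ u v, G z u v = G z v u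
  pos : ∀ᶠ z in nhds y, ∀ u, u ≠ 0 → 0 < G z u u

theorem christoffelFirst_apply (G : E → E →L[ℝ] E →L[ℝ] ℝ) (y u v w : E) :
    christoffelFirst G y u v w =
      (1 / 2 : ℝ) * (fderiv ℝ G y u v w + fderiv ℝ G y v u w - fderiv ℝ G y w u v) := by
  simp [christoffelFirst]

theorem christoffelFirst_add_left (G : E → E →L[ℝ] E →L[ℝ] ℝ) (y u u' v : E) :
    christoffelFirst G y (u + u') v = christoffelFirst G y u v + christoffelFirst G y u' v := by
  ext w
  simp only [christoffelFirst_apply, map_add, add_apply]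
  ring

theorem christoffelFirst_smul_left (G : E → E →L[ℝ] E →L[ℝ] ℝ) (y : E) (t : ℝ) (u v : E) :
    christoffelFirst G y (t • u) v = t • christoffelFirst G y u v := by
  ext w
  simp only [christoffelFirst_apply, map_smul, smul_apply, smul_eq_mul]
  ring

theorem christoffelFirst_add_right (G : E → E →L[ℝ] E →L[ℝ] ℝ) (y u v v' : E) :
    christoffelFirst G y u (v + v') = christoffelFirst G y u v + christoffelFirst G y u v' := by
  ext w
  simp only [christoffelFirst_apply, map_add, add_apply]
  ring

theorem christoffelFirst_smul_right (G : E → E →L[ℝ] E →L[ℝ] ℝ) (y : E) (t : ℝ) (u v : E) :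
    christoffelFirst G y u (t • v) = t • christoffelFirst G y u v := by
  ext w
  simp only [christoffelFirst_apply, map_smul, smul_apply, smul_eq_mul]
  ring

/-- The Christoffel symbols as a bilinear map. -/
def christoffelBilin (G : E → E →L[ℝ] E →L[ℝ] ℝ) (y : E) : E →ₗ[ℝ] E →ₗ[ℝ] E :=
  LinearMap.mk₂ ℝ (christoffel G y)
    (fun u u' v ↦ by simp [christoffel, christoffelFirst_add_left])
    (fun t u v ↦ by simp [christoffel, christoffelFirst_smul_left])
    (fun u v v' ↦ by simp [christoffel, christoffelFirst_add_right])
    (fun t u v ↦ by simp [christoffel, christoffelFirst_smul_right])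

namespace IsLocalMetric

variable {G : E → E →L[ℝ] E →L[ℝ] ℝ} {y : E}

theorem symm_self (hG : IsLocalMetric G y) (u v : E) : G y u v = G y v u :=
  hG.symm.self_of_nhds u v

theorem pos_self (hG : IsLocalMetric G y) (u : E) (hu : u ≠ 0) : 0 < G y u u :=
  hG.pos.self_of_nhds u hu

/-- The conditions are open. Pointwise identities thereby hold on a neighbourhood and may be
differentiated. -/
theorem eventually (hG : IsLocalMetric G y) : ∀ᶠ z in nhds y, IsLocalMetric G z := by
  filter_upwards [hG.smooth.eventually (by simp), hG.symm.eventually_nhds,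
    hG.pos.eventually_nhds] with z h₁ h₂ h₃ using ⟨h₁, h₂, h₃⟩

theorem differentiableAt (hG : IsLocalMetric G y) : DifferentiableAt ℝ G y :=
  hG.smooth.differentiableAt (by simp)

theorem contDiffAt_fderiv (hG : IsLocalMetric G y) : ContDiffAt ℝ 1 (fderiv ℝ G) y :=
  hG.smooth.fderiv_right (by norm_num)

theorem differentiableAt_fderiv (hG : IsLocalMetric G y) : DifferentiableAt ℝ (fderiv ℝ G) y :=
  hG.contDiffAt_fderiv.differentiableAt (by simp)

theorem fderiv_symm (hG : IsLocalMetric G y) (a u v : E) :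
    fderiv ℝ G y a u v = fderiv ℝ G y a v u := by
  have h : (fun z ↦ G z u v) =ᶠ[nhds y] fun z ↦ G z v u := by
    filter_upwards [hG.symm] with z hz using hz u v
  have key (p q : E) : fderiv ℝ (fun z ↦ G z p q) y a = fderiv ℝ G y a p q := by
    have := ((hG.differentiableAt.hasFDerivAt.clm_apply (hasFDerivAt_const p y)).clm_apply
      (hasFDerivAt_const q y)).fderiv
    rw [this]; simp
  rw [← key, ← key, h.fderiv_eq]

theorem christoffelFirst_symm (hG : IsLocalMetric G y) (u v w : E) :
    christoffelFirst G y u v w = christoffelFirst G y v u w := by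
  rw [christoffelFirst_apply, christoffelFirst_apply, hG.fderiv_symm w u v]
  ring

theorem christoffel_symm (hG : IsLocalMetric G y) (u v : E) :
    christoffel G y u v = christoffel G y v u := by
  unfold christoffel
  congr 1
  ext w
  exact hG.christoffelFirst_symm u v w

/-- The metric is parallel. -/
theorem fderiv_eq_christoffelFirst (hG : IsLocalMetric G y) (a u v : E) :
    fderiv ℝ G y a u v = christoffelFirst G y a u v + christoffelFirst G y a v u := by
  rw [christoffelFirst_apply, christoffelFirst_apply, hG.fderiv_symm a v u,
    hG.fderiv_symm v a u, hG.fderiv_symm u a v]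
  ring

/-- Nondegeneracy: vectors such as Christoffel symbols can be identified by testing against every w.
-/
theorem eq_of_apply_eq (hG : IsLocalMetric G y) {u v : E} (h : ∀ w, G y u w = G y v w) :
    u = v := by
  by_contra hne
  have := hG.pos_self (u - v) (sub_ne_zero.mpr hne)
  simp [h] at this

theorem christoffelFirst_differentiableAt (hG : IsLocalMetric G y) (u v : E) :
    DifferentiableAt ℝ (fun z ↦ christoffelFirst G z u v) y := by
  have hD := hG.differentiableAt_fderiv
  have h1 : DifferentiableAt ℝ (fun z ↦ fderiv ℝ G z u v) y :=
    (hD.clm_apply (differentiableAt_const u)).clm_apply (differentiableAt_const v)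
  have h2 : DifferentiableAt ℝ (fun z ↦ fderiv ℝ G z v u) y :=
    (hD.clm_apply (differentiableAt_const v)).clm_apply (differentiableAt_const u)
  have h3 : DifferentiableAt ℝ (fun z ↦ ((fderiv ℝ G z).flip u).flip v) y := by
    have hf : DifferentiableAt ℝ (fun z ↦ (fderiv ℝ G z).flip) y :=
      (ContinuousLinearMap.flipₗᵢ ℝ E E (E →L[ℝ] ℝ)).toContinuousLinearEquiv.differentiableAt.comp
        y hD
    have hf' : DifferentiableAt ℝ (fun z ↦ ((fderiv ℝ G z).flip u).flip) y :=
      (ContinuousLinearMap.flipₗᵢ ℝ E E ℝ).toContinuousLinearEquiv.differentiableAt.comp y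
        (hf.clm_apply (differentiableAt_const u))
    exact hf'.clm_apply (differentiableAt_const v)
  exact ((h1.add h2).sub h3).const_smul (1 / 2 : ℝ)

section

variable [FiniteDimensional ℝ E]

/-- Positivity makes the map to the dual injective, and the dimensions agree. Hence the `inverse` in
`christoffel` is a true inverse and not the default value 0. -/
theorem isInvertible (hG : IsLocalMetric G y) : (G y).IsInvertible := by
  have hinj : Function.Injective (G y : E →ₗ[ℝ] E →L[ℝ] ℝ) := by
    rw [← LinearMap.ker_eq_bot, LinearMap.ker_eq_bot']
    intro u hu
    by_contra hne
    have := hG.pos_self u hne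
    have h0 : G y u = 0 := hu
    simp [h0] at this
  have hdim : Module.finrank ℝ E = Module.finrank ℝ (E →L[ℝ] ℝ) := by
    rw [← (LinearMap.toContinuousLinearMap : (E →ₗ[ℝ] ℝ) ≃ₗ[ℝ] _).finrank_eq]
    exact (Subspace.dual_finrank_eq (K := ℝ) (V := E)).symm
  let e := LinearEquiv.ofInjectiveOfFinrankEq (G y : E →ₗ[ℝ] E →L[ℝ] ℝ) hinj hdim
  exact ⟨e.toContinuousLinearEquiv, by ext u v; rfl⟩

theorem apply_christoffel (hG : IsLocalMetric G y) (u v w : E) :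
    G y (christoffel G y u v) w = christoffelFirst G y u v w := by
  obtain ⟨e, he⟩ := hG.isInvertible
  simp [christoffel, ← he]

theorem christoffel_differentiableAt (hG : IsLocalMetric G y) (u v : E) :
    DifferentiableAt ℝ (fun z ↦ christoffel G z u v) y := by
  obtain ⟨e, he⟩ := hG.isInvertible
  have hinv : DifferentiableAt ℝ (fun z ↦ (G z).inverse) y := by
    have h1 : ContDiffAt ℝ ∞ ContinuousLinearMap.inverse (G y) := he ▸ contDiffAt_map_inverse e
    exact (h1.differentiableAt (by simp)).comp y hG.differentiableAt
  exact hinv.clm_apply (hG.christoffelFirst_differentiableAt u v)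

/-- The curvature with all indices lowered, in terms of Christoffel symbols. -/
theorem apply_coordCurvature (hG : IsLocalMetric G y) (u v w t : E) :
    G y (coordCurvature G y u v w) t =
      fderiv ℝ (fun z ↦ christoffelFirst G z v w t) y u
        - fderiv ℝ (fun z ↦ christoffelFirst G z u w t) y v
        - G y (christoffel G y v w) (christoffel G y u t)
        + G y (christoffel G y u w) (christoffel G y v t) := by
  -- Differentiate G(∇_b c, t) by the product rule and replace the derivative of G through metric
  -- compatibility; the correction G(∇_b c, ∇_a t) is what remains when the index is lowered.
  have key (a b c : E) : fderiv ℝ (fun z ↦ christoffelFirst G z b c t) y a =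
      G y (fderiv ℝ (fun z ↦ christoffel G z b c) y a + christoffel G y a (christoffel G y b c)) t
        + G y (christoffel G y b c) (christoffel G y a t) := by
    have h : (fun z ↦ christoffelFirst G z b c t) =ᶠ[nhds y]
        fun z ↦ G z (christoffel G z b c) t := by
      filter_upwards [hG.eventually] with z hz using (hz.apply_christoffel b c t).symm
    have hd := ((hG.differentiableAt.hasFDerivAt.clm_apply
      (hG.christoffel_differentiableAt b c).hasFDerivAt).clm_apply (hasFDerivAt_const t y)).fderiv
    rw [h.fderiv_eq, hd]
    simp only [ContinuousLinearMap.comp_zero, zero_add, ContinuousLinearMap.flip_apply,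
      add_apply, ContinuousLinearMap.comp_apply, map_add]
    rw [hG.fderiv_eq_christoffelFirst, ← hG.apply_christoffel, ← hG.apply_christoffel,
      hG.symm_self (christoffel G y a t)]
    ring
  rw [key u v w, key v u w]
  simp only [coordCurvature, map_add, map_sub, add_apply,
    sub_apply]
  ring

end

end IsLocalMetric

end Coordinates

/-! ### The Gauss equation for an isometric map between coordinate patches. -/

section GaussEquation

variable {E : Type*} [NormedAddCommGroup E] [NormedSpace ℝ E]
  {E' : Type*} [NormedAddCommGroup E'] [NormedSpace ℝ E']

theorem fderiv_fderiv_apply {F : E → E'} {y : E} (hF : DifferentiableAt ℝ (fderiv ℝ F) y)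
    (u v : E) : fderiv ℝ (fun z ↦ fderiv ℝ F z v) y u = fderiv ℝ (fderiv ℝ F) y u v := by
  rw [(hF.hasFDerivAt.clm_apply (hasFDerivAt_const v y)).fderiv]
  simp

/-- The second fundamental form of `F : (E, G) → (E', G')` at `y`, in coordinates. -/
def coordSecondForm (G : E → E →L[ℝ] E →L[ℝ] ℝ) (G' : E' → E' →L[ℝ] E' →L[ℝ] ℝ) (F : E → E')
    (y u v : E) : E' :=
  fderiv ℝ (fun z ↦ fderiv ℝ F z v) y u
    + christoffel G' (F y) (fderiv ℝ F y u) (fderiv ℝ F y v)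
    - fderiv ℝ F y (christoffel G y u v)

/-- `F` is, near `y`, a smooth isometric map between the local metrics `G` and `G'`. -/
structure IsLocalIsometry (G : E → E →L[ℝ] E →L[ℝ] ℝ) (G' : E' → E' →L[ℝ] E' →L[ℝ] ℝ)
    (F : E → E') (y : E) : Prop where
  source : IsLocalMetric G y
  target : IsLocalMetric G' (F y)
  smooth : ContDiffAt ℝ 3 F y
  isometry : ∀ᶠ z in nhds y, ∀ u v, G' (F z) (fderiv ℝ F z u) (fderiv ℝ F z v) = G z u v

namespace IsLocalIsometry

variable {G : E → E →L[ℝ] E →L[ℝ] ℝ} {G' : E' → E' →L[ℝ] E' →L[ℝ] ℝ} {F : E → E'} {y : E}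

theorem eventually (h : IsLocalIsometry G G' F y) : ∀ᶠ z in nhds y, IsLocalIsometry G G' F z := by
  filter_upwards [h.source.eventually, h.smooth.continuousAt.eventually h.target.eventually,
    h.smooth.eventually (by simp), h.isometry.eventually_nhds] with z h₁ h₂ h₃ h₄
    using ⟨h₁, h₂, h₃, h₄⟩

theorem contDiffAt_fderiv (h : IsLocalIsometry G G' F y) : ContDiffAt ℝ 2 (fderiv ℝ F) y :=
  h.smooth.fderiv_right (by norm_num)

theorem contDiffAt_fderiv_apply (h : IsLocalIsometry G G' F y) (v : E) :
    ContDiffAt ℝ 2 (fun z ↦ fderiv ℝ F z v) y :=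
  h.contDiffAt_fderiv.clm_apply contDiffAt_const

theorem hasFDerivAt (h : IsLocalIsometry G G' F y) : HasFDerivAt F (fderiv ℝ F y) y :=
  (h.smooth.differentiableAt (by simp)).hasFDerivAt

theorem hasFDerivAt_fderiv_apply (h : IsLocalIsometry G G' F y) (v : E) :
    HasFDerivAt (fun z ↦ fderiv ℝ F z v) (fderiv ℝ (fun z ↦ fderiv ℝ F z v) y) y :=
  ((h.contDiffAt_fderiv_apply v).differentiableAt (by simp)).hasFDerivAt

theorem differentiableAt_fderiv (h : IsLocalIsometry G G' F y) :
    DifferentiableAt ℝ (fderiv ℝ F) y :=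
  h.contDiffAt_fderiv.differentiableAt (by simp)

theorem second_symm (h : IsLocalIsometry G G' F y) (u v : E) :
    fderiv ℝ (fun z ↦ fderiv ℝ F z v) y u = fderiv ℝ (fun z ↦ fderiv ℝ F z u) y v := by
  rw [fderiv_fderiv_apply h.differentiableAt_fderiv, fderiv_fderiv_apply h.differentiableAt_fderiv]
  exact (h.smooth.isSymmSndFDerivAt (by simp; norm_num)) u v

theorem hasFDerivAt_second (h : IsLocalIsometry G G' F y) (v w : E) :
    HasFDerivAt (fun z ↦ fderiv ℝ (fun s ↦ fderiv ℝ F s w) z v)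
      (fderiv ℝ (fun z ↦ fderiv ℝ (fun s ↦ fderiv ℝ F s w) z v) y) y := by
  have : ContDiffAt ℝ 1 (fderiv ℝ fun s ↦ fderiv ℝ F s w) y :=
    (h.contDiffAt_fderiv_apply w).fderiv_right (by norm_num)
  exact ((this.clm_apply contDiffAt_const).differentiableAt (by simp)).hasFDerivAt

/-- Third derivatives of F enter the curvature only antisymmetrized in u and v, so this symmetry
cancels them. -/
theorem third_symm (h : IsLocalIsometry G G' F y) (u v w : E) :
    fderiv ℝ (fun z ↦ fderiv ℝ (fun s ↦ fderiv ℝ F s w) z v) y u =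
      fderiv ℝ (fun z ↦ fderiv ℝ (fun s ↦ fderiv ℝ F s w) z u) y v := by
  have hw := h.contDiffAt_fderiv_apply w
  have hd : DifferentiableAt ℝ (fderiv ℝ fun s ↦ fderiv ℝ F s w) y :=
    ((hw.fderiv_right (m := 1) (by norm_num)).differentiableAt (by simp))
  rw [fderiv_fderiv_apply hd, fderiv_fderiv_apply hd]
  exact (hw.isSymmSndFDerivAt (by simp)) u v

theorem fderiv_metric (h : IsLocalIsometry G G' F y) (a u v : E) :
    fderiv ℝ G y a u v =
      fderiv ℝ G' (F y) (fderiv ℝ F y a) (fderiv ℝ F y u) (fderiv ℝ F y v)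
        + G' (F y) (fderiv ℝ (fun z ↦ fderiv ℝ F z u) y a) (fderiv ℝ F y v)
        + G' (F y) (fderiv ℝ F y u) (fderiv ℝ (fun z ↦ fderiv ℝ F z v) y a) := by
  have e : (fun z ↦ G z u v) =ᶠ[nhds y]
      fun z ↦ G' (F z) (fderiv ℝ F z u) (fderiv ℝ F z v) := by
    filter_upwards [h.isometry] with z hz using (hz u v).symm
  have h₁ := ((h.source.differentiableAt.hasFDerivAt.clm_apply (hasFDerivAt_const u y)).clm_apply
    (hasFDerivAt_const v y)).fderiv
  have hG' : HasFDerivAt (fun z ↦ G' (F z)) ((fderiv ℝ G' (F y)).comp (fderiv ℝ F y)) y :=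
    h.target.differentiableAt.hasFDerivAt.comp y h.hasFDerivAt
  have h₂ := ((hG'.clm_apply (h.hasFDerivAt_fderiv_apply u)).clm_apply
    (h.hasFDerivAt_fderiv_apply v)).fderiv
  rw [e.fderiv_eq, h₂] at h₁
  have := congrArg (fun L : E →L[ℝ] ℝ ↦ L a) h₁
  simp only [ContinuousLinearMap.comp_zero, zero_add, ContinuousLinearMap.flip_apply,
      add_apply, ContinuousLinearMap.comp_apply] at this
  rw [← this]
  ring

/-- Differentiating the isometry condition puts six second-derivative terms into the Koszul
combination; by symmetry four cancel and the other two coincide. -/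
theorem christoffelFirst_eq (h : IsLocalIsometry G G' F y) (u v w : E) :
    christoffelFirst G y u v w =
      G' (F y) (fderiv ℝ (fun z ↦ fderiv ℝ F z v) y u) (fderiv ℝ F y w)
        + christoffelFirst G' (F y) (fderiv ℝ F y u) (fderiv ℝ F y v) (fderiv ℝ F y w) := by
  rw [christoffelFirst_apply, christoffelFirst_apply, h.fderiv_metric, h.fderiv_metric,
    h.fderiv_metric, h.second_symm w u, h.second_symm v u, h.second_symm w v,
    h.target.symm_self (fderiv ℝ F y u), h.target.symm_self (fderiv ℝ F y v)
      (fderiv ℝ (fun z ↦ fderiv ℝ F z w) y u)]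
  ring

theorem secondForm_symm (h : IsLocalIsometry G G' F y) (u v : E) :
    coordSecondForm G G' F y u v = coordSecondForm G G' F y v u := by
  unfold coordSecondForm
  rw [h.second_symm, h.source.christoffel_symm, h.target.christoffel_symm]

theorem fderiv_christoffelFirst (h : IsLocalIsometry G G' F y) (u v w t : E) :
    fderiv ℝ (fun z ↦ christoffelFirst G z v w t) y u =
      fderiv ℝ G' (F y) (fderiv ℝ F y u) (fderiv ℝ (fun z ↦ fderiv ℝ F z w) y v) (fderiv ℝ F y t)
      + G' (F y) (fderiv ℝ (fun z ↦ fderiv ℝ (fun s ↦ fderiv ℝ F s w) z v) y u) (fderiv ℝ F y t)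
      + G' (F y) (fderiv ℝ (fun z ↦ fderiv ℝ F z w) y v) (fderiv ℝ (fun z ↦ fderiv ℝ F z t) y u)
      + fderiv ℝ (fun z ↦ christoffelFirst G' z (fderiv ℝ F y v) (fderiv ℝ F y w)
          (fderiv ℝ F y t)) (F y) (fderiv ℝ F y u)
      + christoffelFirst G' (F y) (fderiv ℝ (fun z ↦ fderiv ℝ F z v) y u) (fderiv ℝ F y w)
          (fderiv ℝ F y t)
      + christoffelFirst G' (F y) (fderiv ℝ F y v) (fderiv ℝ (fun z ↦ fderiv ℝ F z w) y u)
          (fderiv ℝ F y t)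
      + christoffelFirst G' (F y) (fderiv ℝ F y v) (fderiv ℝ F y w)
          (fderiv ℝ (fun z ↦ fderiv ℝ F z t) y u) := by
  -- The ambient symbols are unfolded into derivatives of `G'` because the base point and all three
  -- arguments move with z; each contributes a term of the product rule.
  have e : (fun z ↦ christoffelFirst G z v w t) =ᶠ[nhds y] fun z ↦
      G' (F z) (fderiv ℝ (fun s ↦ fderiv ℝ F s w) z v) (fderiv ℝ F z t)
        + (1 / 2 : ℝ) * (fderiv ℝ G' (F z) (fderiv ℝ F z v) (fderiv ℝ F z w) (fderiv ℝ F z t)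
          + fderiv ℝ G' (F z) (fderiv ℝ F z w) (fderiv ℝ F z v) (fderiv ℝ F z t)
          - fderiv ℝ G' (F z) (fderiv ℝ F z t) (fderiv ℝ F z v) (fderiv ℝ F z w)) := by
    filter_upwards [h.eventually] with z hz
    rw [hz.christoffelFirst_eq, christoffelFirst_apply]
  have hG' : HasFDerivAt (fun z ↦ G' (F z)) ((fderiv ℝ G' (F y)).comp (fderiv ℝ F y)) y :=
    h.target.differentiableAt.hasFDerivAt.comp y h.hasFDerivAt
  have hD : HasFDerivAt (fderiv ℝ G') (fderiv ℝ (fderiv ℝ G') (F y)) (F y) :=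
    h.target.differentiableAt_fderiv.hasFDerivAt
  have hD' : HasFDerivAt (fun z ↦ fderiv ℝ G' (F z))
      ((fderiv ℝ (fderiv ℝ G') (F y)).comp (fderiv ℝ F y)) y := hD.comp y h.hasFDerivAt
  have hq (a b c : E) := ((hD'.clm_apply (h.hasFDerivAt_fderiv_apply a)).clm_apply
    (h.hasFDerivAt_fderiv_apply b)).clm_apply (h.hasFDerivAt_fderiv_apply c)
  have hc (a b c : E') := ((hD.clm_apply (hasFDerivAt_const a _)).clm_apply
    (hasFDerivAt_const b _)).clm_apply (hasFDerivAt_const c _)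
  have h₁ := ((hG'.clm_apply (h.hasFDerivAt_second v w)).clm_apply
    (h.hasFDerivAt_fderiv_apply t)).add
      ((((hq v w t).add (hq w v t)).sub (hq t v w)).const_mul (1 / 2 : ℝ))
  have h₂ := ((((hc (fderiv ℝ F y v) (fderiv ℝ F y w) (fderiv ℝ F y t)).add
    (hc (fderiv ℝ F y w) (fderiv ℝ F y v) (fderiv ℝ F y t))).sub
    (hc (fderiv ℝ F y t) (fderiv ℝ F y v) (fderiv ℝ F y w))).const_mul
      (1 / 2 : ℝ)).congr_of_eventuallyEq
        (.of_forall fun z ↦ christoffelFirst_apply G' z (fderiv ℝ F y v) (fderiv ℝ F y w)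
          (fderiv ℝ F y t))
  rw [h₂.fderiv, (h₁.congr_of_eventuallyEq e).fderiv]
  simp only [ContinuousLinearMap.comp_zero, zero_add, ContinuousLinearMap.flip_apply, add_apply,
    sub_apply, smul_apply, smul_eq_mul, ContinuousLinearMap.comp_apply, christoffelFirst_apply]
  ring

variable [FiniteDimensional ℝ E] [FiniteDimensional ℝ E']

/-- By `christoffelFirst_eq` the tangential part of the ambient derivative is the intrinsic one,
which the second fundamental form subtracts. -/
theorem secondForm_normal (h : IsLocalIsometry G G' F y) (u v w : E) :
    G' (F y) (fderiv ℝ F y w) (coordSecondForm G G' F y u v) = 0 := by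
  rw [h.target.symm_self]
  simp only [coordSecondForm, map_sub, map_add, add_apply, sub_apply]
  rw [h.isometry.self_of_nhds, h.source.apply_christoffel, h.target.apply_christoffel,
    h.christoffelFirst_eq]
  ring

/-- The Gauss equation in coordinates. -/
theorem gauss_equation (h : IsLocalIsometry G G' F y) (u v w t : E) :
    G y (coordCurvature G y u v w) t =
      G' (F y) (coordCurvature G' (F y) (fderiv ℝ F y u) (fderiv ℝ F y v) (fderiv ℝ F y w))
          (fderiv ℝ F y t)
        + G' (F y) (coordSecondForm G G' F y v w) (coordSecondForm G G' F y u t)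
        - G' (F y) (coordSecondForm G G' F y u w) (coordSecondForm G G' F y v t) := by
  -- Pythagoras: h is the ambient derivative minus its tangential part and is normal, so ⟨h,h⟩ is
  -- the ambient product minus the product of the intrinsic derivatives.
  have hh (a b c d : E) : G' (F y) (coordSecondForm G G' F y a b) (coordSecondForm G G' F y c d)
      = G' (F y) (fderiv ℝ (fun z ↦ fderiv ℝ F z b) y a) (fderiv ℝ (fun z ↦ fderiv ℝ F z d) y c)
        + christoffelFirst G' (F y) (fderiv ℝ F y a) (fderiv ℝ F y b)
            (fderiv ℝ (fun z ↦ fderiv ℝ F z d) y c)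
        + christoffelFirst G' (F y) (fderiv ℝ F y c) (fderiv ℝ F y d)
            (fderiv ℝ (fun z ↦ fderiv ℝ F z b) y a)
        + G' (F y) (christoffel G' (F y) (fderiv ℝ F y a) (fderiv ℝ F y b))
            (christoffel G' (F y) (fderiv ℝ F y c) (fderiv ℝ F y d))
        - G y (christoffel G y a b) (christoffel G y c d) := by
    have h₀ := h.secondForm_normal a b (christoffel G y c d)
    have h₁ : coordSecondForm G G' F y c d = fderiv ℝ (fun z ↦ fderiv ℝ F z d) y c
        + christoffel G' (F y) (fderiv ℝ F y c) (fderiv ℝ F y d)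
        - fderiv ℝ F y (christoffel G y c d) := rfl
    have h₂ := h.secondForm_normal c d (christoffel G y a b)
    rw [h.target.symm_self] at h₀
    rw [h₁, map_sub, h₀, sub_zero]
    rw [h₁, map_sub, h.isometry.self_of_nhds] at h₂
    simp only [coordSecondForm, map_add, map_sub, add_apply, sub_apply] at h₂ ⊢
    rw [← h.target.apply_christoffel, ← h.target.apply_christoffel,
      h.target.symm_self (christoffel G' (F y) (fderiv ℝ F y c) (fderiv ℝ F y d))]
    linarith
  -- With both curvatures lowered and the third derivatives matched, metric compatibility of the
  -- target turns the claim into a linear identity in the remaining terms.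
  rw [h.source.apply_coordCurvature, h.target.apply_coordCurvature, hh, hh,
    h.fderiv_christoffelFirst, h.fderiv_christoffelFirst, h.third_symm u v w, h.second_symm v u,
    h.target.fderiv_eq_christoffelFirst, h.target.fderiv_eq_christoffelFirst]
  ring

end IsLocalIsometry

end GaussEquation

/-! ### Connection and curvature of a warped product in coordinates. -/

section WarpedCoordinates

variable {E₁ : Type*} [NormedAddCommGroup E₁] [NormedSpace ℝ E₁]
  {E₂ : Type*} [NormedAddCommGroup E₂] [NormedSpace ℝ E₂]

/-- Near `y`, the local metric `G` is the warped product of `G₁` and `G₂` with warping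
function `F`. -/
structure IsLocalWarped (G : E₁ × E₂ → E₁ × E₂ →L[ℝ] E₁ × E₂ →L[ℝ] ℝ)
    (G₁ : E₁ → E₁ →L[ℝ] E₁ →L[ℝ] ℝ) (G₂ : E₂ → E₂ →L[ℝ] E₂ →L[ℝ] ℝ) (F : E₁ → ℝ)
    (y : E₁ × E₂) : Prop where
  fst : IsLocalMetric G₁ y.1
  snd : IsLocalMetric G₂ y.2
  smooth : ContDiffAt ℝ 2 F y.1
  pos : 0 < F y.1
  apply_eq : ∀ᶠ z in nhds y, ∀ u v,
    G z u v = G₁ z.1 u.1 v.1 + F z.1 ^ 2 * G₂ z.2 u.2 v.2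

/-- In finite dimension a linear map is determined, linearly and continuously in both directions, by
its values on a basis. -/
theorem contDiffAt_clm_of_apply {E P W : Type*} [NormedAddCommGroup E] [NormedSpace ℝ E]
    [NormedAddCommGroup P] [NormedSpace ℝ P] [NormedAddCommGroup W] [NormedSpace ℝ W]
    [FiniteDimensional ℝ E] {n : ℕ∞ω} {L : P → E →L[ℝ] W} {y : P}
    (h : ∀ u, ContDiffAt ℝ n (fun z ↦ L z u) y) : ContDiffAt ℝ n L y := by
  let d := Module.finrank ℝ E
  let e₁ : E ≃L[ℝ] Fin d → ℝ := ContinuousLinearEquiv.ofFinrankEq (Module.finrank_fin_fun ℝ).symm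
  let e₂ := (e₁.arrowCongr (1 : W ≃L[ℝ] W)).trans (ContinuousLinearEquiv.piRing (Fin d))
  rw [← e₂.comp_contDiffAt_iff, contDiffAt_pi]
  exact fun i ↦ h (e₁.symm (Pi.single i 1))

theorem contDiffAt_bilin {E P : Type*} [NormedAddCommGroup E] [NormedSpace ℝ E]
    [NormedAddCommGroup P] [NormedSpace ℝ P] [FiniteDimensional ℝ E] {n : ℕ∞ω}
    {G : P → E →L[ℝ] E →L[ℝ] ℝ} {y : P} (h : ∀ u v, ContDiffAt ℝ n (fun z ↦ G z u v) y) :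
    ContDiffAt ℝ n G y :=
  contDiffAt_clm_of_apply fun u ↦ contDiffAt_clm_of_apply fun v ↦ h u v

namespace IsLocalWarped

variable {G : E₁ × E₂ → E₁ × E₂ →L[ℝ] E₁ × E₂ →L[ℝ] ℝ}
  {G₁ : E₁ → E₁ →L[ℝ] E₁ →L[ℝ] ℝ} {G₂ : E₂ → E₂ →L[ℝ] E₂ →L[ℝ] ℝ} {F : E₁ → ℝ}
  {y : E₁ × E₂}

theorem eventually (h : IsLocalWarped G G₁ G₂ F y) :
    ∀ᶠ z in nhds y, IsLocalWarped G G₁ G₂ F z := by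
  filter_upwards [continuous_fst.continuousAt.eventually h.fst.eventually,
    continuous_snd.continuousAt.eventually h.snd.eventually,
    continuous_fst.continuousAt.eventually (h.smooth.eventually (by simp)),
    continuous_fst.continuousAt.eventually 
      (h.smooth.continuousAt.eventually (lt_mem_nhds h.pos)),
    h.apply_eq.eventually_nhds] with z h₁ h₂ h₃ h₄ h₅ using ⟨h₁, h₂, h₃, h₄, h₅⟩

theorem hasFDerivAt_warping (h : IsLocalWarped G G₁ G₂ F y) :
    HasFDerivAt (fun z : E₁ × E₂ ↦ F z.1)
      ((fderiv ℝ F y.1).comp (ContinuousLinearMap.fst ℝ E₁ E₂)) y :=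
  (h.smooth.differentiableAt (by simp)).hasFDerivAt.comp y hasFDerivAt_fst

section

variable [FiniteDimensional ℝ E₁] [FiniteDimensional ℝ E₂]

theorem isLocalMetric (h : IsLocalWarped G G₁ G₂ F y) : IsLocalMetric G y where
  smooth := by
    refine contDiffAt_bilin fun u v ↦ ?_
    have e : (fun z ↦ G z u v) =ᶠ[nhds y]
        fun z ↦ G₁ z.1 u.1 v.1 + F z.1 ^ 2 * G₂ z.2 u.2 v.2 := by
      filter_upwards [h.apply_eq] with z hz using hz u v
    refine ContDiffAt.congr_of_eventuallyEq ?_ e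
    have h₁ : ContDiffAt ℝ 2 (fun z : E₁ × E₂ ↦ G₁ z.1) y := h.fst.smooth.comp y contDiffAt_fst
    have h₂ : ContDiffAt ℝ 2 (fun z : E₁ × E₂ ↦ G₂ z.2) y := h.snd.smooth.comp y contDiffAt_snd
    have h₃ : ContDiffAt ℝ 2 (fun z : E₁ × E₂ ↦ F z.1) y := h.smooth.comp y contDiffAt_fst
    exact ((h₁.clm_apply contDiffAt_const).clm_apply contDiffAt_const).add
      ((h₃.pow 2).mul ((h₂.clm_apply contDiffAt_const).clm_apply contDiffAt_const))
  symm := by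
    filter_upwards [h.eventually] with z hz u v
    rw [hz.apply_eq.self_of_nhds, hz.apply_eq.self_of_nhds, hz.fst.symm_self, hz.snd.symm_self]
  pos := by
    filter_upwards [h.eventually] with z hz u hu
    rw [hz.apply_eq.self_of_nhds]
    have hF : 0 < F z.1 ^ 2 := pow_pos hz.pos 2
    have nonneg₁ : 0 ≤ G₁ z.1 u.1 u.1 := by
      rcases eq_or_ne u.1 0 with h0 | h0
      · simp [h0]
      · exact (hz.fst.pos_self _ h0).le
    rcases eq_or_ne u.2 0 with h0 | h0
    · have h1 : u.1 ≠ 0 := fun h1 ↦ hu (Prod.ext h1 h0)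
      have := hz.fst.pos_self _ h1
      simpa [h0] using this
    · have := mul_pos hF (hz.snd.pos_self _ h0)
      linarith

theorem fderiv_apply (h : IsLocalWarped G G₁ G₂ F y) (a u v : E₁ × E₂) :
    fderiv ℝ G y a u v = fderiv ℝ G₁ y.1 a.1 u.1 v.1
      + 2 * F y.1 * fderiv ℝ F y.1 a.1 * G₂ y.2 u.2 v.2
      + F y.1 ^ 2 * fderiv ℝ G₂ y.2 a.2 u.2 v.2 := by
  have e : (fun z ↦ G z u v) =ᶠ[nhds y]
      fun z ↦ G₁ z.1 u.1 v.1 + F z.1 ^ 2 * G₂ z.2 u.2 v.2 := by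
    filter_upwards [h.apply_eq] with z hz using hz u v
  have h₀ := ((h.isLocalMetric.differentiableAt.hasFDerivAt.clm_apply
    (hasFDerivAt_const u y)).clm_apply (hasFDerivAt_const v y)).fderiv
  have h₁ : HasFDerivAt (fun z : E₁ × E₂ ↦ G₁ z.1)
      ((fderiv ℝ G₁ y.1).comp (ContinuousLinearMap.fst ℝ E₁ E₂)) y :=
    h.fst.differentiableAt.hasFDerivAt.comp y hasFDerivAt_fst
  have h₂ : HasFDerivAt (fun z : E₁ × E₂ ↦ G₂ z.2)
      ((fderiv ℝ G₂ y.2).comp (ContinuousLinearMap.snd ℝ E₁ E₂)) y :=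
    h.snd.differentiableAt.hasFDerivAt.comp y hasFDerivAt_snd
  have h₄ := ((h₁.clm_apply (hasFDerivAt_const u.1 y)).clm_apply (hasFDerivAt_const v.1 y)).add
    ((h.hasFDerivAt_warping.pow 2).mul
      ((h₂.clm_apply (hasFDerivAt_const u.2 y)).clm_apply (hasFDerivAt_const v.2 y)))
  rw [(h₄.congr_of_eventuallyEq e).fderiv] at h₀
  have := congrArg (fun L : E₁ × E₂ →L[ℝ] ℝ ↦ L a) h₀
  simp only [ContinuousLinearMap.comp_zero, zero_add, ContinuousLinearMap.flip_apply,
    add_apply, smul_apply, ContinuousLinearMap.comp_apply, ContinuousLinearMap.coe_fst',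
    ContinuousLinearMap.coe_snd', smul_eq_mul] at this
  rw [← this]
  simp
  ring

/-- The last group comes from the derivative 2F dF of the factor F²; it is the only interaction
between the two factors. -/
theorem christoffelFirst_apply (h : IsLocalWarped G G₁ G₂ F y) (u v w : E₁ × E₂) :
    christoffelFirst G y u v w = christoffelFirst G₁ y.1 u.1 v.1 w.1
      + F y.1 ^ 2 * christoffelFirst G₂ y.2 u.2 v.2 w.2
      + F y.1 * (fderiv ℝ F y.1 u.1 * G₂ y.2 v.2 w.2 + fderiv ℝ F y.1 v.1 * G₂ y.2 u.2 w.2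
        - fderiv ℝ F y.1 w.1 * G₂ y.2 u.2 v.2) := by
  simp only [WarpedChen.christoffelFirst_apply, h.fderiv_apply]
  ring

theorem christoffel_leaf_leaf (h : IsLocalWarped G G₁ G₂ F y) (u v : E₁) :
    christoffel G y (u, 0) (v, 0) = (christoffel G₁ y.1 u v, 0) := by
  refine h.isLocalMetric.eq_of_apply_eq fun w ↦ ?_
  rw [h.isLocalMetric.apply_christoffel, h.christoffelFirst_apply, h.apply_eq.self_of_nhds]
  have : christoffelFirst G₂ y.2 0 0 = 0 := by simp [christoffelFirst]
  simp [h.fst.apply_christoffel, this]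

theorem christoffel_leaf_fiber (h : IsLocalWarped G G₁ G₂ F y) (u : E₁) (w : E₂) :
    christoffel G y (u, 0) (0, w) = (0, (fderiv ℝ F y.1 u / F y.1) • w) := by
  refine h.isLocalMetric.eq_of_apply_eq fun t ↦ ?_
  rw [h.isLocalMetric.apply_christoffel, h.christoffelFirst_apply, h.apply_eq.self_of_nhds]
  have h₂ : christoffelFirst G₂ y.2 0 w = 0 := by ext; simp [WarpedChen.christoffelFirst_apply]
  have h₁ : christoffelFirst G₁ y.1 u 0 = 0 := by ext; simp [WarpedChen.christoffelFirst_apply]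
  have := h.pos.ne'
  simp [h₁, h₂]
  field_simp

/-- The leaves of a warped product are totally geodesic: the curvature of the leaves. -/
theorem curvature_leaf (h : IsLocalWarped G G₁ G₂ F y) (u v w t : E₁) :
    G y (coordCurvature G y (u, 0) (v, 0) (w, 0)) (t, 0) =
      G₁ y.1 (coordCurvature G₁ y.1 u v w) t := by
  have key (a b c : E₁) :
      fderiv ℝ (fun z ↦ christoffelFirst G z (b, 0) (c, 0) (t, 0)) y (a, 0) =
        fderiv ℝ (fun z ↦ christoffelFirst G₁ z b c t) y.1 a := by
    have e : (fun z ↦ christoffelFirst G z (b, 0) (c, 0) (t, 0)) =ᶠ[nhds y]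
        (fun z ↦ christoffelFirst G₁ z b c t) ∘ Prod.fst := by
      filter_upwards [h.eventually] with z hz
      rw [hz.christoffelFirst_apply]
      simp
    have hd : DifferentiableAt ℝ (fun z ↦ christoffelFirst G₁ z b c t) y.1 :=
      (h.fst.christoffelFirst_differentiableAt b c).clm_apply (differentiableAt_const t)
    rw [e.fderiv_eq, (hd.hasFDerivAt.comp y hasFDerivAt_fst).fderiv]
    simp
  rw [h.isLocalMetric.apply_coordCurvature, h.fst.apply_coordCurvature, key, key]
  simp [h.christoffel_leaf_leaf, h.apply_eq.self_of_nhds]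

/-- The curvature of a mixed plane of a warped product. -/
theorem curvature_mixed (h : IsLocalWarped G G₁ G₂ F y) (u : E₁) (w : E₂) :
    G y (coordCurvature G y (u, 0) (0, w) (0, w)) (u, 0) =
      -(F y.1 * G₂ y.2 w w * (fderiv ℝ (fun z ↦ fderiv ℝ F z u) y.1 u
        - fderiv ℝ F y.1 (christoffel G₁ y.1 u u))) := by
  have hdF : ContDiffAt ℝ 1 (fderiv ℝ F) y.1 := h.smooth.fderiv_right (by norm_num)
  have hdu : HasFDerivAt (fun z : E₁ × E₂ ↦ fderiv ℝ F z.1 u)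
      ((fderiv ℝ (fun z ↦ fderiv ℝ F z u) y.1).comp (ContinuousLinearMap.fst ℝ E₁ E₂)) y :=
    ((hdF.clm_apply contDiffAt_const).differentiableAt (by simp)).hasFDerivAt.comp y
      hasFDerivAt_fst
  have h₂ : HasFDerivAt (fun z : E₁ × E₂ ↦ G₂ z.2)
      ((fderiv ℝ G₂ y.2).comp (ContinuousLinearMap.snd ℝ E₁ E₂)) y :=
    h.snd.differentiableAt.hasFDerivAt.comp y hasFDerivAt_snd
  -- Only the normal component -F dF(u) G₂(w,w) of the fibre derivative is present; its derivative
  -- along u yields the second derivative of F and a square of dF(u).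
  have key₁ : fderiv ℝ (fun z ↦ christoffelFirst G z (0, w) (0, w) (u, 0)) y (u, 0) =
      -(fderiv ℝ F y.1 u ^ 2 * G₂ y.2 w w
        + F y.1 * fderiv ℝ (fun z ↦ fderiv ℝ F z u) y.1 u * G₂ y.2 w w) := by
    have e : (fun z ↦ christoffelFirst G z (0, w) (0, w) (u, 0)) =ᶠ[nhds y]
        fun z ↦ -((F z.1 * fderiv ℝ F z.1 u) * G₂ z.2 w w) := by
      filter_upwards [h.eventually] with z hz
      rw [hz.christoffelFirst_apply]
      have : christoffelFirst G₁ z.1 0 0 = 0 := by ext; simp [WarpedChen.christoffelFirst_apply]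
      simp [this]
      ring
    have hd := ((h.hasFDerivAt_warping.mul hdu).mul
      ((h₂.clm_apply (hasFDerivAt_const w y)).clm_apply (hasFDerivAt_const w y))).neg
    rw [(hd.congr_of_eventuallyEq e).fderiv]
    simp
    ring
  have key₂ : fderiv ℝ (fun z ↦ christoffelFirst G z (u, 0) (0, w) (u, 0)) y (0, w) = 0 := by
    have e : (fun z ↦ christoffelFirst G z (u, 0) (0, w) (u, 0)) =ᶠ[nhds y] fun _ ↦ (0 : ℝ) := by
      filter_upwards [h.eventually] with z hz
      rw [hz.christoffelFirst_apply]
      have : christoffelFirst G₁ z.1 u 0 = 0 := by ext; simp [WarpedChen.christoffelFirst_apply]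
      simp [this]
    rw [e.fderiv_eq]
    simp
  have hzero : christoffelFirst G₁ y.1 0 0 = 0 := by ext; simp [WarpedChen.christoffelFirst_apply]
  -- The product of the mixed symbols (dF(u)/F) w cancels the square from `key₁`, and the product of
  -- the two pure ones supplies the connection term of the Hessian.
  rw [h.isLocalMetric.apply_coordCurvature, key₁, key₂,
    h.isLocalMetric.christoffel_symm (0, w) (u, 0), h.isLocalMetric.apply_christoffel,
    h.christoffel_leaf_leaf, h.christoffel_leaf_fiber, h.christoffelFirst_apply,
    h.apply_eq.self_of_nhds]
  have := h.pos.ne'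
  simp [hzero]
  field_simp
  ring

end

end IsLocalWarped

end WarpedCoordinates

/-! ### Orthonormal frames and traces for a bilinear form. -/

section InnerProducts

theorem range_fin_append {α : Type*} {k l : ℕ} (f : Fin k → α) (f' : Fin l → α) :
    Set.range (Fin.append f f') = Set.range f ∪ Set.range f' := by
  ext w
  constructor
  · rintro ⟨i, rfl⟩
    induction i using Fin.addCases with
    | left i => exact Or.inl ⟨i, by rw [Fin.append_left]⟩
    | right i => exact Or.inr ⟨i, by rw [Fin.append_right]⟩
  · rintro (⟨i, rfl⟩ | ⟨i, rfl⟩)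
    · exact ⟨Fin.castAdd l i, by rw [Fin.append_left]⟩
    · exact ⟨Fin.natAdd k i, by rw [Fin.append_right]⟩

/-- Concatenate orthonormal bases of P and of its orthogonal complement inside L. With P a plane
this makes the first two vectors span it. -/
theorem exists_orthonormal_adapted {V : Type*} [NormedAddCommGroup V] [InnerProductSpace ℝ V]
    [FiniteDimensional ℝ V] {P L : Submodule ℝ V} (hPL : P ≤ L) {k : ℕ}
    (hk : Module.finrank ℝ L = k) :
    ∃ e : Fin k → V, Orthonormal ℝ e ∧ Submodule.span ℝ (Set.range e) = L ∧
      Submodule.span ℝ (e '' {i | i.val < Module.finrank ℝ P}) = P := by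
  set j := Module.finrank ℝ P
  have hd : j + Module.finrank ℝ (Pᗮ ⊓ L : Submodule ℝ V) = k :=
    hk ▸ Submodule.finrank_add_inf_finrank_orthogonal hPL
  set l := Module.finrank ℝ (Pᗮ ⊓ L : Submodule ℝ V)
  -- The index type becomes `Fin (j + l)`, as `Fin.append` requires.
  subst hd
  let f := stdOrthonormalBasis ℝ P
  let f' := stdOrthonormalBasis ℝ (Pᗮ ⊓ L : Submodule ℝ V)
  have span_coe {S : Submodule ℝ V} {d : ℕ} (b : OrthonormalBasis (Fin d) ℝ S) :
      Submodule.span ℝ (Set.range fun i ↦ (b i : V)) = S := by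
    have := congrArg (Submodule.map S.subtype) b.toBasis.span_eq
    rw [Submodule.map_span, ← Set.range_comp, Submodule.map_top, Submodule.range_subtype] at this
    simpa [Function.comp_def] using this
  have on_coe {S : Submodule ℝ V} {d : ℕ} (b : OrthonormalBasis (Fin d) ℝ S) (i i' : Fin d) :
      inner ℝ (b i : V) (b i' : V) = if i = i' then 1 else 0 :=
    (orthonormal_iff_ite.mp b.orthonormal) i i'
  have him : Fin.append (fun i ↦ (f i : V)) (fun i ↦ (f' i : V)) '' {i | i.val < j} =
      Set.range fun i ↦ (f i : V) := by
    ext w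
    constructor
    · rintro ⟨i, hi, rfl⟩
      refine ⟨⟨i, hi⟩, ?_⟩
      exact (Fin.append_left (fun i ↦ (f i : V)) (fun i ↦ (f' i : V)) ⟨i, hi⟩).symm
    · rintro ⟨i, rfl⟩
      exact ⟨Fin.castAdd l i, i.2, by rw [Fin.append_left]⟩
  refine ⟨Fin.append (fun i ↦ (f i : V)) (fun i ↦ (f' i : V)), ?_, ?_, ?_⟩
  · rw [orthonormal_iff_ite]
    intro a b
    induction a using Fin.addCases with
    | left a =>
      induction b using Fin.addCases with
      | left b => rw [Fin.append_left, Fin.append_left, on_coe]; simp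
      | right b =>
        rw [Fin.append_left, Fin.append_right,
          Submodule.inner_right_of_mem_orthogonal (f a).2 (f' b).2.1, if_neg]
        intro h
        have := congrArg Fin.val h
        simp at this
        omega
    | right a =>
      induction b using Fin.addCases with
      | left b =>
        rw [Fin.append_left, Fin.append_right,
          Submodule.inner_left_of_mem_orthogonal (f b).2 (f' a).2.1, if_neg]
        intro h
        have := congrArg Fin.val h
        simp at this
        omega
      | right b => rw [Fin.append_right, Fin.append_right, on_coe]; simp
  · rw [range_fin_append, Submodule.span_union, span_coe, span_coe]
    exact Submodule.sup_orthogonal_inf_of_hasOrthogonalProjection hPL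
  · rw [him, span_coe]

variable {V : Type*} [NormedAddCommGroup V] [NormedSpace ℝ V]

/-- `B` is an inner product. -/
structure IsInner (B : V →L[ℝ] V →L[ℝ] ℝ) : Prop where
  symm : ∀ u v, B u v = B v u
  pos : ∀ u, u ≠ 0 → 0 < B u u

/-- The space carries no norm here, so the norm defined by b does not compete with another one; the
conclusion is purely algebraic. -/
theorem exists_frame_of_core {V : Type*} [AddCommGroup V] [Module ℝ V] [FiniteDimensional ℝ V]
    (b : V →ₗ[ℝ] V →ₗ[ℝ] ℝ) (hs : ∀ u v, b u v = b v u) (hp : ∀ u, u ≠ 0 → 0 < b u u)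
    {P L : Submodule ℝ V} (hPL : P ≤ L) {k : ℕ} (hk : Module.finrank ℝ L = k) :
    ∃ e : Fin k → V, (∀ i j, b (e i) (e j) = if i = j then 1 else 0) ∧
      Submodule.span ℝ (Set.range e) = L ∧
      Submodule.span ℝ (e '' {i | i.val < Module.finrank ℝ P}) = P := by
  let core : InnerProductSpace.Core ℝ V :=
    { inner := fun u v ↦ b u v
      conj_inner_symm := fun u v ↦ by simpa using hs v u
      re_inner_nonneg := fun u ↦ by
        rcases eq_or_ne u 0 with rfl | h
        · simp
        · exact (hp u h).le
      add_left := fun u v w ↦ by simp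
      smul_left := fun u v r ↦ by simp
      definite := fun u h ↦ by
        by_contra hne
        exact (hp u hne).ne' h }
  let _ := core.toNormedAddCommGroup
  let _ : InnerProductSpace ℝ V := InnerProductSpace.ofCore core.toCore
  obtain ⟨e, he, h₁, h₂⟩ := exists_orthonormal_adapted hPL hk
  exact ⟨e, fun i j ↦ (orthonormal_iff_ite.mp he) i j, h₁, h₂⟩

namespace IsInner

variable {B : V →L[ℝ] V →L[ℝ] ℝ}

theorem self_nonneg (hB : IsInner B) (u : V) : 0 ≤ B u u := by
  rcases eq_or_ne u 0 with rfl | h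
  · simp
  · exact (hB.pos u h).le

theorem self_eq_zero (hB : IsInner B) {u : V} : B u u = 0 ↔ u = 0 := by
  refine ⟨fun h ↦ ?_, fun h ↦ by simp [h]⟩
  by_contra hne
  exact (hB.pos u hne).ne' h

theorem exists_frame_adapted [FiniteDimensional ℝ V] (hB : IsInner B) {P L : Submodule ℝ V}
    (hPL : P ≤ L) {k : ℕ} (hk : Module.finrank ℝ L = k) :
    ∃ e : Fin k → V, IsFrame B L e ∧
      Submodule.span ℝ (e '' {i | i.val < Module.finrank ℝ P}) = P := by
  obtain ⟨e, h₁, h₂, h₃⟩ := exists_frame_of_core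
    (LinearMap.mk₂ ℝ (fun u v ↦ B u v) (by simp) (by simp) (by simp) (by simp))
    hB.symm hB.pos hPL hk
  exact ⟨e, ⟨h₁, h₂⟩, h₃⟩

theorem exists_frame [FiniteDimensional ℝ V] (hB : IsInner B) (L : Submodule ℝ V) {k : ℕ}
    (hk : Module.finrank ℝ L = k) : ∃ e : Fin k → V, IsFrame B L e := by
  obtain ⟨e, he, -⟩ := hB.exists_frame_adapted (le_refl L) hk
  exact ⟨e, he⟩

/-- Excludes the default value 0 in the choice of a frame. -/
theorem isFrame_frameOf [FiniteDimensional ℝ V] (hB : IsInner B) (L : Submodule ℝ V) :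
    IsFrame B L (frameOf B L) := by
  have h := hB.exists_frame L rfl
  rw [frameOf, dif_pos h]
  exact h.choose_spec

end IsInner

namespace IsFrame

variable {B : V →L[ℝ] V →L[ℝ] ℝ} {L : Submodule ℝ V} {k : ℕ} {e : Fin k → V}

theorem mem (he : IsFrame B L e) (i : Fin k) : e i ∈ L :=
  he.2 ▸ Submodule.subset_span ⟨i, rfl⟩

theorem self_eq_one (he : IsFrame B L e) (i : Fin k) : B (e i) (e i) = 1 := by simp [he.1]

theorem eq_zero (he : IsFrame B L e) {i j : Fin k} (h : i ≠ j) : B (e i) (e j) = 0 := by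
  simp [he.1, h]

theorem expansion (he : IsFrame B L e) {u : V} (hu : u ∈ L) : u = ∑ i, B u (e i) • e i := by
  rw [← he.2, Submodule.mem_span_range_iff_exists_fun] at hu
  obtain ⟨a, rfl⟩ := hu
  refine Finset.sum_congr rfl fun i _ ↦ ?_
  congr 1
  simp [map_sum, he.1]

theorem linearIndependent (he : IsFrame B L e) : LinearIndependent ℝ e := by
  rw [Fintype.linearIndependent_iff]
  intro a ha i
  have := congrArg (fun w ↦ B w (e i)) ha
  simpa [map_sum, sum_apply, he.1] using this

theorem finrank_eq (he : IsFrame B L e) : Module.finrank ℝ L = k := by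
  rw [← he.2, finrank_span_eq_card he.linearIndependent, Fintype.card_fin]

/-- The change of frame is orthogonal, so traces do not depend on the frame. The two lengths are
kept apart because a chosen frame is indexed by a `finrank`. -/
theorem sum_bilin_eq (hB : IsInner B) (he : IsFrame B L e) {k' : ℕ} {e' : Fin k' → V}
    (he' : IsFrame B L e') {W : Type*} [AddCommGroup W] [Module ℝ W] (b : V →ₗ[ℝ] V →ₗ[ℝ] W) :
    ∑ i, b (e i) (e i) = ∑ i, b (e' i) (e' i) := by
  have h₁ (i : Fin k) : b (e i) (e i) =
      ∑ p, ∑ q, (B (e i) (e' p) * B (e i) (e' q)) • b (e' p) (e' q) := by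
    conv_lhs => rw [he'.expansion (he.mem i)]
    simp only [map_sum, map_smul, LinearMap.sum_apply, LinearMap.smul_apply, smul_smul,
      Finset.smul_sum]
    rw [Finset.sum_comm]
    exact Finset.sum_congr rfl fun p _ ↦ Finset.sum_congr rfl fun q _ ↦ by rw [mul_comm]
  -- Parseval: expand one of the vectors of e' in the frame e.
  have h₂ (p q : Fin k') : ∑ i, B (e i) (e' p) * B (e i) (e' q) = if p = q then 1 else 0 := by
    rw [← he'.1 p q]
    conv_rhs => rw [he.expansion (he'.mem p)]
    simp only [map_sum, map_smul, sum_apply, smul_apply, smul_eq_mul,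
      hB.symm (e' p)]
  simp_rw [h₁]
  rw [Finset.sum_comm]
  refine Finset.sum_congr rfl fun p _ ↦ ?_
  rw [Finset.sum_comm]
  simp_rw [← Finset.sum_smul, h₂]
  simp

theorem traceOn_eq [FiniteDimensional ℝ V] (hB : IsInner B) (he : IsFrame B L e) {W : Type*}
    [AddCommGroup W] [Module ℝ W] (b : V →ₗ[ℝ] V →ₗ[ℝ] W) :
    traceOn B L (fun u v ↦ b u v) = ∑ i, b (e i) (e i) :=
  (hB.isFrame_frameOf L).sum_bilin_eq hB he b

theorem append {L' : Submodule ℝ V} {k' : ℕ} {e' : Fin k' → V} (hB : IsInner B)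
    (he : IsFrame B L e) (he' : IsFrame B L' e') (h : ∀ u ∈ L, ∀ v ∈ L', B u v = 0) :
    IsFrame B (L ⊔ L') (Fin.append e e') := by
  refine ⟨fun a b ↦ ?_, ?_⟩
  · induction a using Fin.addCases with
    | left a =>
      induction b using Fin.addCases with
      | left b => rw [Fin.append_left, Fin.append_left, he.1]; simp
      | right b =>
        rw [Fin.append_left, Fin.append_right, h _ (he.mem a) _ (he'.mem b), if_neg]
        intro h
        have := congrArg Fin.val h
        simp at this
        omega
    | right a =>
      induction b using Fin.addCases with
      | left b =>
        rw [Fin.append_left, Fin.append_right, hB.symm, h _ (he.mem b) _ (he'.mem a), if_neg]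
        intro h
        have := congrArg Fin.val h
        simp at this
        omega
      | right b => rw [Fin.append_right, Fin.append_right, he'.1]; simp
  · rw [range_fin_append, Submodule.span_union, he.2, he'.2]

end IsFrame

end InnerProducts

/-! ### Pointwise algebra: corner blocks, and curvature in terms of h. -/

section Algebraic

theorem two_mul_sum_Ioi {k : ℕ} (a : Fin k → Fin k → ℝ) (ha : ∀ i j, a i j = a j i) :
    2 * ∑ i, ∑ j ∈ Finset.Ioi i, a i j = ∑ i, ∑ j, a i j - ∑ i, a i i := by
  have h₁ : ∑ i, ∑ j ∈ Finset.Iio i, a i j = ∑ i, ∑ j ∈ Finset.Ioi i, a i j := by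
    refine (Finset.sum_comm' (t' := Finset.univ) (s' := fun j ↦ Finset.Ioi j)
      (fun i j ↦ by simp)).trans ?_
    exact Finset.sum_congr rfl fun i _ ↦ Finset.sum_congr rfl fun j _ ↦ ha _ _
  have h₂ (i : Fin k) : ∑ j, a i j =
      ∑ j ∈ Finset.Iio i, a i j + a i i + ∑ j ∈ Finset.Ioi i, a i j := by
    have hu : (Finset.univ : Finset (Fin k)) = (Finset.Iio i ∪ {i}) ∪ Finset.Ioi i := by
      ext j
      rcases lt_trichotomy j i with h | h | h <;> simp [h, h.le]
    rw [hu, Finset.sum_union, Finset.sum_union, Finset.sum_singleton]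
    · simp
    · simp [Finset.disjoint_left]
  simp_rw [h₂, Finset.sum_add_distrib, h₁]
  ring

variable {V : Type*} [NormedAddCommGroup V] [NormedSpace ℝ V]
  {W : Type*} [NormedAddCommGroup W] [NormedSpace ℝ W]

/-- The Gram determinant of two vectors. -/
def gram (B : V →L[ℝ] V →L[ℝ] ℝ) (u v : V) : ℝ := B u u * B v v - B u v ^ 2

/-- The quadratic expression in the second fundamental form `h` which occurs in the Gauss
equation of a plane. -/
def gaussTerm (B' : W →L[ℝ] W →L[ℝ] ℝ) (h : V →ₗ[ℝ] V →ₗ[ℝ] W) (u v : V) : ℝ :=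
  B' (h u u) (h v v) - B' (h u v) (h u v)

/-- Algebraic data of a submanifold of a space form at a point: `h` is a second fundamental form
with values in the normal space `S`, the tangent space is the orthogonal sum of `L₁` and `L₂`, the
sectional curvature `κ` satisfies the Gauss equation, and the mixed curvatures sum up to `D`. -/
structure IsSplitGauss (B : V →L[ℝ] V →L[ℝ] ℝ) (B' : W →L[ℝ] W →L[ℝ] ℝ)
    (h : V →ₗ[ℝ] V →ₗ[ℝ] W) (L₁ L₂ : Submodule ℝ V) (S : Submodule ℝ W) (n₁ n₂ q : ℕ) (c D : ℝ)
    (κ : V → V → ℝ) : Prop where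
  inner : IsInner B
  inner' : IsInner B'
  symm : ∀ u v, h u v = h v u
  orth : ∀ u ∈ L₁, ∀ v ∈ L₂, B u v = 0
  sup : L₁ ⊔ L₂ = ⊤
  finrank_fst : Module.finrank ℝ L₁ = n₁
  finrank_snd : Module.finrank ℝ L₂ = n₂
  finrank_normal : Module.finrank ℝ S = q
  mem : ∀ u v, h u v ∈ S
  curv : ∀ u v, κ u v = (c * gram B u v + gaussTerm B' h u v) / gram B u v
  mixed : ∀ (e₁ : Fin n₁ → V) (e₂ : Fin n₂ → V), IsFrame B L₁ e₁ → IsFrame B L₂ e₂ →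
    ∑ i, ∑ s, (c + gaussTerm B' h (e₁ i) (e₂ s)) = D

/-- Vanishing conditions on `h` characterizing equality in Chen's inequality. -/
structure IsChenIdeal (h : V →ₗ[ℝ] V →ₗ[ℝ] W) {n₁ n₂ : ℕ} (e₁ : Fin n₁ → V)
    (e₂ : Fin n₂ → V) : Prop where
  mixed : ∀ i s, h (e₁ i) (e₂ s) = 0
  trace : ∑ s, h (e₂ s) (e₂ s) = 0
  corner : ∀ i j : Fin n₁, i.val = 0 → j.val = 1 → h (e₁ i) (e₁ i) + h (e₁ j) (e₁ j) = 0
  rest : ∀ i j : Fin n₁, ¬ (i.val < 2 ∧ j.val < 2) → h (e₁ i) (e₁ j) = 0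

/-- The shape operators in a frame, entrywise: mixed entries vanish, the first block is a corner
block, and both blocks have trace zero. -/
def HasShapeForms (B' : W →L[ℝ] W →L[ℝ] ℝ) (h : V →ₗ[ℝ] V →ₗ[ℝ] W) {n₁ n₂ q : ℕ}
    (e₁ : Fin n₁ → V) (e₂ : Fin n₂ → V) (ξ : Fin q → W) : Prop :=
  ∀ r : Fin q, (∀ i s, B' (h (e₁ i) (e₂ s)) (ξ r) = 0) ∧
    IsCornerBlock r.val (Matrix.of fun i j ↦ B' (h (e₁ i) (e₁ j)) (ξ r)) ∧
    ∑ i, B' (h (e₁ i) (e₁ i)) (ξ r) = 0 ∧ ∑ s, B' (h (e₂ s) (e₂ s)) (ξ r) = 0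

/-- Turns an equation between normal vectors into one scalar equation for each normal direction. -/
theorem IsFrame.eq_zero_iff {B' : W →L[ℝ] W →L[ℝ] ℝ} {S : Submodule ℝ W} {q : ℕ} {ξ : Fin q → W}
    (hξ : IsFrame B' S ξ) {w : W} (hw : w ∈ S) : w = 0 ↔ ∀ r, B' w (ξ r) = 0 := by
  refine ⟨fun h r ↦ by simp [h], fun h ↦ ?_⟩
  rw [hξ.expansion hw]
  simp [h]

theorem sum_fin_eq_two {k : ℕ} {A : Type*} [AddCommMonoid A] (hk : 2 ≤ k) (a : Fin k → A)
    (ha : ∀ i : Fin k, ¬ i.val < 2 → a i = 0) :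
    ∑ i, a i = a ⟨0, by omega⟩ + a ⟨1, by omega⟩ := by
  obtain ⟨l, rfl⟩ := Nat.exists_eq_add_of_le hk
  rw [Fin.sum_univ_add, Fin.sum_univ_two]
  rw [Finset.sum_eq_zero (s := Finset.univ) (f := fun i : Fin l ↦ a (Fin.natAdd 2 i)), add_zero]
  · rfl
  · intro i _
    exact ha _ (by rw [Fin.val_natAdd]; omega)

theorem cornerMatrix_trace {k : ℕ} (hk : 2 ≤ k) (μ₁ μ₂ a μ : ℝ) :
    ∑ i, cornerMatrix k μ₁ μ₂ a μ i i = μ₁ + μ₂ + (k - 2 : ℝ) * μ := by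
  obtain ⟨l, rfl⟩ := Nat.exists_eq_add_of_le hk
  have h₀ : cornerMatrix (2 + l) μ₁ μ₂ a μ (Fin.castAdd l 0) (Fin.castAdd l 0) = μ₁ := by
    rw [cornerMatrix, Matrix.of_apply, if_pos ⟨rfl, rfl⟩]
  have h₁ : cornerMatrix (2 + l) μ₁ μ₂ a μ (Fin.castAdd l 1) (Fin.castAdd l 1) = μ₂ := by
    rw [cornerMatrix, Matrix.of_apply, if_neg (fun h ↦ Nat.one_ne_zero h.1), if_pos ⟨rfl, rfl⟩]
  have h₂ (i : Fin l) :
      cornerMatrix (2 + l) μ₁ μ₂ a μ (Fin.natAdd 2 i) (Fin.natAdd 2 i) = μ := by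
    have hi : (Fin.natAdd 2 i).val = 2 + i.val := rfl
    rw [cornerMatrix, Matrix.of_apply, if_neg (by omega), if_neg (by omega), if_neg (by omega),
      if_pos rfl]
  rw [Fin.sum_univ_add, Fin.sum_univ_two, h₀, h₁]
  simp [h₂]

/-- With μ = μ₁ + μ₂ the trace is (k-1)μ, so a first block of trace zero has μ = 0 and takes the
same form as the others. -/
theorem isCornerBlock_iff_of_trace {k : ℕ} (hk : 2 ≤ k) (r : ℕ) (P : Matrix (Fin k) (Fin k) ℝ)
    (hP : ∑ i, P i i = 0) :
    IsCornerBlock r P ↔ ∃ b a : ℝ, P = cornerMatrix k b (-b) a 0 := by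
  unfold IsCornerBlock
  split_ifs with hr
  · constructor
    · rintro ⟨μ₁, μ₂, a, rfl⟩
      rw [cornerMatrix_trace hk] at hP
      have hk' : (2 : ℝ) ≤ k := by exact_mod_cast hk
      have h0 : μ₁ + μ₂ = 0 := by
        have : ((k : ℝ) - 1) * (μ₁ + μ₂) = 0 := by linarith
        rcases mul_eq_zero.mp this with h | h
        · linarith
        · exact h
      exact ⟨μ₁, a, by rw [h0, eq_neg_of_add_eq_zero_right h0]⟩
    · rintro ⟨b, a, rfl⟩
      exact ⟨b, -b, a, by rw [add_neg_cancel]⟩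
  · rfl

theorem eq_cornerMatrix_iff {k : ℕ} (hk : 2 ≤ k) (P : Matrix (Fin k) (Fin k) ℝ)
    (hs : ∀ i j, P i j = P j i) :
    (∃ b a : ℝ, P = cornerMatrix k b (-b) a 0) ↔
      (∀ i j : Fin k, i.val = 0 → j.val = 1 → P i i + P j j = 0) ∧
      ∀ i j : Fin k, ¬ (i.val < 2 ∧ j.val < 2) → P i j = 0 := by
  constructor
  · rintro ⟨b, a, rfl⟩
    refine ⟨fun i j hi hj ↦ by simp [cornerMatrix, hi, hj], fun i j hij ↦ ?_⟩
    have h₁ : ¬ (i.val = 0 ∧ j.val = 0) := by omega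
    have h₂ : ¬ (i.val = 1 ∧ j.val = 1) := by omega
    have h₃ : ¬ ((i.val = 0 ∧ j.val = 1) ∨ (i.val = 1 ∧ j.val = 0)) := by omega
    simp only [cornerMatrix, Matrix.of_apply, if_neg h₁, if_neg h₂, if_neg h₃, ite_self]
  · rintro ⟨h₁, h₂⟩
    refine ⟨P ⟨0, by omega⟩ ⟨0, by omega⟩, P ⟨0, by omega⟩ ⟨1, by omega⟩, ?_⟩
    ext i j
    by_cases hij : i.val < 2 ∧ j.val < 2
    · obtain ⟨i, hi⟩ := i
      obtain ⟨j, hj⟩ := j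
      obtain ⟨hi', hj'⟩ := hij
      have h₀ := h₁ ⟨0, by omega⟩ ⟨1, by omega⟩ rfl rfl
      have hi'' : i = 0 ∨ i = 1 := by simp only at hi'; omega
      have hj'' : j = 0 ∨ j = 1 := by simp only at hj'; omega
      rcases hi'' with rfl | rfl <;> rcases hj'' with rfl | rfl <;> simp [cornerMatrix]
      · exact hs _ _
      · linarith
    · rw [h₂ i j hij]
      have h₁ : ¬ (i.val = 0 ∧ j.val = 0) := by omega
      have h₂ : ¬ (i.val = 1 ∧ j.val = 1) := by omega
      have h₃ : ¬ ((i.val = 0 ∧ j.val = 1) ∨ (i.val = 1 ∧ j.val = 0)) := by omega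
      simp only [cornerMatrix, Matrix.of_apply, if_neg h₁, if_neg h₂, if_neg h₃, ite_self]

namespace IsSplitGauss

variable {B : V →L[ℝ] V →L[ℝ] ℝ} {B' : W →L[ℝ] W →L[ℝ] ℝ} {h : V →ₗ[ℝ] V →ₗ[ℝ] W}
  {L₁ L₂ : Submodule ℝ V} {S : Submodule ℝ W} {n₁ n₂ q : ℕ} {c D : ℝ} {κ : V → V → ℝ}

/-- The mixed curvature sum is symmetric in the factors, so D is unchanged. This reduces the second
factor to the first. -/
theorem swap (H : IsSplitGauss B B' h L₁ L₂ S n₁ n₂ q c D κ) :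
    IsSplitGauss B B' h L₂ L₁ S n₂ n₁ q c D κ where
  inner := H.inner
  inner' := H.inner'
  symm := H.symm
  orth u hu v hv := by rw [H.inner.symm, H.orth v hv u hu]
  sup := by rw [sup_comm, H.sup]
  finrank_fst := H.finrank_snd
  finrank_snd := H.finrank_fst
  finrank_normal := H.finrank_normal
  mem := H.mem
  curv := H.curv
  mixed e₂ e₁ h₂ h₁ := by
    rw [← H.mixed e₁ e₂ h₁ h₂, Finset.sum_comm]
    refine Finset.sum_congr rfl fun i _ ↦ Finset.sum_congr rfl fun s _ ↦ ?_
    rw [gaussTerm, gaussTerm, H.inner'.symm (h (e₂ s) (e₂ s)), H.symm (e₂ s) (e₁ i)]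

/-- Since h takes values in the normal space, its vanishing conditions can be tested on any normal
frame; none has to be adapted to h. -/
theorem isChenIdeal_iff (H : IsSplitGauss B B' h L₁ L₂ S n₁ n₂ q c D κ) (hn : 2 ≤ n₁)
    {e₁ : Fin n₁ → V} {e₂ : Fin n₂ → V} {ξ : Fin q → W} (hξ : IsFrame B' S ξ) :
    IsChenIdeal h e₁ e₂ ↔ HasShapeForms B' h e₁ e₂ ξ := by
  have hs (r : Fin q) (i j : Fin n₁) :
      (Matrix.of fun i j ↦ B' (h (e₁ i) (e₁ j)) (ξ r)) i j =
      (Matrix.of fun i j ↦ B' (h (e₁ i) (e₁ j)) (ξ r)) j i := by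
    simp [H.symm (e₁ i)]
  constructor
  · intro I r
    have hc : (∃ b a : ℝ, (Matrix.of fun i j ↦ B' (h (e₁ i) (e₁ j)) (ξ r)) =
        cornerMatrix n₁ b (-b) a 0) := by
      rw [eq_cornerMatrix_iff hn _ (hs r)]
      refine ⟨fun i j hi hj ↦ ?_, fun i j hij ↦ ?_⟩
      · simp only [Matrix.of_apply]
        rw [← add_apply, ← map_add, I.corner i j hi hj]
        simp
      · simp [I.rest i j hij]
    have ht : ∑ i, B' (h (e₁ i) (e₁ i)) (ξ r) = 0 := by
      rw [sum_fin_eq_two hn]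
      · rw [← add_apply, ← map_add, I.corner _ _ rfl rfl]
        simp
      · intro i hi
        rw [I.rest i i (fun h ↦ hi h.1)]
        simp
    refine ⟨fun i s ↦ by simp [I.mixed], ?_, ht, ?_⟩
    · rwa [isCornerBlock_iff_of_trace hn _ _ (by simpa using ht)]
    · rw [← sum_apply, ← map_sum, I.trace]
      simp
  · intro I
    have hc (r : Fin q) := by
      have := (I r).2.1
      rw [isCornerBlock_iff_of_trace hn _ _ (by simpa using (I r).2.2.1),
        eq_cornerMatrix_iff hn _ (hs r)] at this
      exact this
    refine ⟨fun i s ↦ ?_, ?_, fun i j hi hj ↦ ?_, fun i j hij ↦ ?_⟩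
    · rw [hξ.eq_zero_iff (H.mem _ _)]
      exact fun r ↦ (I r).1 i s
    · rw [hξ.eq_zero_iff (S.sum_mem fun s _ ↦ H.mem _ _)]
      intro r
      rw [map_sum, sum_apply]
      exact (I r).2.2.2
    · rw [hξ.eq_zero_iff (S.add_mem (H.mem _ _) (H.mem _ _))]
      intro r
      rw [map_add, add_apply]
      exact (hc r).1 i j hi hj
    · rw [hξ.eq_zero_iff (H.mem _ _)]
      exact fun r ↦ (hc r).2 i j hij

theorem curv_of_orthonormal (H : IsSplitGauss B B' h L₁ L₂ S n₁ n₂ q c D κ) {u v : V}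
    (hu : B u u = 1) (hv : B v v = 1) (huv : B u v = 0) : κ u v = c + gaussTerm B' h u v := by
  rw [H.curv]
  simp [gram, hu, hv, huv]

/-- Under a change of basis of the plane, both the Gram determinant and the Gauss term are
multiplied by the square of the determinant. -/
theorem curv_eq_of_span_eq (H : IsSplitGauss B B' h L₁ L₂ S n₁ n₂ q c D κ) {u v e e' : V}
    (he : B e e = 1) (he' : B e' e' = 1) (hee' : B e e' = 0) (huv : LinearIndependent ℝ ![u, v])
    (hspan : Submodule.span ℝ {e, e'} = Submodule.span ℝ {u, v}) : κ u v = κ e e' := by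
  have hu : u ∈ Submodule.span ℝ {e, e'} := hspan ▸ Submodule.subset_span (by simp)
  have hv : v ∈ Submodule.span ℝ {e, e'} := hspan ▸ Submodule.subset_span (by simp)
  obtain ⟨a, b, rfl⟩ := Submodule.mem_span_pair.mp hu
  obtain ⟨p, r, rfl⟩ := Submodule.mem_span_pair.mp hv
  -- If the determinant vanished, r u - b v = 0 and p u - a v = 0 would be relations; independence
  -- gives a = b = 0, hence u = 0.
  have hdet : a * r - b * p ≠ 0 := by
    intro h0
    have hind := LinearIndependent.pair_iff.mp huv
    have h₁ := hind r (-b) (by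
      have : r • (a • e + b • e') + -b • (p • e + r • e') = (a * r - b * p) • e := by module
      rw [this, h0, zero_smul])
    have h₂ := hind p (-a) (by
      have : p • (a • e + b • e') + -a • (p • e + r • e') = -(a * r - b * p) • e' := by module
      rw [this, h0, neg_zero, zero_smul])
    have hb : b = 0 := by linarith [h₁.2]
    have ha : a = 0 := by linarith [h₂.2]
    have h₃ := hind 1 0 (by simp [ha, hb])
    exact one_ne_zero h₃.1
  have hg : gram B (a • e + b • e') (p • e + r • e') = (a * r - b * p) ^ 2 := by
    simp only [gram, map_add, map_smul, add_apply, smul_apply, smul_eq_mul, he, he', hee',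
      H.inner.symm e' e]
    ring
  have hh : gaussTerm B' h (a • e + b • e') (p • e + r • e') =
      (a * r - b * p) ^ 2 * gaussTerm B' h e e' := by
    simp only [gaussTerm, map_add, map_smul, add_apply, smul_apply, smul_eq_mul,
      LinearMap.add_apply, LinearMap.smul_apply, H.symm e' e,
      H.inner'.symm (h e e') (h e e), H.inner'.symm (h e' e') (h e e),
      H.inner'.symm (h e' e') (h e e')]
    ring
  rw [H.curv_of_orthonormal he he' hee', H.curv, hg, hh]
  field_simp

/-- The scalar curvature of a subspace in terms of `h`. -/
theorem sum_curv_of_frame (H : IsSplitGauss B B' h L₁ L₂ S n₁ n₂ q c D κ) {L : Submodule ℝ V}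
    {k : ℕ} {e : Fin k → V} (he : IsFrame B L e) :
    ∑ i, ∑ j ∈ Finset.Ioi i, κ (e i) (e j) =
      (k * (k - 1) * c + B' (∑ i, h (e i) (e i)) (∑ i, h (e i) (e i))
        - ∑ i, ∑ j, B' (h (e i) (e j)) (h (e i) (e j))) / 2 := by
  have h₁ : ∑ i, ∑ j ∈ Finset.Ioi i, κ (e i) (e j) =
      ∑ i, ∑ j ∈ Finset.Ioi i, (c + gaussTerm B' h (e i) (e j)) := by
    refine Finset.sum_congr rfl fun i _ ↦ Finset.sum_congr rfl fun j hj ↦ ?_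
    exact H.curv_of_orthonormal (he.self_eq_one i) (he.self_eq_one j)
      (he.eq_zero (Finset.mem_Ioi.mp hj).ne)
  have h₂ := two_mul_sum_Ioi (fun i j ↦ c + gaussTerm B' h (e i) (e j))
    (fun i j ↦ by rw [gaussTerm, gaussTerm, H.inner'.symm, H.symm (e i) (e j)])
  have h₃ (i : Fin k) : gaussTerm B' h (e i) (e i) = 0 := by simp [gaussTerm]
  have h₄ : B' (∑ i, h (e i) (e i)) (∑ i, h (e i) (e i)) =
      ∑ i, ∑ j, B' (h (e i) (e i)) (h (e j) (e j)) := by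
    simp only [map_sum, sum_apply]
    exact Finset.sum_comm
  rw [h₁, h₄]
  simp only [h₃, Finset.sum_add_distrib] at h₂
  simp only [gaussTerm, Finset.sum_add_distrib, Finset.sum_sub_distrib, Finset.sum_const,
    Finset.card_univ, Fintype.card_fin, nsmul_eq_mul] at h₂ ⊢
  linarith

/-- Frame independence of the trace, applied in one slot of h at a time with the other slot fixed.
-/
theorem sum_norm_eq (H : IsSplitGauss B B' h L₁ L₂ S n₁ n₂ q c D κ) {L : Submodule ℝ V}
    {k k' : ℕ} {e : Fin k → V} {e' : Fin k' → V} (he : IsFrame B L e) (he' : IsFrame B L e') :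
    ∑ i, ∑ j, B' (h (e i) (e j)) (h (e i) (e j)) =
      ∑ i, ∑ j, B' (h (e' i) (e' j)) (h (e' i) (e' j)) := by
  let b (w : V) : V →ₗ[ℝ] V →ₗ[ℝ] ℝ :=
    LinearMap.mk₂ ℝ (fun u v ↦ B' (h u w) (h v w)) (by simp) (by simp) (by simp) (by simp)
  have hb (w : V) : ∑ i, B' (h (e i) w) (h (e i) w) = ∑ i, B' (h (e' i) w) (h (e' i) w) :=
    he.sum_bilin_eq H.inner he' (b w)
  rw [Finset.sum_comm]
  simp_rw [hb]
  rw [Finset.sum_comm]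
  refine Finset.sum_congr rfl fun i _ ↦ ?_
  simp_rw [H.symm (e' i)]
  exact hb (e' i)

theorem sum_curv_eq (H : IsSplitGauss B B' h L₁ L₂ S n₁ n₂ q c D κ) {L : Submodule ℝ V}
    {k k' : ℕ} {e : Fin k → V} {e' : Fin k' → V} (he : IsFrame B L e) (he' : IsFrame B L e') :
    ∑ i, ∑ j ∈ Finset.Ioi i, κ (e i) (e j) = ∑ i, ∑ j ∈ Finset.Ioi i, κ (e' i) (e' j) := by
  have hk : k = k' := he.finrank_eq.symm.trans he'.finrank_eq
  rw [H.sum_curv_of_frame he, H.sum_curv_of_frame he', H.sum_norm_eq he he',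
    he.sum_bilin_eq H.inner he' h, hk]

end IsSplitGauss

end Algebraic

/-! ### Pointwise algebra: the sum of squares, the inequality and its equality case. -/

section Algebraic

variable {V : Type*} [NormedAddCommGroup V] [NormedSpace ℝ V]
  {W : Type*} [NormedAddCommGroup W] [NormedSpace ℝ W]

theorem finrank_span_pair {u v : V} (huv : LinearIndependent ℝ ![u, v]) :
    Module.finrank ℝ (Submodule.span ℝ {u, v}) = 2 := by
  have := finrank_span_eq_card huv
  rwa [Fintype.card_fin, Matrix.range_cons, Matrix.range_cons, Matrix.range_empty,
    Set.union_empty, Set.singleton_union] at this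

theorem IsFrame.span_image_two {B : V →L[ℝ] V →L[ℝ] ℝ} {L : Submodule ℝ V} {k : ℕ} {e : Fin k → V}
    (_ : IsFrame B L e) (hk : 2 ≤ k) :
    Submodule.span ℝ (e '' {i | i.val < 2}) =
      Submodule.span ℝ {e ⟨0, by omega⟩, e ⟨1, by omega⟩} := by
  congr 1
  ext w
  constructor
  · rintro ⟨⟨i, hi⟩, hi', rfl⟩
    have : i = 0 ∨ i = 1 := by
      simp only [Set.mem_ofPred_eq] at hi'
      omega
    rcases this with rfl | rfl <;> simp
  · rintro (rfl | rfl)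
    · exact ⟨⟨0, by omega⟩, by simp, rfl⟩
    · exact ⟨⟨1, by omega⟩, by simp, rfl⟩

theorem IsFrame.linearIndependent_pair {B : V →L[ℝ] V →L[ℝ] ℝ} {L : Submodule ℝ V} {k : ℕ}
    {e : Fin k → V} (he : IsFrame B L e) {i j : Fin k} (hij : i ≠ j) :
    LinearIndependent ℝ ![e i, e j] := by
  rw [LinearIndependent.pair_iff]
  intro s t hst
  have h₁ := congrArg (fun w ↦ B w (e i)) hst
  have h₂ := congrArg (fun w ↦ B w (e j)) hst
  simp [he.self_eq_one, he.eq_zero hij, he.eq_zero hij.symm] at h₁ h₂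
  exact ⟨h₁, h₂⟩

namespace IsSplitGauss

variable {B : V →L[ℝ] V →L[ℝ] ℝ} {B' : W →L[ℝ] W →L[ℝ] ℝ} {h : V →ₗ[ℝ] V →ₗ[ℝ] W}
  {L₁ L₂ : Submodule ℝ V} {S : Submodule ℝ W} {n₁ n₂ q : ℕ} {c D : ℝ} {κ : V → V → ℝ}

/-- The difference of the two sides of Chen's inequality, as a sum of squares. -/
theorem defect_eq (H : IsSplitGauss B B' h L₁ L₂ S n₁ n₂ q c D κ) (hn : 2 ≤ n₁)
    {e₁ : Fin n₁ → V} {e₂ : Fin n₂ → V} (h₁ : IsFrame B L₁ e₁) (h₂ : IsFrame B L₂ e₂) {t : W}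
    (ht : t = ∑ i, h (e₁ i) (e₁ i) + ∑ s, h (e₂ s) (e₂ s)) :
    (B' t t / 2 - D + 1 / 2 * n₁ * ((n₁ : ℝ) + 2 * n₂ - 1) * c - c)
      - (∑ i, ∑ j ∈ Finset.Ioi i, κ (e₁ i) (e₁ j) - κ (e₁ ⟨0, by omega⟩) (e₁ ⟨1, by omega⟩)) =
    B' (∑ s, h (e₂ s) (e₂ s)) (∑ s, h (e₂ s) (e₂ s)) / 2
      + ∑ i, ∑ s, B' (h (e₁ i) (e₂ s)) (h (e₁ i) (e₂ s))
      + B' (h (e₁ ⟨0, by omega⟩) (e₁ ⟨0, by omega⟩) + h (e₁ ⟨1, by omega⟩) (e₁ ⟨1, by omega⟩))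
          (h (e₁ ⟨0, by omega⟩) (e₁ ⟨0, by omega⟩) + h (e₁ ⟨1, by omega⟩) (e₁ ⟨1, by omega⟩)) / 2
      + (∑ i, ∑ j, if i.val < 2 ∧ j.val < 2 then 0
          else B' (h (e₁ i) (e₁ j)) (h (e₁ i) (e₁ j))) / 2 := by
  have hm := H.mixed e₁ e₂ h₁ h₂
  have hm' : ∑ i, ∑ s, B' (h (e₁ i) (e₁ i)) (h (e₂ s) (e₂ s)) =
      B' (∑ i, h (e₁ i) (e₁ i)) (∑ s, h (e₂ s) (e₂ s)) := by
    simp only [map_sum, sum_apply]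
    exact Finset.sum_comm
  simp only [gaussTerm, Finset.sum_add_distrib, Finset.sum_sub_distrib, Finset.sum_const,
    Finset.card_univ, Fintype.card_fin, nsmul_eq_mul, hm'] at hm
  -- The 2 × 2 corner is set apart because its terms combine with the curvature of the plane into
  -- ½|h₀₀ + h₁₁|².
  have hsplit : ∑ i, ∑ j, B' (h (e₁ i) (e₁ j)) (h (e₁ i) (e₁ j)) =
      ∑ i : Fin n₁, ∑ j : Fin n₁, (if i.val < 2 ∧ j.val < 2 then
        B' (h (e₁ i) (e₁ j)) (h (e₁ i) (e₁ j)) else 0)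
      + ∑ i, ∑ j, if i.val < 2 ∧ j.val < 2 then 0
          else B' (h (e₁ i) (e₁ j)) (h (e₁ i) (e₁ j)) := by
    rw [← Finset.sum_add_distrib]
    refine Finset.sum_congr rfl fun i _ ↦ ?_
    rw [← Finset.sum_add_distrib]
    exact Finset.sum_congr rfl fun j _ ↦ by split_ifs <;> simp
  have hcorner : ∑ i : Fin n₁, ∑ j : Fin n₁, (if i.val < 2 ∧ j.val < 2 then
        B' (h (e₁ i) (e₁ j)) (h (e₁ i) (e₁ j)) else 0) =
      B' (h (e₁ ⟨0, by omega⟩) (e₁ ⟨0, by omega⟩)) (h (e₁ ⟨0, by omega⟩) (e₁ ⟨0, by omega⟩))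
      + 2 * B' (h (e₁ ⟨0, by omega⟩) (e₁ ⟨1, by omega⟩)) (h (e₁ ⟨0, by omega⟩) (e₁ ⟨1, by omega⟩))
      + B' (h (e₁ ⟨1, by omega⟩) (e₁ ⟨1, by omega⟩)) (h (e₁ ⟨1, by omega⟩) (e₁ ⟨1, by omega⟩)) := by
    rw [sum_fin_eq_two hn _ (fun i hi ↦ Finset.sum_eq_zero fun j _ ↦ if_neg fun h ↦ hi h.1),
      sum_fin_eq_two hn _ (fun i hi ↦ if_neg fun h ↦ hi h.2),
      sum_fin_eq_two hn _ (fun i hi ↦ if_neg fun h ↦ hi h.2)]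
    simp [H.symm (e₁ ⟨1, by omega⟩) (e₁ ⟨0, by omega⟩)]
    ring
  have hκ : κ (e₁ ⟨0, by omega⟩) (e₁ ⟨1, by omega⟩) =
      c + gaussTerm B' h (e₁ ⟨0, by omega⟩) (e₁ ⟨1, by omega⟩) :=
    H.curv_of_orthonormal (h₁.self_eq_one _) (h₁.self_eq_one _) (h₁.eq_zero (by simp))
  -- Replacing D by the mixed Gauss sum cancels the product of the two traces; the terms in c cancel
  -- as well.
  rw [H.sum_curv_of_frame h₁, hsplit, hcorner, hκ, gaussTerm, ← hm, ht]
  simp only [map_add, add_apply, H.inner'.symm (∑ s, h (e₂ s) (e₂ s)) (∑ i, h (e₁ i) (e₁ i)),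
    H.inner'.symm (h (e₁ ⟨1, by omega⟩) (e₁ ⟨1, by omega⟩))
      (h (e₁ ⟨0, by omega⟩) (e₁ ⟨0, by omega⟩))]
  ring

/-- The four summands of the defect are nonnegative, and the four fields of `IsChenIdeal` are
exactly their vanishing. -/
theorem frame_le (H : IsSplitGauss B B' h L₁ L₂ S n₁ n₂ q c D κ) (hn : 2 ≤ n₁)
    {e₁ : Fin n₁ → V} {e₂ : Fin n₂ → V} (h₁ : IsFrame B L₁ e₁) (h₂ : IsFrame B L₂ e₂) {t : W}
    (ht : t = ∑ i, h (e₁ i) (e₁ i) + ∑ s, h (e₂ s) (e₂ s)) :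
    ∑ i, ∑ j ∈ Finset.Ioi i, κ (e₁ i) (e₁ j) - κ (e₁ ⟨0, by omega⟩) (e₁ ⟨1, by omega⟩) ≤
      B' t t / 2 - D + 1 / 2 * n₁ * ((n₁ : ℝ) + 2 * n₂ - 1) * c - c ∧
    (∑ i, ∑ j ∈ Finset.Ioi i, κ (e₁ i) (e₁ j) - κ (e₁ ⟨0, by omega⟩) (e₁ ⟨1, by omega⟩) =
      B' t t / 2 - D + 1 / 2 * n₁ * ((n₁ : ℝ) + 2 * n₂ - 1) * c - c ↔ IsChenIdeal h e₁ e₂) := by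
  have hd := H.defect_eq hn h₁ h₂ ht
  have p₁ := H.inner'.self_nonneg (∑ s, h (e₂ s) (e₂ s))
  have p₂ (i : Fin n₁) (s : Fin n₂) := H.inner'.self_nonneg (h (e₁ i) (e₂ s))
  have p₂' : 0 ≤ ∑ i, ∑ s, B' (h (e₁ i) (e₂ s)) (h (e₁ i) (e₂ s)) :=
    Finset.sum_nonneg fun i _ ↦ Finset.sum_nonneg fun s _ ↦ p₂ i s
  have p₃ := H.inner'.self_nonneg (h (e₁ ⟨0, by omega⟩) (e₁ ⟨0, by omega⟩)
    + h (e₁ ⟨1, by omega⟩) (e₁ ⟨1, by omega⟩))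
  have p₄ (i j : Fin n₁) : 0 ≤ (if i.val < 2 ∧ j.val < 2 then 0
      else B' (h (e₁ i) (e₁ j)) (h (e₁ i) (e₁ j))) := by
    split_ifs
    · exact le_rfl
    · exact H.inner'.self_nonneg _
  have p₄' : 0 ≤ ∑ i : Fin n₁, ∑ j : Fin n₁, (if i.val < 2 ∧ j.val < 2 then 0
      else B' (h (e₁ i) (e₁ j)) (h (e₁ i) (e₁ j))) :=
    Finset.sum_nonneg fun i _ ↦ Finset.sum_nonneg fun j _ ↦ p₄ i j
  refine ⟨by linarith, fun heq ↦ ?_, fun I ↦ ?_⟩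
  · rw [heq, sub_self] at hd
    have z₁ : B' (∑ s, h (e₂ s) (e₂ s)) (∑ s, h (e₂ s) (e₂ s)) = 0 := by linarith
    have z₂ : ∑ i, ∑ s, B' (h (e₁ i) (e₂ s)) (h (e₁ i) (e₂ s)) = 0 := by linarith
    have z₃ : B' (h (e₁ ⟨0, by omega⟩) (e₁ ⟨0, by omega⟩)
        + h (e₁ ⟨1, by omega⟩) (e₁ ⟨1, by omega⟩)) (h (e₁ ⟨0, by omega⟩) (e₁ ⟨0, by omega⟩)
        + h (e₁ ⟨1, by omega⟩) (e₁ ⟨1, by omega⟩)) = 0 := by linarith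
    have z₄ : ∑ i : Fin n₁, ∑ j : Fin n₁, (if i.val < 2 ∧ j.val < 2 then 0
      else B' (h (e₁ i) (e₁ j)) (h (e₁ i) (e₁ j))) = 0 := by linarith
    refine ⟨fun i s ↦ ?_, H.inner'.self_eq_zero.mp z₁, ?_, fun i j hij ↦ ?_⟩
    · rw [Finset.sum_eq_zero_iff_of_nonneg
        (fun i _ ↦ Finset.sum_nonneg fun s _ ↦ p₂ i s)] at z₂
      have := z₂ i (Finset.mem_univ _)
      rw [Finset.sum_eq_zero_iff_of_nonneg (fun s _ ↦ p₂ i s)] at this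
      exact H.inner'.self_eq_zero.mp (this s (Finset.mem_univ _))
    · rintro ⟨i, hi⟩ ⟨j, hj⟩ rfl rfl
      exact H.inner'.self_eq_zero.mp z₃
    · rw [Finset.sum_eq_zero_iff_of_nonneg
        (fun i _ ↦ Finset.sum_nonneg fun s _ ↦ p₄ i s)] at z₄
      have := z₄ i (Finset.mem_univ _)
      rw [Finset.sum_eq_zero_iff_of_nonneg (fun s _ ↦ p₄ i s)] at this
      have := this j (Finset.mem_univ _)
      rw [if_neg hij] at this
      exact H.inner'.self_eq_zero.mp this
  · have z₂ : ∑ i, ∑ s, B' (h (e₁ i) (e₂ s)) (h (e₁ i) (e₂ s)) = 0 :=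
      Finset.sum_eq_zero fun i _ ↦ Finset.sum_eq_zero fun s _ ↦ by simp [I.mixed i s]
    have z₄ : ∑ i : Fin n₁, ∑ j : Fin n₁, (if i.val < 2 ∧ j.val < 2 then 0
        else B' (h (e₁ i) (e₁ j)) (h (e₁ i) (e₁ j))) = 0 := by
      refine Finset.sum_eq_zero fun i _ ↦ Finset.sum_eq_zero fun j _ ↦ ?_
      split_ifs with hij
      · rfl
      · simp [I.rest i j hij]
    have z₀ : B' 0 0 = 0 := by simp
    rw [I.trace, I.corner _ _ rfl rfl, z₂, z₄, z₀] at hd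
    linarith

/-- The infimum of the sectional curvatures is attained. -/
theorem exists_min_curv [FiniteDimensional ℝ V]
    (H : IsSplitGauss B B' h L₁ L₂ S n₁ n₂ q c D κ) (hn : 2 ≤ n₁) :
    ∃ u ∈ L₁, ∃ v ∈ L₁, LinearIndependent ℝ ![u, v] ∧
      ∀ u' ∈ L₁, ∀ v' ∈ L₁, LinearIndependent ℝ ![u', v'] → κ u v ≤ κ u' v' := by
  obtain ⟨e, he⟩ := H.inner.exists_frame L₁ H.finrank_fst
  have hB (x y : Fin n₁ → ℝ) : B (∑ i, x i • e i) (∑ i, y i • e i) = ∑ i, x i * y i := by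
    simp [map_sum, he.1, mul_comm]
  -- Coordinates of orthonormal pairs in L₁: a closed subset of a cube, nonempty because n₁ ≥ 2.
  let K : Set ((Fin n₁ → ℝ) × (Fin n₁ → ℝ)) :=
    {p | ∑ i, p.1 i * p.1 i = 1 ∧ ∑ i, p.2 i * p.2 i = 1 ∧ ∑ i, p.1 i * p.2 i = 0}
  have hclosed : IsClosed K := by
    refine IsClosed.and ?_ (IsClosed.and ?_ ?_)
    all_goals exact isClosed_eq (by fun_prop) continuous_const
  have hbound (x : Fin n₁ → ℝ) (hx : ∑ i, x i * x i = 1) :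
      x ∈ Set.Icc (fun _ ↦ (-1 : ℝ)) (fun _ ↦ (1 : ℝ)) := by
    have hle (i : Fin n₁) : x i * x i ≤ 1 :=
      hx ▸ Finset.single_le_sum (f := fun i ↦ x i * x i) (fun i _ ↦ mul_self_nonneg _)
        (Finset.mem_univ i)
    exact ⟨fun i ↦ by nlinarith [hle i], fun i ↦ by nlinarith [hle i]⟩
  have hK : IsCompact K := by
    have hI : IsCompact (Set.Icc (fun _ : Fin n₁ ↦ (-1 : ℝ)) (fun _ ↦ (1 : ℝ))) := isCompact_Icc
    exact (hI.prod hI).of_isClosed_subset hclosed fun p hp ↦ ⟨hbound _ hp.1, hbound _ hp.2.1⟩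
  have hne : K.Nonempty := by
    refine ⟨(Pi.single ⟨0, by omega⟩ 1, Pi.single ⟨1, by omega⟩ 1), ?_, ?_, ?_⟩ <;>
      simp [Pi.single_apply]
  -- On orthonormal pairs the curvature loses its denominator, so it is given by a polynomial that
  -- is continuous everywhere.
  let ψ : (Fin n₁ → ℝ) × (Fin n₁ → ℝ) → ℝ := fun p ↦
    c + gaussTerm B' h (∑ i, p.1 i • e i) (∑ i, p.2 i • e i)
  have hψ : Continuous ψ := by
    simp only [ψ, gaussTerm, map_sum, map_smul, LinearMap.sum_apply, LinearMap.smul_apply]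
    fun_prop
  obtain ⟨p, hp, hmin⟩ := hK.exists_isMinOn hne hψ.continuousOn
  have hmem (x : Fin n₁ → ℝ) : ∑ i, x i • e i ∈ L₁ :=
    L₁.sum_mem fun i _ ↦ L₁.smul_mem _ (he.mem i)
  have b₁ : B (∑ i, p.1 i • e i) (∑ i, p.1 i • e i) = 1 := (hB _ _).trans hp.1
  have b₂ : B (∑ i, p.2 i • e i) (∑ i, p.2 i • e i) = 1 := (hB _ _).trans hp.2.1
  have b₃ : B (∑ i, p.1 i • e i) (∑ i, p.2 i • e i) = 0 := (hB _ _).trans hp.2.2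
  refine ⟨_, hmem p.1, _, hmem p.2, ?_, fun u hu v hv huv ↦ ?_⟩
  · rw [LinearIndependent.pair_iff]
    intro s t hst
    have h₁ := congrArg (fun w ↦ B w (∑ i, p.1 i • e i)) hst
    have h₂ := congrArg (fun w ↦ B w (∑ i, p.2 i • e i)) hst
    simp only [map_add, map_smul, add_apply, smul_apply, b₁, b₂, b₃,
      H.inner.symm (∑ i, p.2 i • e i) (∑ i, p.1 i • e i)] at h₁ h₂
    simp at h₁ h₂
    exact ⟨h₁, h₂⟩
  -- An arbitrary plane is compared with the minimum through an orthonormal basis of it, whose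
  -- coordinates lie in K.
  · obtain ⟨f, hf, hspan⟩ := H.inner.exists_frame_adapted (P := Submodule.span ℝ {u, v})
      (L := Submodule.span ℝ {u, v}) le_rfl (k := 2) (finrank_span_pair huv)
    have hsp : Submodule.span ℝ {f 0, f 1} = Submodule.span ℝ {u, v} := by
      rw [← hf.2]
      congr 1
      ext w
      simp [eq_comm]
    have hfL (i : Fin 2) : f i ∈ L₁ := by
      have : Submodule.span ℝ {u, v} ≤ L₁ := by
        rw [Submodule.span_le]
        rintro w (rfl | rfl)
        exacts [hu, hv]
      exact this (hf.mem i)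
    rw [H.curv_eq_of_span_eq (hf.self_eq_one 0) (hf.self_eq_one 1) (hf.eq_zero (by simp)) huv hsp,
      H.curv_of_orthonormal b₁ b₂ b₃,
      H.curv_of_orthonormal (hf.self_eq_one 0) (hf.self_eq_one 1) (hf.eq_zero (by simp))]
    have ex (i : Fin 2) : f i = ∑ j, B (f i) (e j) • e j := he.expansion (hfL i)
    have : ψ p ≤ ψ (fun j ↦ B (f 0) (e j), fun j ↦ B (f 1) (e j)) := hmin (a := (fun j ↦ B (f 0) (e j), fun j ↦ B (f 1) (e j))) (by
      refine ⟨?_, ?_, ?_⟩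
      · rw [← hB, ← ex, hf.self_eq_one]
      · rw [← hB, ← ex, hf.self_eq_one]
      · rw [← hB, ← ex, ← ex, hf.eq_zero (by simp)])
    simpa only [ψ, ← ex] using this

variable [FiniteDimensional ℝ V]

theorem trace_top (H : IsSplitGauss B B' h L₁ L₂ S n₁ n₂ q c D κ)
    {e₁ : Fin n₁ → V} {e₂ : Fin n₂ → V} (h₁ : IsFrame B L₁ e₁) (h₂ : IsFrame B L₂ e₂) :
    traceOn B ⊤ (fun u v ↦ h u v) = ∑ i, h (e₁ i) (e₁ i) + ∑ s, h (e₂ s) (e₂ s) := by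
  have := IsFrame.append H.inner h₁ h₂ H.orth
  rw [H.sup] at this
  rw [this.traceOn_eq H.inner h, Fin.sum_univ_add]
  simp

variable [FiniteDimensional ℝ W]

/-- Chen's inequality for a plane in the first summand, and its equality case. -/
theorem plane (H : IsSplitGauss B B' h L₁ L₂ S n₁ n₂ q c D κ) (hn : 2 ≤ n₁) {u v : V}
    (hu : u ∈ L₁) (hv : v ∈ L₁) (huv : LinearIndependent ℝ ![u, v]) {β : ℝ}
    (hβ : β = B' (traceOn B ⊤ (fun u v ↦ h u v)) (traceOn B ⊤ (fun u v ↦ h u v)) / 2 - D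
      + 1 / 2 * n₁ * ((n₁ : ℝ) + 2 * n₂ - 1) * c - c) :
    ∑ i, ∑ j ∈ Finset.Ioi i, κ (frameOf B L₁ i) (frameOf B L₁ j) - κ u v ≤ β ∧
    (∑ i, ∑ j ∈ Finset.Ioi i, κ (frameOf B L₁ i) (frameOf B L₁ j) - κ u v = β ↔
      ∃ (e₁ : Fin n₁ → V) (e₂ : Fin n₂ → V) (ξ : Fin q → W),
        (IsFrame B L₁ e₁ ∧ IsFrame B L₂ e₂ ∧ IsFrame B' S ξ) ∧
        Submodule.span ℝ (e₁ '' {i | i.val < 2}) = Submodule.span ℝ {u, v} ∧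
        HasShapeForms B' h e₁ e₂ ξ) := by
  -- Holding for all frames adapted to the plane, this serves both directions: a constructed frame
  -- for existence, a given one for the converse.
  have key (e₁ : Fin n₁ → V) (e₂ : Fin n₂ → V) (h₁ : IsFrame B L₁ e₁) (h₂ : IsFrame B L₂ e₂)
      (hsp : Submodule.span ℝ (e₁ '' {i | i.val < 2}) = Submodule.span ℝ {u, v}) :
      ∑ i, ∑ j ∈ Finset.Ioi i, κ (frameOf B L₁ i) (frameOf B L₁ j) - κ u v ≤ β ∧
      (∑ i, ∑ j ∈ Finset.Ioi i, κ (frameOf B L₁ i) (frameOf B L₁ j) - κ u v = β ↔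
        IsChenIdeal h e₁ e₂) := by
    rw [h₁.span_image_two hn] at hsp
    rw [H.sum_curv_eq (H.inner.isFrame_frameOf L₁) h₁,
      H.curv_eq_of_span_eq (h₁.self_eq_one _) (h₁.self_eq_one _) (h₁.eq_zero (by simp)) huv hsp, hβ]
    exact H.frame_le hn h₁ h₂ (H.trace_top h₁ h₂)
  have hrank : Module.finrank ℝ (Submodule.span ℝ {u, v}) = 2 :=
    finrank_span_pair huv
  have hPL : Submodule.span ℝ {u, v} ≤ L₁ := by
    rw [Submodule.span_le]
    rintro w (rfl | rfl)
    exacts [hu, hv]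
  obtain ⟨e₁, h₁, hsp⟩ := H.inner.exists_frame_adapted hPL H.finrank_fst
  rw [hrank] at hsp
  obtain ⟨e₂, h₂⟩ := H.inner.exists_frame L₂ H.finrank_snd
  obtain ⟨ξ, hξ⟩ := H.inner'.exists_frame S H.finrank_normal
  refine ⟨(key e₁ e₂ h₁ h₂ hsp).1, fun heq ↦ ⟨e₁, e₂, ξ, ⟨h₁, h₂, hξ⟩, hsp, ?_⟩, ?_⟩
  · rw [← H.isChenIdeal_iff hn hξ]
    exact (key e₁ e₂ h₁ h₂ hsp).2.mp heq
  · rintro ⟨e₁, e₂, ξ, ⟨h₁, h₂, hξ⟩, hsp, hform⟩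
    rw [← H.isChenIdeal_iff hn hξ] at hform
    exact (key e₁ e₂ h₁ h₂ hsp).2.mpr hform

/-- Chen's inequality for the first Chen invariant of the first summand, and its equality case. -/
theorem chen (H : IsSplitGauss B B' h L₁ L₂ S n₁ n₂ q c D κ) (hn : 2 ≤ n₁) {β : ℝ}
    (hβ : β = B' (traceOn B ⊤ (fun u v ↦ h u v)) (traceOn B ⊤ (fun u v ↦ h u v)) / 2 - D
      + 1 / 2 * n₁ * ((n₁ : ℝ) + 2 * n₂ - 1) * c - c) {δ : ℝ}
    (hδ : δ = ∑ i, ∑ j ∈ Finset.Ioi i, κ (frameOf B L₁ i) (frameOf B L₁ j)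
      - sInf {k : ℝ | ∃ u ∈ L₁, ∃ v ∈ L₁, LinearIndependent ℝ ![u, v] ∧ k = κ u v}) :
    δ ≤ β ∧
    (δ = β ↔ ∃ (e₁ : Fin n₁ → V) (e₂ : Fin n₂ → V) (ξ : Fin q → W),
        (IsFrame B L₁ e₁ ∧ IsFrame B L₂ e₂ ∧ IsFrame B' S ξ) ∧ HasShapeForms B' h e₁ e₂ ξ) ∧
    (δ = β → (∀ u ∈ L₁, ∀ v ∈ L₂, h u v = 0) ∧ traceOn B L₁ (fun u v ↦ h u v) = 0 ∧
      traceOn B L₂ (fun u v ↦ h u v) = 0 ∧ traceOn B ⊤ (fun u v ↦ h u v) = 0) := by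
  obtain ⟨u, hu, v, hv, huv, hmin⟩ := H.exists_min_curv hn
  have hinf : sInf {k : ℝ | ∃ u ∈ L₁, ∃ v ∈ L₁, LinearIndependent ℝ ![u, v] ∧ k = κ u v} =
      κ u v := by
    refine IsLeast.csInf_eq ⟨⟨u, hu, v, hv, huv, rfl⟩, ?_⟩
    rintro k ⟨u', hu', v', hv', huv', rfl⟩
    exact hmin u' hu' v' hv' huv'
  rw [hinf] at hδ
  have hp := H.plane hn hu hv huv hβ
  rw [← hδ] at hp
  have hiff : δ = β ↔ ∃ (e₁ : Fin n₁ → V) (e₂ : Fin n₂ → V) (ξ : Fin q → W),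
      (IsFrame B L₁ e₁ ∧ IsFrame B L₂ e₂ ∧ IsFrame B' S ξ) ∧ HasShapeForms B' h e₁ e₂ ξ := by
    constructor
    · intro heq
      obtain ⟨e₁, e₂, ξ, hfr, -, hform⟩ := hp.2.mp heq
      exact ⟨e₁, e₂, ξ, hfr, hform⟩
    · rintro ⟨e₁, e₂, ξ, ⟨h₁, h₂, hξ⟩, hform⟩
      -- No plane is prescribed, so the one spanned by the first two frame vectors is used. It
      -- attains β, the minimal curvature is at most its curvature, and thus δ ≥ β.
      have hind := h₁.linearIndependent_pair (i := ⟨0, by omega⟩) (j := ⟨1, by omega⟩) (by simp)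
      have := (H.plane hn (h₁.mem _) (h₁.mem _) hind hβ).2.mpr
        ⟨e₁, e₂, ξ, ⟨h₁, h₂, hξ⟩, h₁.span_image_two hn, hform⟩
      have hle := hmin _ (h₁.mem ⟨0, by omega⟩) _ (h₁.mem ⟨1, by omega⟩) hind
      linarith [hp.1]
  refine ⟨hp.1, hiff, fun heq ↦ ?_⟩
  obtain ⟨e₁, e₂, ξ, ⟨h₁, h₂, hξ⟩, hform⟩ := hiff.mp heq
  have I := (H.isChenIdeal_iff hn hξ).mpr hform
  have t₁ : ∑ i, h (e₁ i) (e₁ i) = 0 := by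
    rw [sum_fin_eq_two hn _ (fun i hi ↦ I.rest i i fun h ↦ hi h.1)]
    exact I.corner _ _ rfl rfl
  refine ⟨fun u hu v hv ↦ ?_, ?_, ?_, ?_⟩
  · rw [h₁.expansion hu, h₂.expansion hv]
    simp [map_sum, LinearMap.sum_apply, I.mixed]
  · rw [h₁.traceOn_eq H.inner, t₁]
  · rw [h₂.traceOn_eq H.inner, I.trace]
  · rw [H.trace_top h₁ h₂, t₁, I.trace, add_zero]

end IsSplitGauss

end Algebraic

/-! ### The Gram form of a Riemannian metric in a chart. -/

section Charts

variable {E : Type*} [NormedAddCommGroup E] [NormedSpace ℝ E]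
  {H : Type*} [TopologicalSpace H] {I : ModelWithCorners ℝ E H}
  {M : Type*} [TopologicalSpace M] [ChartedSpace H M]

/-- Tangent vectors at p are their own coordinates in the preferred chart at p: the coordinate
change from that chart to itself is the identity. -/
theorem mfderivWithin_extChartAt_symm_self [IsManifold I 1 M] (p : M) (v : E) :
    mfderivWithin 𝓘(ℝ, E) I (extChartAt I p).symm (Set.range I) (extChartAt I p p) v = v := by
  have h := TangentBundle.symmL_trivializationAt (𝕜 := ℝ) (I := I) (mem_chart_source H p)
  have h' : (trivializationAt E (TangentSpace I : M → Type _) p).symmL ℝ p v = v := by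
    rw [TangentBundle.symmL_trivializationAt_eq_core (mem_chart_source H p)]
    exact (tangentBundleCore I M).coordChange_self _ _ (mem_chart_source H p) v
  exact (congrArg (fun L : E →L[ℝ] E ↦ L v) h).symm.trans h'

theorem chartMetric_apply (g : ∀ p : M, TangentSpace I p →L[ℝ] TangentSpace I p →L[ℝ] ℝ)
    (p : M) (z u v : E) :
    chartMetric I g p z u v = g ((extChartAt I p).symm z)
      (mfderivWithin 𝓘(ℝ, E) I (extChartAt I p).symm (Set.range I) z u)
      (mfderivWithin 𝓘(ℝ, E) I (extChartAt I p).symm (Set.range I) z v) := rfl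

theorem chartMetric_self [IsManifold I 1 M]
    (g : ∀ p : M, TangentSpace I p →L[ℝ] TangentSpace I p →L[ℝ] ℝ) (p : M) (u v : E) :
    chartMetric I g p (extChartAt I p p) u v = g p u v := by
  rw [chartMetric_apply]
  -- The point obtained by going through the chart and back equals p only propositionally, so the
  -- form is transported along this equality.
  have key (q : M) (hq : q = p) (a b : E) :
      (g q : E →L[ℝ] E →L[ℝ] ℝ) a b = (g p : E →L[ℝ] E →L[ℝ] ℝ) a b := by
    subst hq
    rfl
  refine (key _ (extChartAt_to_inv p) _ _).trans ?_
  exact congrArg₂ (fun a b : E ↦ (g p : E →L[ℝ] E →L[ℝ] ℝ) a b)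
    (mfderivWithin_extChartAt_symm_self p u) (mfderivWithin_extChartAt_symm_self p v)

variable [IsManifold I ∞ M]

theorem chartMetric_symm (g : ContMDiffRiemannianMetric I ∞ E (fun p : M ↦ TangentSpace I p))
    (p : M) (z u v : E) :
    chartMetric I g.inner p z u v = chartMetric I g.inner p z v u := by
  rw [chartMetric_apply, chartMetric_apply]
  exact g.symm ((extChartAt I p).symm z) _ _

theorem chartMetric_pos (g : ContMDiffRiemannianMetric I ∞ E (fun p : M ↦ TangentSpace I p))
    (p : M) {z : E} (hz : z ∈ (extChartAt I p).target) (u : E) (hu : u ≠ 0) :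
    0 < chartMetric I g.inner p z u u := by
  rw [chartMetric_apply]
  refine g.pos ((extChartAt I p).symm z) _ fun h0 ↦ hu ?_
  have := isInvertible_mfderivWithin_extChartAt_symm (I := I) hz
  exact this.injective (h0.trans (map_zero _).symm)

variable [FiniteDimensional ℝ E] [I.Boundaryless]

/-- Smoothness of the metric as a section of the bundle of bilinear forms means smoothness in the
trivialization at p, whose inverse is the derivative of the inverse chart. -/
theorem contDiffAt_chartMetric
    (g : ContMDiffRiemannianMetric I ∞ E (fun p : M ↦ TangentSpace I p)) (p : M) :
    ContDiffAt ℝ ∞ (chartMetric I g.inner p) (extChartAt I p p) := by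
  refine contDiffAt_bilin fun u v ↦ ?_
  have h₁ := ((contMDiffAt_hom_bundle _).mp (g.contMDiff p)).2
  have h₂ : ContMDiffAt 𝓘(ℝ, E) I ∞ (extChartAt I p).symm (extChartAt I p p) :=
    (contMDiffOn_extChartAt_symm p).contMDiffAt (extChartAt_target_mem_nhds p)
  have h₃ := ContMDiffAt.comp_of_eq (x := extChartAt I p p) h₁ h₂ (extChartAt_to_inv p)
  have h₄ := ((contMDiffAt_iff_contDiffAt.mp h₃).clm_apply (contDiffAt_const (c := u))).clm_apply
    (contDiffAt_const (c := v))
  refine h₄.congr_of_eventuallyEq ?_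
  filter_upwards [extChartAt_target_mem_nhds p] with z hz
  have hs : (extChartAt I p).symm z ∈ (chartAt H p).source := by
    rw [← extChartAt_source I]
    exact (extChartAt I p).map_target hz
  have hr : extChartAt I p ((extChartAt I p).symm z) = z := (extChartAt I p).right_inv hz
  rw [chartMetric_apply]
  have hA (w : E) : (trivializationAt E (TangentSpace I : M → Type _) p).symm
      ((extChartAt I p).symm z) w =
      mfderivWithin 𝓘(ℝ, E) I (extChartAt I p).symm (Set.range I) z w := by
    have h := TangentBundle.symmL_trivializationAt (𝕜 := ℝ) (I := I) hs
    rw [hr] at h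
    refine Eq.trans ?_ (congrArg (fun L : E →L[ℝ] E ↦ L w) h)
    exact (Trivialization.symmL_apply _ hs w).symm
  refine Eq.symm ((inCoordinates_apply_eq₂ (E₃ := Bundle.Trivial M ℝ) (F₃ := ℝ) ?_ ?_ ?_).trans ?_)
  · exact hs
  · exact hs
  · trivial
  · rw [hA, hA]
    exact congrArg (fun L : ℝ →ₗ[ℝ] ℝ ↦ L _) (Bundle.Trivial.linearMapAt_trivialization ℝ M ℝ _)

theorem isLocalMetric_chartMetric
    (g : ContMDiffRiemannianMetric I ∞ E (fun p : M ↦ TangentSpace I p)) (p : M) :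
    IsLocalMetric (chartMetric I g.inner p) (extChartAt I p p) where
  smooth := (contDiffAt_chartMetric g p).of_le (by norm_cast)
  symm := .of_forall fun z u v ↦ chartMetric_symm g p z u v
  pos := by
    filter_upwards [extChartAt_target_mem_nhds p] with z hz u hu
    exact chartMetric_pos g p hz u hu

end Charts

/-! ### From an isometric immersion to an isometric map in charts. -/

section Immersions

variable {E : Type*} [NormedAddCommGroup E] [NormedSpace ℝ E]
  {H : Type*} [TopologicalSpace H] {I : ModelWithCorners ℝ E H} [I.Boundaryless]
  {M : Type*} [TopologicalSpace M] [ChartedSpace H M]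
  {g : ∀ p : M, TangentSpace I p →L[ℝ] TangentSpace I p →L[ℝ] ℝ}
  {E' : Type*} [NormedAddCommGroup E'] [NormedSpace ℝ E']
  {H' : Type*} [TopologicalSpace H'] {I' : ModelWithCorners ℝ E' H'}
  {M' : Type*} [TopologicalSpace M'] [ChartedSpace H' M']
  {g' : ∀ p : M', TangentSpace I' p →L[ℝ] TangentSpace I' p →L[ℝ] ℝ} {φ : M → M'}

theorem contDiffAt_writtenInExtChartAt (hφ : ContMDiff I I' ∞ φ) (x : M) :
    ContDiffAt ℝ ∞ (writtenInExtChartAt I I' x φ) (extChartAt I x x) := by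
  have := (contMDiffAt_iff.mp (hφ x)).2
  rwa [I.range_eq_univ, contDiffWithinAt_univ] at this

theorem mfderiv_eq_fderiv_writtenInExtChartAt (hφ : ContMDiff I I' ∞ φ) (x : M) (v : E) :
    mfderiv I I' φ x v = fderiv ℝ (writtenInExtChartAt I I' x φ) (extChartAt I x x) v := by
  rw [((hφ x).mdifferentiableAt (by simp)).mfderiv, I.range_eq_univ, fderivWithin_univ]
  rfl

variable [IsManifold I ∞ M]

theorem hasMFDerivAt_extChartAt_symm (p : M) {z : E} (hz : z ∈ (extChartAt I p).target) :
    HasMFDerivAt 𝓘(ℝ, E) I (extChartAt I p).symm z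
      (mfderivWithin 𝓘(ℝ, E) I (extChartAt I p).symm (Set.range I) z) := by
  have h := (mdifferentiableWithinAt_extChartAt_symm (I := I) hz).hasMFDerivWithinAt
  rw [← hasMFDerivWithinAt_univ, ← I.range_eq_univ]
  exact h

variable [I'.Boundaryless] [IsManifold I' ∞ M']

/-- Both composites around the chart square agree near the base point, so the chain rule and
uniqueness of derivatives give the identity at all nearby points. -/
theorem mfderivWithin_symm_fderiv_writtenInExtChartAt (hφ : ContMDiff I I' ∞ φ) (x : M) :
    ∀ᶠ z in nhds (extChartAt I x x), (extChartAt I' (φ x)).symm (writtenInExtChartAt I I' x φ z) =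
      φ ((extChartAt I x).symm z) ∧
      ∀ v : E, (mfderivWithin 𝓘(ℝ, E') I' (extChartAt I' (φ x)).symm (Set.range I')
        (writtenInExtChartAt I I' x φ z) (fderiv ℝ (writtenInExtChartAt I I' x φ) z v) : E') =
      (mfderiv I I' φ ((extChartAt I x).symm z)
        (mfderivWithin 𝓘(ℝ, E) I (extChartAt I x).symm (Set.range I) z v) : E') := by
  have hc : ContinuousAt (φ ∘ (extChartAt I x).symm) (extChartAt I x x) := by
    refine ContinuousAt.comp (hφ.continuous.continuousAt) (continuousAt_extChartAt_symm x)
  have hs : ∀ᶠ z in nhds (extChartAt I x x),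
      φ ((extChartAt I x).symm z) ∈ (extChartAt I' (φ x)).source := by
    refine hc.eventually ?_
    simp only [Function.comp_apply, extChartAt_to_inv]
    exact extChartAt_source_mem_nhds (φ x)
  have hF : ∀ᶠ z in nhds (extChartAt I x x),
      ContDiffAt ℝ 1 (writtenInExtChartAt I I' x φ) z :=
    ((contDiffAt_writtenInExtChartAt hφ x).of_le (by norm_cast)).eventually (by simp)
  filter_upwards [hs.eventually_nhds, hF, extChartAt_target_mem_nhds x] with z hz hFz hzt
  have heq (w : E) (hw : φ ((extChartAt I x).symm w) ∈ (extChartAt I' (φ x)).source) :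
      (extChartAt I' (φ x)).symm (writtenInExtChartAt I I' x φ w) =
        φ ((extChartAt I x).symm w) :=
    (extChartAt I' (φ x)).left_inv hw
  refine ⟨heq z hz.self_of_nhds, fun v ↦ ?_⟩
  have h₁ := hasMFDerivAt_extChartAt_symm (I := I) x hzt
  have h₂ := ((hφ ((extChartAt I x).symm z)).mdifferentiableAt (by simp)).hasMFDerivAt
  have h₃ := h₂.comp z h₁
  have h₄ := (hFz.differentiableAt (by simp)).hasFDerivAt.hasMFDerivAt
  have h₅ := hasMFDerivAt_extChartAt_symm (I := I') (φ x)
    ((extChartAt I' (φ x)).map_source hz.self_of_nhds)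
  have h₆ := h₅.comp z h₄
  have h₇ := hasMFDerivAt_unique (h₃.congr_of_eventuallyEq (hz.mono fun w hw ↦ heq w hw)) h₆
  exact (congrArg (fun L : E →L[ℝ] E' ↦ L v) h₇).symm

theorem isLocalIsometry_writtenInExtChartAt (hφ : IsIsometricImmersion I g I' g' φ) (x : M)
    (hg : IsLocalMetric (chartMetric I g x) (extChartAt I x x))
    (hg' : IsLocalMetric (chartMetric I' g' (φ x)) (extChartAt I' (φ x) (φ x))) :
    IsLocalIsometry (chartMetric I g x) (chartMetric I' g' (φ x))
      (writtenInExtChartAt I I' x φ) (extChartAt I x x) where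
  source := hg
  target := by
    have : writtenInExtChartAt I I' x φ (extChartAt I x x) = extChartAt I' (φ x) (φ x) := by
      simp [writtenInExtChartAt]
    rwa [this]
  smooth := (contDiffAt_writtenInExtChartAt hφ.1 x).of_le (by norm_cast)
  isometry := by
    filter_upwards [mfderivWithin_symm_fderiv_writtenInExtChartAt hφ.1 x] with z hz u v
    rw [chartMetric_apply, chartMetric_apply, ← hφ.2]
    have key (q : M') (hq : q = φ ((extChartAt I x).symm z)) (a b : E') :
        (g' q : E' →L[ℝ] E' →L[ℝ] ℝ) a b =
          (g' (φ ((extChartAt I x).symm z)) : E' →L[ℝ] E' →L[ℝ] ℝ) a b := by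
      subst hq
      rfl
    refine (key _ hz.1 _ _).trans ?_
    exact congrArg₂ (fun a b : E' ↦
      (g' (φ ((extChartAt I x).symm z)) : E' →L[ℝ] E' →L[ℝ] ℝ) a b) (hz.2 u) (hz.2 v)

end Immersions

/-! ### The warped product metric in product charts. -/

section WarpedCharts

variable {E₁ : Type*} [NormedAddCommGroup E₁] [NormedSpace ℝ E₁]
  {H₁ : Type*} [TopologicalSpace H₁] {I₁ : ModelWithCorners ℝ E₁ H₁}
  {N₁ : Type*} [TopologicalSpace N₁] [ChartedSpace H₁ N₁]
  {E₂ : Type*} [NormedAddCommGroup E₂] [NormedSpace ℝ E₂]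
  {H₂ : Type*} [TopologicalSpace H₂] {I₂ : ModelWithCorners ℝ E₂ H₂}
  {N₂ : Type*} [TopologicalSpace N₂] [ChartedSpace H₂ N₂]

theorem warpedMetric_apply (g₁ : ∀ p : N₁, TangentSpace I₁ p →L[ℝ] TangentSpace I₁ p →L[ℝ] ℝ)
    (g₂ : ∀ p : N₂, TangentSpace I₂ p →L[ℝ] TangentSpace I₂ p →L[ℝ] ℝ) (f : N₁ → ℝ)
    (x : N₁ × N₂) (u v : E₁ × E₂) :
    warpedMetric I₁ I₂ g₁ g₂ f x u v = (g₁ x.1 : E₁ →L[ℝ] E₁ →L[ℝ] ℝ) u.1 v.1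
      + f x.1 ^ 2 * (g₂ x.2 : E₂ →L[ℝ] E₂ →L[ℝ] ℝ) u.2 v.2 := by
  unfold warpedMetric
  rw [mfderiv_fst, mfderiv_snd]
  rfl

variable [I₁.Boundaryless] [I₂.Boundaryless] [IsManifold I₁ ∞ N₁] [IsManifold I₂ ∞ N₂]

/-- The chart of the product is the product of the charts; each component follows by composing with
a projection. -/
theorem mfderivWithin_extChartAt_prod_symm (x : N₁ × N₂) {z : E₁ × E₂}
    (hz : z ∈ (extChartAt (I₁.prod I₂) x).target) (u : E₁ × E₂) :
    (mfderivWithin 𝓘(ℝ, E₁ × E₂) (I₁.prod I₂) (extChartAt (I₁.prod I₂) x).symm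
      (Set.range (I₁.prod I₂)) z u : E₁ × E₂) =
    ((mfderivWithin 𝓘(ℝ, E₁) I₁ (extChartAt I₁ x.1).symm (Set.range I₁) z.1 u.1 : E₁),
      (mfderivWithin 𝓘(ℝ, E₂) I₂ (extChartAt I₂ x.2).symm (Set.range I₂) z.2 u.2 : E₂)) := by
  have hz' : z.1 ∈ (extChartAt I₁ x.1).target ∧ z.2 ∈ (extChartAt I₂ x.2).target := by
    rwa [extChartAt_prod, PartialEquiv.prod_target, Set.mem_prod] at hz
  have h := hasMFDerivAt_extChartAt_symm (I := I₁.prod I₂) x hz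
  refine Prod.ext ?_ ?_
  · have h₁ := (hasMFDerivAt_fst (I := I₁) (I' := I₂)
      ((extChartAt (I₁.prod I₂) x).symm z)).comp z h
    have h₂ := (hasMFDerivAt_extChartAt_symm (I := I₁) x.1 hz'.1).comp z
      (hasFDerivAt_fst (𝕜 := ℝ) (p := z)).hasMFDerivAt
    have h₃ := hasMFDerivAt_unique h₁ (h₂.congr_of_eventuallyEq (.of_forall fun _ ↦ rfl))
    exact congrArg (fun L : E₁ × E₂ →L[ℝ] E₁ ↦ L u) h₃
  · have h₁ := (hasMFDerivAt_snd (I := I₁) (I' := I₂)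
      ((extChartAt (I₁.prod I₂) x).symm z)).comp z h
    have h₂ := (hasMFDerivAt_extChartAt_symm (I := I₂) x.2 hz'.2).comp z
      (hasFDerivAt_snd (𝕜 := ℝ) (p := z)).hasMFDerivAt
    have h₃ := hasMFDerivAt_unique h₁ (h₂.congr_of_eventuallyEq (.of_forall fun _ ↦ rfl))
    exact congrArg (fun L : E₁ × E₂ →L[ℝ] E₂ ↦ L u) h₃

variable [FiniteDimensional ℝ E₁] [FiniteDimensional ℝ E₂]

theorem isLocalWarped_chartMetric
    (g₁ : ContMDiffRiemannianMetric I₁ ∞ E₁ (fun p : N₁ ↦ TangentSpace I₁ p))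
    (g₂ : ContMDiffRiemannianMetric I₂ ∞ E₂ (fun p : N₂ ↦ TangentSpace I₂ p))
    {f : N₁ → ℝ} (hf : ContMDiff I₁ 𝓘(ℝ, ℝ) ∞ f) (hf_pos : ∀ p, 0 < f p) (x : N₁ × N₂) :
    IsLocalWarped (chartMetric (I₁.prod I₂) (warpedMetric I₁ I₂ g₁.inner g₂.inner f) x)
      (chartMetric I₁ g₁.inner x.1) (chartMetric I₂ g₂.inner x.2)
      (f ∘ (extChartAt I₁ x.1).symm) (extChartAt (I₁.prod I₂) x x) where
  fst := by
    have : (extChartAt (I₁.prod I₂) x x).1 = extChartAt I₁ x.1 x.1 := rfl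
    rw [this]
    exact isLocalMetric_chartMetric g₁ x.1
  snd := by
    have : (extChartAt (I₁.prod I₂) x x).2 = extChartAt I₂ x.2 x.2 := rfl
    rw [this]
    exact isLocalMetric_chartMetric g₂ x.2
  smooth := by
    have : (extChartAt (I₁.prod I₂) x x).1 = extChartAt I₁ x.1 x.1 := rfl
    rw [this]
    exact (contDiffAt_writtenInExtChartAt hf x.1).of_le (by norm_cast)
  pos := hf_pos _
  apply_eq := by
    filter_upwards [extChartAt_target_mem_nhds x] with z hz u v
    rw [chartMetric_apply]
    refine (warpedMetric_apply _ _ _ _ _ _).trans ?_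
    rw [mfderivWithin_extChartAt_prod_symm x hz, mfderivWithin_extChartAt_prod_symm x hz]
    rfl

end WarpedCharts

/-! ### Second derivatives as bilinear maps; dimension of the normal space. -/

section Pointwise

variable {V : Type*} [NormedAddCommGroup V] [NormedSpace ℝ V]
  {W : Type*} [NormedAddCommGroup W] [NormedSpace ℝ W]

theorem IsInner.linearIndependent_of_gram {B : V →L[ℝ] V →L[ℝ] ℝ} (hB : IsInner B) {u v : V}
    (h : gram B u v ≠ 0) : LinearIndependent ℝ ![u, v] := by
  rw [LinearIndependent.pair_iff]
  intro s t hst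
  have h₁ := congrArg (fun w ↦ B w u) hst
  have h₂ := congrArg (fun w ↦ B w v) hst
  simp only [map_add, map_smul, add_apply, smul_apply, smul_eq_mul, map_zero,
    zero_apply, hB.symm v u] at h₁ h₂
  have hs : gram B u v * s = 0 := by
    unfold gram
    linear_combination B v v * h₁ - B u v * h₂
  have ht : gram B u v * t = 0 := by
    unfold gram
    linear_combination B u u * h₂ - B u v * h₁
  exact ⟨(mul_eq_zero.mp hs).resolve_left h, (mul_eq_zero.mp ht).resolve_left h⟩

theorem IsLocalMetric.isInner {G : V → V →L[ℝ] V →L[ℝ] ℝ} {y : V} (h : IsLocalMetric G y) :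
    IsInner (G y) := ⟨h.symm_self, h.pos_self⟩

/-- The second derivative as a bilinear map. -/
def secondDerivBilin (F : V → W) (y : V) (hF : DifferentiableAt ℝ (fderiv ℝ F) y) :
    V →ₗ[ℝ] V →ₗ[ℝ] W :=
  LinearMap.mk₂ ℝ (fun u v ↦ fderiv ℝ (fun z ↦ fderiv ℝ F z v) y u)
    (fun u u' v ↦ map_add _ _ _) (fun t u v ↦ map_smul _ _ _)
    (fun u v v' ↦ by simp only [fderiv_fderiv_apply hF]; exact map_add _ _ _)
    (fun t u v ↦ by simp only [fderiv_fderiv_apply hF]; exact map_smul _ _ _)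

/-- The second fundamental form as a bilinear map. -/
def secondFormBilin (G : V → V →L[ℝ] V →L[ℝ] ℝ) (G' : W → W →L[ℝ] W →L[ℝ] ℝ) (F : V → W) (y : V)
    (hF : DifferentiableAt ℝ (fderiv ℝ F) y) : V →ₗ[ℝ] V →ₗ[ℝ] W :=
  secondDerivBilin F y hF
    + (christoffelBilin G' (F y)).compl₁₂ (fderiv ℝ F y).toLinearMap (fderiv ℝ F y).toLinearMap
    - (christoffelBilin G y).compr₂ (fderiv ℝ F y).toLinearMap

/-- The normal space of an isometric injection has complementary dimension. -/
theorem finrank_normal_eq [FiniteDimensional ℝ V] [FiniteDimensional ℝ W]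
    {B : V →L[ℝ] V →L[ℝ] ℝ} (hB : IsInner B) (B' : W →L[ℝ] W →L[ℝ] ℝ) (A : V →L[ℝ] W)
    (hA : ∀ u v, B' (A u) (A v) = B u v) (S : Submodule ℝ W)
    (hS : ∀ w, w ∈ S ↔ ∀ u, B' (A u) w = 0) :
    Module.finrank ℝ S = Module.finrank ℝ W - Module.finrank ℝ V := by
  -- The normal space is the kernel of this map. Restricted to the image of A the map is already
  -- onto the dual, so rank-nullity gives the codimension.
  let T : W →ₗ[ℝ] Module.Dual ℝ V :=
    LinearMap.mk₂ ℝ (fun w u ↦ B' (A u) w) (by simp) (by simp) (by simp) (by simp)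
  have hker : LinearMap.ker T = S := by
    ext w
    rw [hS, LinearMap.mem_ker]
    exact ⟨fun h u ↦ congrArg (fun L : Module.Dual ℝ V ↦ L u) h, fun h ↦ LinearMap.ext h⟩
  have hinj : Function.Injective (T ∘ₗ A.toLinearMap) := by
    rw [← LinearMap.ker_eq_bot, LinearMap.ker_eq_bot']
    intro u hu
    have h₀ : B' (A u) (A u) = 0 := congrArg (fun L : Module.Dual ℝ V ↦ L u) hu
    rw [hA] at h₀
    exact hB.self_eq_zero.mp h₀
  have hsurj : Function.Surjective (T ∘ₗ A.toLinearMap) :=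
    (LinearMap.injective_iff_surjective_of_finrank_eq_finrank
      (Subspace.dual_finrank_eq (K := ℝ) (V := V)).symm).mp hinj
  have hrange : LinearMap.range T = ⊤ := by
    rw [LinearMap.range_eq_top]
    exact Function.Surjective.of_comp hsurj
  have := T.finrank_range_add_finrank_ker
  rw [hker, hrange, finrank_top, Subspace.dual_finrank_eq] at this
  omega

end Pointwise

/-! ### Tangent spaces of the factors as coordinate subspaces. -/

section Factors

variable {E₁ : Type*} [NormedAddCommGroup E₁] [NormedSpace ℝ E₁]
  {H₁ : Type*} [TopologicalSpace H₁] {I₁ : ModelWithCorners ℝ E₁ H₁}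
  {N₁ : Type*} [TopologicalSpace N₁] [ChartedSpace H₁ N₁]
  {E₂ : Type*} [NormedAddCommGroup E₂] [NormedSpace ℝ E₂]
  {H₂ : Type*} [TopologicalSpace H₂] {I₂ : ModelWithCorners ℝ E₂ H₂}
  {N₂ : Type*} [TopologicalSpace N₂] [ChartedSpace H₂ N₂]

theorem leaf_eq (x : N₁ × N₂) :
    (leaf I₁ I₂ x : Submodule ℝ (E₁ × E₂)) = LinearMap.range (LinearMap.inl ℝ E₁ E₂) := by
  unfold leaf
  rw [mfderiv_snd, LinearMap.range_inl]
  rfl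

theorem fiber_eq (x : N₁ × N₂) :
    (fiber I₁ I₂ x : Submodule ℝ (E₁ × E₂)) = LinearMap.range (LinearMap.inr ℝ E₁ E₂) := by
  unfold fiber
  rw [mfderiv_fst, LinearMap.range_inr]
  rfl

end Factors

/-! ### Sectional curvatures of the warped product. -/

section Submanifold

variable {n₁ n₂ m : ℕ}
  {N₁ : Type*} [TopologicalSpace N₁] [ChartedSpace (EuclideanSpace ℝ (Fin n₁)) N₁]
  [IsManifold (𝓡 n₁) ∞ N₁]
  {N₂ : Type*} [TopologicalSpace N₂] [ChartedSpace (EuclideanSpace ℝ (Fin n₂)) N₂]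
  [IsManifold (𝓡 n₂) ∞ N₂]
  {M' : Type*} [TopologicalSpace M'] [ChartedSpace (EuclideanSpace ℝ (Fin m)) M']
  [IsManifold (𝓡 m) ∞ M']
  {g₁ : ContMDiffRiemannianMetric (𝓡 n₁) ∞ (EuclideanSpace ℝ (Fin n₁))
    (fun p : N₁ ↦ TangentSpace (𝓡 n₁) p)}
  {g₂ : ContMDiffRiemannianMetric (𝓡 n₂) ∞ (EuclideanSpace ℝ (Fin n₂))
    (fun p : N₂ ↦ TangentSpace (𝓡 n₂) p)}
  {g' : ContMDiffRiemannianMetric (𝓡 m) ∞ (EuclideanSpace ℝ (Fin m))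
    (fun p : M' ↦ TangentSpace (𝓡 m) p)}
  {f : N₁ → ℝ} {c : ℝ}
  {g : ∀ x : N₁ × N₂, TangentSpace ((𝓡 n₁).prod (𝓡 n₂)) x →L[ℝ]
    TangentSpace ((𝓡 n₁).prod (𝓡 n₂)) x →L[ℝ] ℝ}
  {φ : N₁ × N₂ → M'}

theorem warpedMetric_leaf (hg : g = warpedMetric (𝓡 n₁) (𝓡 n₂) g₁.inner g₂.inner f) (x : N₁ × N₂)
    (a b : EuclideanSpace ℝ (Fin n₁)) :
    g x ((a, 0) : EuclideanSpace ℝ (Fin n₁) × EuclideanSpace ℝ (Fin n₂))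
      ((b, 0) : EuclideanSpace ℝ (Fin n₁) × EuclideanSpace ℝ (Fin n₂)) = g₁.inner x.1 a b := by
  subst hg
  have key (C : EuclideanSpace ℝ (Fin n₂) →L[ℝ] EuclideanSpace ℝ (Fin n₂) →L[ℝ] ℝ) (r s : ℝ) :
      r + s * C 0 0 = r := by simp
  exact (warpedMetric_apply _ _ _ _ _ _).trans (key (g₂.inner x.2) _ _)

theorem warpedMetric_fiber (hg : g = warpedMetric (𝓡 n₁) (𝓡 n₂) g₁.inner g₂.inner f)
    (x : N₁ × N₂) (a b : EuclideanSpace ℝ (Fin n₂)) :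
    g x ((0, a) : EuclideanSpace ℝ (Fin n₁) × EuclideanSpace ℝ (Fin n₂))
      ((0, b) : EuclideanSpace ℝ (Fin n₁) × EuclideanSpace ℝ (Fin n₂)) =
      f x.1 ^ 2 * g₂.inner x.2 a b := by
  subst hg
  have key (C : EuclideanSpace ℝ (Fin n₁) →L[ℝ] EuclideanSpace ℝ (Fin n₁) →L[ℝ] ℝ) (r : ℝ) :
      C 0 0 + r = r := by simp
  exact (warpedMetric_apply _ _ _ _ _ _).trans (key (g₁.inner x.1) _)

theorem warpedMetric_mixed (hg : g = warpedMetric (𝓡 n₁) (𝓡 n₂) g₁.inner g₂.inner f)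
    (x : N₁ × N₂) (a : EuclideanSpace ℝ (Fin n₁)) (b : EuclideanSpace ℝ (Fin n₂)) :
    g x ((a, 0) : EuclideanSpace ℝ (Fin n₁) × EuclideanSpace ℝ (Fin n₂))
      ((0, b) : EuclideanSpace ℝ (Fin n₁) × EuclideanSpace ℝ (Fin n₂)) = 0 := by
  subst hg
  have key (C : EuclideanSpace ℝ (Fin n₁) →L[ℝ] EuclideanSpace ℝ (Fin n₁) →L[ℝ] ℝ)
      (C' : EuclideanSpace ℝ (Fin n₂) →L[ℝ] EuclideanSpace ℝ (Fin n₂) →L[ℝ] ℝ) (r : ℝ) :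
      C a 0 + r * C' 0 b = 0 := by simp
  exact (warpedMetric_apply _ _ _ _ _ _).trans (key (g₁.inner x.1) (g₂.inner x.2) _)

/-- The sectional curvature of a plane tangent to the first factor of a warped product. -/
theorem sectional_leaf (hf : ContMDiff (𝓡 n₁) 𝓘(ℝ, ℝ) ∞ f) (hf_pos : ∀ p, 0 < f p)
    (hg : g = warpedMetric (𝓡 n₁) (𝓡 n₂) g₁.inner g₂.inner f) (x : N₁ × N₂)
    (u v : EuclideanSpace ℝ (Fin n₁)) :
    sectional ((𝓡 n₁).prod (𝓡 n₂)) g x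
        ((u, 0) : EuclideanSpace ℝ (Fin n₁) × EuclideanSpace ℝ (Fin n₂))
        ((v, 0) : EuclideanSpace ℝ (Fin n₁) × EuclideanSpace ℝ (Fin n₂)) =
      sectional (𝓡 n₁) g₁.inner x.1 u v := by
  subst hg
  have hW := isLocalWarped_chartMetric g₁ g₂ hf hf_pos x
  have h₁ := hW.curvature_leaf u v v u
  rw [chartMetric_self] at h₁
  have h₂ := chartMetric_self g₁.inner x.1
    (coordCurvature (chartMetric (𝓡 n₁) g₁.inner x.1) (extChartAt (𝓡 n₁) x.1 x.1) u v v) u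
  have h₃ := h₁.trans h₂
  have h₄ := warpedMetric_leaf (g₁ := g₁) (g₂ := g₂) (f := f) rfl x
  unfold sectional
  rw [h₄, h₄, h₄]
  congr 1

/-- The sectional curvature of a mixed plane of a warped product. -/
theorem sectional_mixed (hf : ContMDiff (𝓡 n₁) 𝓘(ℝ, ℝ) ∞ f) (hf_pos : ∀ p, 0 < f p)
    (hg : g = warpedMetric (𝓡 n₁) (𝓡 n₂) g₁.inner g₂.inner f) (x : N₁ × N₂)
    (u : EuclideanSpace ℝ (Fin n₁)) (w : EuclideanSpace ℝ (Fin n₂))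
    (hu : g x ((u, 0) : EuclideanSpace ℝ (Fin n₁) × EuclideanSpace ℝ (Fin n₂))
      ((u, 0) : EuclideanSpace ℝ (Fin n₁) × EuclideanSpace ℝ (Fin n₂)) = 1)
    (hw : g x ((0, w) : EuclideanSpace ℝ (Fin n₁) × EuclideanSpace ℝ (Fin n₂))
      ((0, w) : EuclideanSpace ℝ (Fin n₁) × EuclideanSpace ℝ (Fin n₂)) = 1) :
    sectional ((𝓡 n₁).prod (𝓡 n₂)) g x
        ((u, 0) : EuclideanSpace ℝ (Fin n₁) × EuclideanSpace ℝ (Fin n₂))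
        ((0, w) : EuclideanSpace ℝ (Fin n₁) × EuclideanSpace ℝ (Fin n₂)) =
      -(hessian (𝓡 n₁) g₁.inner f x.1 u u / f x.1) := by
  subst hg
  have hW := isLocalWarped_chartMetric g₁ g₂ hf hf_pos x
  have h₁ := hW.curvature_mixed u w
  rw [chartMetric_self] at h₁
  have h₂ : chartMetric (𝓡 n₂) g₂.inner x.2 (extChartAt ((𝓡 n₁).prod (𝓡 n₂)) x x).2 w w =
      g₂.inner x.2 w w := chartMetric_self g₂.inner x.2 w w
  have hF : (f ∘ (extChartAt (𝓡 n₁) x.1).symm) (extChartAt ((𝓡 n₁).prod (𝓡 n₂)) x x).1 = f x.1 :=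
    congrArg f (extChartAt_to_inv x.1)
  rw [h₂, hF] at h₁
  -- A unit vector of the fibre has g₂-square 1/f², which turns the factor f g₂(w,w) into 1/f.
  have h₃ : f x.1 ^ 2 * g₂.inner x.2 w w = 1 := by
    rw [← hw]
    exact (warpedMetric_fiber (g₁ := g₁) (g₂ := g₂) (f := f) rfl x w w).symm
  have h₄ := warpedMetric_mixed (g₁ := g₁) (g₂ := g₂) (f := f) rfl x u w
  have hp := (hf_pos x.1).ne'
  have h₅ : g₂.inner x.2 w w = 1 / f x.1 ^ 2 := by
    field_simp
    linarith
  -- The coordinate expression is by definition the Hessian of f at the first component.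
  have h₆ := h₁.trans (b := -(f x.1 * g₂.inner x.2 w w * hessian (𝓡 n₁) g₁.inner f x.1 u u)) rfl
  unfold sectional
  rw [hu, hw, h₄]
  refine (congrArg (fun t : ℝ ↦ t / (1 * 1 - 0 ^ 2)) h₆).trans ?_
  rw [h₅]
  field_simp
  simp

end Submanifold

/-! ### The Gauss equation for an immersion into a space form. -/

section GaussImmersion

variable {E : Type*} [NormedAddCommGroup E] [NormedSpace ℝ E]
  {H : Type*} [TopologicalSpace H] {I : ModelWithCorners ℝ E H}
  {M : Type*} [TopologicalSpace M] [ChartedSpace H M]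
  {g : ∀ p : M, TangentSpace I p →L[ℝ] TangentSpace I p →L[ℝ] ℝ}
  {E' : Type*} [NormedAddCommGroup E'] [NormedSpace ℝ E']
  {H' : Type*} [TopologicalSpace H'] {I' : ModelWithCorners ℝ E' H'}
  {M' : Type*} [TopologicalSpace M'] [ChartedSpace H' M']
  {g' : ∀ p : M', TangentSpace I' p →L[ℝ] TangentSpace I' p →L[ℝ] ℝ}
  {φ : M → M'}

theorem finrank_normalSpace [FiniteDimensional ℝ E] [FiniteDimensional ℝ E']
    (hφ : IsIsometricImmersion I g I' g' φ) (x : M)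
    (hB : IsInner (V := E) (g x)) :
    Module.finrank ℝ (normalSpace I I' g' φ x) = Module.finrank ℝ E' - Module.finrank ℝ E :=
  finrank_normal_eq (V := E) (W := E') hB (g' (φ x)) (mfderiv I I' φ x) (fun u v ↦ hφ.2 x u v)
    (normalSpace I I' g' φ x) fun _ ↦ Iff.rfl

variable [IsManifold I ∞ M]

theorem isInner_of_isLocalMetric (x : M)
    (hg : IsLocalMetric (chartMetric I g x) (extChartAt I x x)) : IsInner (V := E) (g x) := by
  have : IsManifold I 1 M := IsManifold.of_le (n := ∞) (by norm_cast)
  have h := hg.isInner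
  have e : chartMetric I g x (extChartAt I x x) = (g x : E →L[ℝ] E →L[ℝ] ℝ) :=
    ContinuousLinearMap.ext fun u ↦ ContinuousLinearMap.ext fun v ↦ chartMetric_self g x u v
  rwa [e] at h

variable [I.Boundaryless] [I'.Boundaryless] [IsManifold I' ∞ M']

theorem exists_secondForm_bilin (hφ : IsIsometricImmersion I g I' g' φ) (x : M)
    (hg : IsLocalMetric (chartMetric I g x) (extChartAt I x x))
    (hg' : IsLocalMetric (chartMetric I' g' (φ x)) (extChartAt I' (φ x) (φ x))) :
    ∃ h : E →ₗ[ℝ] E →ₗ[ℝ] E', (∀ u v, h u v = h v u) ∧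
      ∀ u v, h u v = secondFundamentalForm I g I' g' φ x u v := by
  have hL := isLocalIsometry_writtenInExtChartAt hφ x hg hg'
  exact ⟨secondFormBilin _ _ _ _ hL.differentiableAt_fderiv, hL.secondForm_symm, fun u v ↦ rfl⟩

variable [FiniteDimensional ℝ E] [FiniteDimensional ℝ E']

/-- The Gauss equation of an isometric immersion. -/
theorem curvature_gauss (hφ : IsIsometricImmersion I g I' g' φ) (x : M)
    (hg : IsLocalMetric (chartMetric I g x) (extChartAt I x x))
    (hg' : IsLocalMetric (chartMetric I' g' (φ x)) (extChartAt I' (φ x) (φ x))) (u v : E) :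
    g x (curvature I g x u v v) u =
      g' (φ x) (curvature I' g' (φ x) (mfderiv I I' φ x u) (mfderiv I I' φ x v)
          (mfderiv I I' φ x v)) (mfderiv I I' φ x u)
        + (g' (φ x) (secondFundamentalForm I g I' g' φ x u u)
            (secondFundamentalForm I g I' g' φ x v v)
          - g' (φ x) (secondFundamentalForm I g I' g' φ x u v)
            (secondFundamentalForm I g I' g' φ x u v)) := by
  have : IsManifold I 1 M := IsManifold.of_le (n := ∞) (by norm_cast)
  have : IsManifold I' 1 M' := IsManifold.of_le (n := ∞) (by norm_cast)
  have hL := isLocalIsometry_writtenInExtChartAt hφ x hg hg'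
  have h₀ := hL.gauss_equation u v v u
  have hy : writtenInExtChartAt I I' x φ (extChartAt I x x) = extChartAt I' (φ x) (φ x) := by
    simp [writtenInExtChartAt]
  rw [hL.secondForm_symm v u, hL.target.symm_self (coordSecondForm _ _ _ _ v v), hy,
    chartMetric_self, chartMetric_self, chartMetric_self, chartMetric_self] at h₀
  rw [mfderiv_eq_fderiv_writtenInExtChartAt hφ.1, mfderiv_eq_fderiv_writtenInExtChartAt hφ.1]
  refine h₀.trans ?_
  rw [add_sub_assoc]
  rfl

theorem secondFundamentalForm_mem_normalSpace (hφ : IsIsometricImmersion I g I' g' φ) (x : M)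
    (hg : IsLocalMetric (chartMetric I g x) (extChartAt I x x))
    (hg' : IsLocalMetric (chartMetric I' g' (φ x)) (extChartAt I' (φ x) (φ x))) (u v : E) :
    secondFundamentalForm I g I' g' φ x u v ∈ normalSpace I I' g' φ x := by
  have : IsManifold I' 1 M' := IsManifold.of_le (n := ∞) (by norm_cast)
  have hL := isLocalIsometry_writtenInExtChartAt hφ x hg hg'
  have hy : writtenInExtChartAt I I' x φ (extChartAt I x x) = extChartAt I' (φ x) (φ x) := by
    simp [writtenInExtChartAt]
  intro w
  have h₀ := hL.secondForm_normal u v w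
  rw [hy, chartMetric_self] at h₀
  exact (congrArg (fun a : E' ↦ (g' (φ x) : E' →L[ℝ] E' →L[ℝ] ℝ) a
    (secondFundamentalForm I g I' g' φ x u v))
    (mfderiv_eq_fderiv_writtenInExtChartAt hφ.1 x w)).trans h₀

/-- The curvature of a submanifold of a space form. -/
theorem sectional_gauss {c : ℝ} (hc : IsSpaceForm I' g' c) (hφ : IsIsometricImmersion I g I' g' φ)
    (x : M) (hg : IsLocalMetric (chartMetric I g x) (extChartAt I x x))
    (hg' : IsLocalMetric (chartMetric I' g' (φ x)) (extChartAt I' (φ x) (φ x)))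
    (hB' : IsInner (V := E') (g' (φ x)))
    (h : E →ₗ[ℝ] E →ₗ[ℝ] E') (hh : ∀ u v, h u v = secondFundamentalForm I g I' g' φ x u v)
    (u v : E) :
    sectional I g x u v =
      (c * gram (V := E) (g x) u v + gaussTerm (W := E') (g' (φ x)) h u v)
        / gram (V := E) (g x) u v := by
  -- For dependent vectors both sides are quotients by zero, hence 0, so the formula needs no
  -- independence hypothesis.
  rcases eq_or_ne (gram (V := E) (g x) u v) 0 with h₀ | h₀
  · rw [h₀, div_zero]
    exact (congrArg (fun t : ℝ ↦ g x (curvature I g x u v v) u / t) h₀).trans (div_zero _)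
  · have e : gram (V := E') (g' (φ x)) (mfderiv I I' φ x u) (mfderiv I I' φ x v) =
        gram (V := E) (g x) u v := by
      unfold gram
      exact congrArg₂ (· - ·) (congrArg₂ (· * ·) (hφ.2 x u u) (hφ.2 x v v))
        (congrArg (· ^ 2) (hφ.2 x u v))
    -- The differential preserves Gram determinants, so the images are independent and the space
    -- form condition applies to them.
    have h₁ := hc (φ x) (mfderiv I I' φ x u) (mfderiv I I' φ x v)
      (hB'.linearIndependent_of_gram (by rwa [e]))
    have h₂ : g' (φ x) (curvature I' g' (φ x) (mfderiv I I' φ x u) (mfderiv I I' φ x v)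
          (mfderiv I I' φ x v)) (mfderiv I I' φ x u) = c * gram (V := E) (g x) u v := by
      rw [← div_eq_iff h₀, ← e]
      exact h₁
    have h₃ := curvature_gauss hφ x hg hg' u v
    rw [h₂] at h₃
    unfold gaussTerm
    rw [hh, hh, hh]
    exact congrArg (· / gram (V := E) (g x) u v) h₃

end GaussImmersion

theorem gram_eq_one {V : Type*} [NormedAddCommGroup V] [NormedSpace ℝ V] {B : V →L[ℝ] V →L[ℝ] ℝ}
    {u v : V} (hu : B u u = 1) (hv : B v v = 1) (huv : B u v = 0) : gram B u v = 1 := by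
  rw [gram, hu, hv, huv]
  norm_num

/-! ### The Laplacian in an arbitrary frame. -/

section Laplacian

variable {E : Type*} [NormedAddCommGroup E] [NormedSpace ℝ E] [FiniteDimensional ℝ E]
  {H : Type*} [TopologicalSpace H] {I : ModelWithCorners ℝ E H} [I.Boundaryless]
  {M : Type*} [TopologicalSpace M] [ChartedSpace H M]
  {g : ∀ p : M, TangentSpace I p →L[ℝ] TangentSpace I p →L[ℝ] ℝ}

/-- The Hessian is bilinear, so its trace may be taken in any frame, in particular one induced from
the warped product. -/
theorem laplacian_eq {ψ : M → ℝ} (hψ : ContMDiff I 𝓘(ℝ, ℝ) ∞ ψ) (p : M)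
    (hB : IsInner (V := E) (g p)) {k : ℕ} {e : Fin k → E} (he : IsFrame (V := E) (g p) (⊤ : Submodule ℝ E) e) :
    laplacian I g ψ p = -∑ i, hessian I g ψ p (e i) (e i) := by
  have hs : ContDiffAt ℝ ∞ (ψ ∘ (extChartAt I p).symm) (extChartAt I p p) := by
    have := (contMDiffAt_iff.mp (hψ p)).2
    rw [I.range_eq_univ, contDiffWithinAt_univ] at this
    exact this
  have hd : DifferentiableAt ℝ (fderiv ℝ (ψ ∘ (extChartAt I p).symm)) (extChartAt I p p) :=
    (hs.fderiv_right (m := 1) (by norm_cast)).differentiableAt (by simp)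
  let b : E →ₗ[ℝ] E →ₗ[ℝ] ℝ := secondDerivBilin _ _ hd
    - (christoffelBilin (chartMetric I g p) (extChartAt I p p)).compr₂
        (fderiv ℝ (ψ ∘ (extChartAt I p).symm) (extChartAt I p p)).toLinearMap
  unfold laplacian
  exact congrArg Neg.neg (he.traceOn_eq hB b)

end Laplacian

/-! ### Passing frames between the first factor and the product. -/

section Factors

variable {E₁ : Type*} [NormedAddCommGroup E₁] [NormedSpace ℝ E₁]
  {E₂ : Type*} [NormedAddCommGroup E₂] [NormedSpace ℝ E₂]

theorem IsFrame.fst_of_range_inl {B : E₁ × E₂ →L[ℝ] E₁ × E₂ →L[ℝ] ℝ} {B₁ : E₁ →L[ℝ] E₁ →L[ℝ] ℝ}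
    (hB : ∀ a b, B (a, 0) (b, 0) = B₁ a b) {k : ℕ} {e : Fin k → E₁ × E₂}
    (he : IsFrame B (LinearMap.range (LinearMap.inl ℝ E₁ E₂)) e) :
    IsFrame B₁ ⊤ (fun i ↦ (e i).1) ∧ ∀ i, e i = ((e i).1, 0) := by
  have h₀ (i : Fin k) : e i = ((e i).1, 0) := by
    obtain ⟨a, ha⟩ := he.mem i
    rw [← ha]
    rfl
  refine ⟨⟨fun i j ↦ ?_, ?_⟩, h₀⟩
  · rw [← hB, ← h₀, ← h₀, he.1]
  · have := congrArg (Submodule.map (LinearMap.fst ℝ E₁ E₂)) he.2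
    rw [Submodule.map_span, ← Set.range_comp, ← LinearMap.range_comp, LinearMap.fst_comp_inl,
      LinearMap.range_id] at this
    exact this

theorem IsFrame.inl {B : E₁ × E₂ →L[ℝ] E₁ × E₂ →L[ℝ] ℝ} {B₁ : E₁ →L[ℝ] E₁ →L[ℝ] ℝ}
    (hB : ∀ a b, B (a, 0) (b, 0) = B₁ a b) {k : ℕ} {e : Fin k → E₁} (he : IsFrame B₁ ⊤ e) :
    IsFrame B (LinearMap.range (LinearMap.inl ℝ E₁ E₂)) (fun i ↦ (e i, 0)) := by
  refine ⟨fun i j ↦ by rw [hB, he.1], ?_⟩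
  rw [LinearMap.range_eq_map, ← he.2, Submodule.map_span, ← Set.range_comp]
  rfl

end Factors

/-! ### The algebraic data of an immersed warped product. -/

section Submanifold

variable {n₁ n₂ m : ℕ}
  {N₁ : Type*} [TopologicalSpace N₁] [ChartedSpace (EuclideanSpace ℝ (Fin n₁)) N₁]
  [IsManifold (𝓡 n₁) ∞ N₁]
  {N₂ : Type*} [TopologicalSpace N₂] [ChartedSpace (EuclideanSpace ℝ (Fin n₂)) N₂]
  [IsManifold (𝓡 n₂) ∞ N₂]
  {M' : Type*} [TopologicalSpace M'] [ChartedSpace (EuclideanSpace ℝ (Fin m)) M']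
  [IsManifold (𝓡 m) ∞ M']
  {g₁ : ContMDiffRiemannianMetric (𝓡 n₁) ∞ (EuclideanSpace ℝ (Fin n₁))
    (fun p : N₁ ↦ TangentSpace (𝓡 n₁) p)}
  {g₂ : ContMDiffRiemannianMetric (𝓡 n₂) ∞ (EuclideanSpace ℝ (Fin n₂))
    (fun p : N₂ ↦ TangentSpace (𝓡 n₂) p)}
  {g' : ContMDiffRiemannianMetric (𝓡 m) ∞ (EuclideanSpace ℝ (Fin m))
    (fun p : M' ↦ TangentSpace (𝓡 m) p)}
  {f : N₁ → ℝ} {c : ℝ}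
  {g : ∀ x : N₁ × N₂, TangentSpace ((𝓡 n₁).prod (𝓡 n₂)) x →L[ℝ]
    TangentSpace ((𝓡 n₁).prod (𝓡 n₂)) x →L[ℝ] ℝ}
  {φ : N₁ × N₂ → M'}

/-- The sum of the mixed sectional curvatures of a warped product. -/
theorem sum_sectional_mixed (hf : ContMDiff (𝓡 n₁) 𝓘(ℝ, ℝ) ∞ f) (hf_pos : ∀ p, 0 < f p)
    (hg : g = warpedMetric (𝓡 n₁) (𝓡 n₂) g₁.inner g₂.inner f) (x : N₁ × N₂)
    {e₁ : Fin n₁ → EuclideanSpace ℝ (Fin n₁) × EuclideanSpace ℝ (Fin n₂)}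
    {e₂ : Fin n₂ → EuclideanSpace ℝ (Fin n₁) × EuclideanSpace ℝ (Fin n₂)}
    (h₁ : IsFrame (V := EuclideanSpace ℝ (Fin n₁) × EuclideanSpace ℝ (Fin n₂)) (g x)
      (leaf (𝓡 n₁) (𝓡 n₂) x) e₁)
    (h₂ : IsFrame (V := EuclideanSpace ℝ (Fin n₁) × EuclideanSpace ℝ (Fin n₂)) (g x)
      (fiber (𝓡 n₁) (𝓡 n₂) x) e₂) :
    ∑ i, ∑ s, sectional ((𝓡 n₁).prod (𝓡 n₂)) g x (e₁ i) (e₂ s) =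
      n₂ * laplacian (𝓡 n₁) g₁.inner f x.1 / f x.1 := by
  have hB₁ : IsInner (V := EuclideanSpace ℝ (Fin n₁)) (g₁.inner x.1) :=
    isInner_of_isLocalMetric x.1 (isLocalMetric_chartMetric g₁ x.1)
  rw [leaf_eq] at h₁
  obtain ⟨k₁, k₂⟩ := h₁.fst_of_range_inl (B₁ := g₁.inner x.1) (warpedMetric_leaf hg x)
  have k₃ (s : Fin n₂) : e₂ s = (0, (e₂ s).2) := by
    have hm := h₂.mem s
    rw [fiber_eq] at hm
    obtain ⟨a, ha⟩ := hm
    rw [← ha]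
    rfl
  have k₄ (i : Fin n₁) (s : Fin n₂) : sectional ((𝓡 n₁).prod (𝓡 n₂)) g x (e₁ i) (e₂ s) =
      -(hessian (𝓡 n₁) g₁.inner f x.1 (e₁ i).1 (e₁ i).1 / f x.1) := by
    have a₁ := h₁.self_eq_one i
    have a₂ := h₂.self_eq_one s
    rw [k₂ i] at a₁ ⊢
    rw [k₃ s] at a₂ ⊢
    exact sectional_mixed hf hf_pos hg x _ _ a₁ a₂
  -- The mixed curvature does not depend on the fibre direction, so the sum over s only produces the
  -- factor n₂.
  simp_rw [k₄]
  rw [laplacian_eq hf x.1 hB₁ k₁]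
  simp only [Finset.sum_const, Finset.card_univ, Fintype.card_fin, nsmul_eq_mul,
    Finset.sum_neg_distrib, ← Finset.mul_sum, ← Finset.sum_div]
  ring

/-- At every point, an immersed warped product in a space form yields the algebraic data of the
Gauss equation. -/
theorem exists_isSplitGauss (hf : ContMDiff (𝓡 n₁) 𝓘(ℝ, ℝ) ∞ f) (hf_pos : ∀ p, 0 < f p)
    (hc : IsSpaceForm (𝓡 m) g'.inner c)
    (hg : g = warpedMetric (𝓡 n₁) (𝓡 n₂) g₁.inner g₂.inner f)
    (hφ : IsIsometricImmersion ((𝓡 n₁).prod (𝓡 n₂)) g (𝓡 m) g'.inner φ) (x : N₁ × N₂) :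
    ∃ h : (EuclideanSpace ℝ (Fin n₁) × EuclideanSpace ℝ (Fin n₂)) →ₗ[ℝ]
        (EuclideanSpace ℝ (Fin n₁) × EuclideanSpace ℝ (Fin n₂)) →ₗ[ℝ] EuclideanSpace ℝ (Fin m),
      (∀ u v, h u v = secondFundamentalForm ((𝓡 n₁).prod (𝓡 n₂)) g (𝓡 m) g'.inner φ x u v) ∧
      IsSplitGauss (V := EuclideanSpace ℝ (Fin n₁) × EuclideanSpace ℝ (Fin n₂))
        (W := EuclideanSpace ℝ (Fin m)) (g x) (g'.inner (φ x)) h (leaf (𝓡 n₁) (𝓡 n₂) x)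
        (fiber (𝓡 n₁) (𝓡 n₂) x) (normalSpace ((𝓡 n₁).prod (𝓡 n₂)) (𝓡 m) g'.inner φ x)
        n₁ n₂ (m - (n₁ + n₂)) c (n₂ * laplacian (𝓡 n₁) g₁.inner f x.1 / f x.1)
        (sectional ((𝓡 n₁).prod (𝓡 n₂)) g x) := by
  have hL' := isLocalMetric_chartMetric g' (φ x)
  have hL : IsLocalMetric (chartMetric ((𝓡 n₁).prod (𝓡 n₂)) g x)
      (extChartAt ((𝓡 n₁).prod (𝓡 n₂)) x x) := by
    subst hg
    exact (isLocalWarped_chartMetric g₁ g₂ hf hf_pos x).isLocalMetric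
  have hB := isInner_of_isLocalMetric x hL
  have hB' := isInner_of_isLocalMetric (φ x) hL'
  obtain ⟨h, hs, hh⟩ := exists_secondForm_bilin hφ x hL hL'
  have hcurv := sectional_gauss hc hφ x hL hL' hB' h hh
  refine ⟨h, hh, hB, hB', hs, ?_, ?_, ?_, ?_, ?_, ?_, hcurv, ?_⟩
  · rw [leaf_eq, fiber_eq]
    rintro _ ⟨a, rfl⟩ _ ⟨b, rfl⟩
    exact warpedMetric_mixed hg x a b
  · rw [leaf_eq, fiber_eq]
    exact LinearMap.sup_range_inl_inr
  · rw [leaf_eq, LinearMap.finrank_range_of_inj LinearMap.inl_injective]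
    simp
  · rw [fiber_eq, LinearMap.finrank_range_of_inj LinearMap.inr_injective]
    simp
  · exact (finrank_normalSpace hφ x hB).trans (by simp)
  · intro u v
    rw [hh]
    exact secondFundamentalForm_mem_normalSpace hφ x hL hL' u v
  · intro e₁ e₂ h₁ h₂
    rw [← sum_sectional_mixed hf hf_pos hg x h₁ h₂]
    refine Finset.sum_congr rfl fun i _ ↦ Finset.sum_congr rfl fun s _ ↦ ?_
    have hm : (g x : _ →L[ℝ] _ →L[ℝ] ℝ) (e₁ i) (e₂ s) = 0 := by
      have a₁ := h₁.mem i
      have a₂ := h₂.mem s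
      rw [leaf_eq] at a₁
      rw [fiber_eq] at a₂
      obtain ⟨a, ha⟩ := a₁
      obtain ⟨b, hb⟩ := a₂
      rw [← ha, ← hb]
      exact warpedMetric_mixed hg x a b
    refine Eq.trans ?_ (hcurv (e₁ i) (e₂ s)).symm
    have a₁ := h₁.self_eq_one i
    have a₂ := h₂.self_eq_one s
    have hgr := gram_eq_one a₁ a₂ hm
    rw [hgr, mul_one, div_one]

end Submanifold

/-! ### Translation between the algebraic and the geometric formulations. -/

section Submanifold

variable {n₁ n₂ m : ℕ}
  {N₁ : Type*} [TopologicalSpace N₁] [ChartedSpace (EuclideanSpace ℝ (Fin n₁)) N₁]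
  {N₂ : Type*} [TopologicalSpace N₂] [ChartedSpace (EuclideanSpace ℝ (Fin n₂)) N₂]
  {M' : Type*} [TopologicalSpace M'] [ChartedSpace (EuclideanSpace ℝ (Fin m)) M']
  {g' : ∀ p : M', TangentSpace (𝓡 m) p →L[ℝ] TangentSpace (𝓡 m) p →L[ℝ] ℝ}
  {g : ∀ x : N₁ × N₂, TangentSpace ((𝓡 n₁).prod (𝓡 n₂)) x →L[ℝ]
    TangentSpace ((𝓡 n₁).prod (𝓡 n₂)) x →L[ℝ] ℝ}
  {φ : N₁ × N₂ → M'} {x : N₁ × N₂}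
  {h : (EuclideanSpace ℝ (Fin n₁) × EuclideanSpace ℝ (Fin n₂)) →ₗ[ℝ]
    (EuclideanSpace ℝ (Fin n₁) × EuclideanSpace ℝ (Fin n₂)) →ₗ[ℝ] EuclideanSpace ℝ (Fin m)}

/-- By symmetry of h the lower left block repeats the upper right one, so a single mixed condition
suffices. -/
theorem shapeMatrix_eq_fromBlocks_iff (hs : ∀ u v, h u v = h v u)
    (hh : ∀ u v, h u v = secondFundamentalForm ((𝓡 n₁).prod (𝓡 n₂)) g (𝓡 m) g' φ x u v)
    (e₁ : Fin n₁ → EuclideanSpace ℝ (Fin n₁) × EuclideanSpace ℝ (Fin n₂))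
    (e₂ : Fin n₂ → EuclideanSpace ℝ (Fin n₁) × EuclideanSpace ℝ (Fin n₂))
    (ξ : EuclideanSpace ℝ (Fin m)) (P : Matrix (Fin n₁) (Fin n₁) ℝ)
    (Q : Matrix (Fin n₂) (Fin n₂) ℝ) :
    shapeMatrix ((𝓡 n₁).prod (𝓡 n₂)) g (𝓡 m) g' φ x (Sum.elim e₁ e₂) ξ
        = Matrix.fromBlocks P 0 0 Q ↔
      (Matrix.of fun i j ↦ (g' (φ x) : EuclideanSpace ℝ (Fin m) →L[ℝ]
        EuclideanSpace ℝ (Fin m) →L[ℝ] ℝ) (h (e₁ i) (e₁ j)) ξ) = P ∧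
      (Matrix.of fun i j ↦ (g' (φ x) : EuclideanSpace ℝ (Fin m) →L[ℝ]
        EuclideanSpace ℝ (Fin m) →L[ℝ] ℝ) (h (e₂ i) (e₂ j)) ξ) = Q ∧
      ∀ i s, (g' (φ x) : EuclideanSpace ℝ (Fin m) →L[ℝ]
        EuclideanSpace ℝ (Fin m) →L[ℝ] ℝ) (h (e₁ i) (e₂ s)) ξ = 0 := by
  have e : shapeMatrix ((𝓡 n₁).prod (𝓡 n₂)) g (𝓡 m) g' φ x (Sum.elim e₁ e₂) ξ =
      Matrix.fromBlocks
        (Matrix.of fun i j ↦ (g' (φ x) : EuclideanSpace ℝ (Fin m) →L[ℝ]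
          EuclideanSpace ℝ (Fin m) →L[ℝ] ℝ) (h (e₁ i) (e₁ j)) ξ)
        (Matrix.of fun i s ↦ (g' (φ x) : EuclideanSpace ℝ (Fin m) →L[ℝ]
          EuclideanSpace ℝ (Fin m) →L[ℝ] ℝ) (h (e₁ i) (e₂ s)) ξ)
        (Matrix.of fun s i ↦ (g' (φ x) : EuclideanSpace ℝ (Fin m) →L[ℝ]
          EuclideanSpace ℝ (Fin m) →L[ℝ] ℝ) (h (e₁ i) (e₂ s)) ξ)
        (Matrix.of fun i j ↦ (g' (φ x) : EuclideanSpace ℝ (Fin m) →L[ℝ]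
          EuclideanSpace ℝ (Fin m) →L[ℝ] ℝ) (h (e₂ i) (e₂ j)) ξ) := by
    have key (a b : EuclideanSpace ℝ (Fin n₁) × EuclideanSpace ℝ (Fin n₂)) :
        g' (φ x) (secondFundamentalForm ((𝓡 n₁).prod (𝓡 n₂)) g (𝓡 m) g' φ x a b) ξ =
          (g' (φ x) : EuclideanSpace ℝ (Fin m) →L[ℝ] EuclideanSpace ℝ (Fin m) →L[ℝ] ℝ)
            (h a b) ξ := by
      rw [hh]
    ext (i | i) (j | j)
    · exact key _ _
    · exact key _ _
    · exact (key _ _).trans (congrArg (fun a : EuclideanSpace ℝ (Fin m) ↦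
        (g' (φ x) : EuclideanSpace ℝ (Fin m) →L[ℝ] EuclideanSpace ℝ (Fin m) →L[ℝ] ℝ) a ξ)
          (hs _ _))
    · exact key _ _
  rw [e, Matrix.fromBlocks_inj]
  constructor
  · rintro ⟨h₁, h₂, -, h₄⟩
    exact ⟨h₁, h₄, fun i s ↦ congrFun (congrFun h₂ i) s⟩
  · rintro ⟨h₁, h₂, h₃⟩
    exact ⟨h₁, Matrix.ext fun i s ↦ h₃ i s, Matrix.ext fun s i ↦ h₃ i s, h₂⟩

theorem shapeForms₁_iff (hs : ∀ u v, h u v = h v u)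
    (hh : ∀ u v, h u v = secondFundamentalForm ((𝓡 n₁).prod (𝓡 n₂)) g (𝓡 m) g' φ x u v)
    (e₁ : Fin n₁ → EuclideanSpace ℝ (Fin n₁) × EuclideanSpace ℝ (Fin n₂))
    (e₂ : Fin n₂ → EuclideanSpace ℝ (Fin n₁) × EuclideanSpace ℝ (Fin n₂))
    (ξ : Fin (m - (n₁ + n₂)) → EuclideanSpace ℝ (Fin m)) :
    ShapeForms₁ g g' φ x e₁ e₂ ξ ↔
      HasShapeForms (W := EuclideanSpace ℝ (Fin m)) (g' (φ x)) h e₁ e₂ ξ := by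
  refine forall_congr' fun r ↦ ?_
  constructor
  · rintro ⟨P, Q, h₁, h₂, h₃, h₄⟩
    obtain ⟨rfl, rfl, h₅⟩ := (shapeMatrix_eq_fromBlocks_iff hs hh e₁ e₂ (ξ r) P Q).mp h₁
    exact ⟨h₅, h₂, h₃, h₄⟩
  · rintro ⟨h₁, h₂, h₃, h₄⟩
    exact ⟨_, _, (shapeMatrix_eq_fromBlocks_iff hs hh e₁ e₂ (ξ r) _ _).mpr ⟨rfl, rfl, h₁⟩,
      h₂, h₃, h₄⟩

theorem shapeForms₂_iff (hs : ∀ u v, h u v = h v u)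
    (hh : ∀ u v, h u v = secondFundamentalForm ((𝓡 n₁).prod (𝓡 n₂)) g (𝓡 m) g' φ x u v)
    (e₁ : Fin n₁ → EuclideanSpace ℝ (Fin n₁) × EuclideanSpace ℝ (Fin n₂))
    (e₂ : Fin n₂ → EuclideanSpace ℝ (Fin n₁) × EuclideanSpace ℝ (Fin n₂))
    (ξ : Fin (m - (n₁ + n₂)) → EuclideanSpace ℝ (Fin m)) :
    ShapeForms₂ g g' φ x e₁ e₂ ξ ↔
      HasShapeForms (W := EuclideanSpace ℝ (Fin m)) (g' (φ x)) h e₂ e₁ ξ := by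
  refine forall_congr' fun r ↦ ?_
  constructor
  · rintro ⟨P, Q, h₁, h₂, h₃, h₄⟩
    obtain ⟨rfl, rfl, h₅⟩ := (shapeMatrix_eq_fromBlocks_iff hs hh e₁ e₂ (ξ r) P Q).mp h₁
    exact ⟨fun i s ↦ by rw [hs]; exact h₅ s i, h₂, h₄, h₃⟩
  · rintro ⟨h₁, h₂, h₃, h₄⟩
    exact ⟨_, _, (shapeMatrix_eq_fromBlocks_iff hs hh e₁ e₂ (ξ r) _ _).mpr
      ⟨rfl, rfl, fun i s ↦ by rw [hs]; exact h₁ s i⟩, h₂, h₄, h₃⟩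

theorem meanCurvature_eq
    (hh : ∀ u v, h u v = secondFundamentalForm ((𝓡 n₁).prod (𝓡 n₂)) g (𝓡 m) g' φ x u v) :
    (meanCurvature ((𝓡 n₁).prod (𝓡 n₂)) g (𝓡 m) g' φ x : EuclideanSpace ℝ (Fin m)) =
      (1 / ((n₁ : ℝ) + n₂)) •
        traceOn (V := EuclideanSpace ℝ (Fin n₁) × EuclideanSpace ℝ (Fin n₂)) (g x)
          (⊤ : Submodule ℝ (EuclideanSpace ℝ (Fin n₁) × EuclideanSpace ℝ (Fin n₂)))
          (fun u v ↦ h u v) := by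
  have e : (fun u v ↦ h u v) =
      secondFundamentalForm ((𝓡 n₁).prod (𝓡 n₂)) g (𝓡 m) g' φ x := by
    funext u v
    exact hh u v
  have hd : (Module.finrank ℝ (EuclideanSpace ℝ (Fin n₁) × EuclideanSpace ℝ (Fin n₂)) : ℝ) =
      (n₁ : ℝ) + n₂ := by simp
  unfold meanCurvature
  rw [hd, e]
  rfl

/-- The mean curvature is the full trace divided by n, so n²|H|² is the square of that trace; n ≠ 0
is needed to cancel. -/
theorem chenBound_eq (hn : n₁ + n₂ ≠ 0)
    (hh : ∀ u v, h u v = secondFundamentalForm ((𝓡 n₁).prod (𝓡 n₂)) g (𝓡 m) g' φ x u v)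
    (g₁ : ∀ p : N₁, TangentSpace (𝓡 n₁) p →L[ℝ] TangentSpace (𝓡 n₁) p →L[ℝ] ℝ)
    (f : N₁ → ℝ) (c : ℝ) (k l : ℕ) {t : EuclideanSpace ℝ (Fin m)}
    (ht : t = traceOn (V := EuclideanSpace ℝ (Fin n₁) × EuclideanSpace ℝ (Fin n₂)) (g x)
          (⊤ : Submodule ℝ (EuclideanSpace ℝ (Fin n₁) × EuclideanSpace ℝ (Fin n₂)))
      (fun u v ↦ h u v)) :
    chenBound g g' φ x g₁ f c k l =
      (g' (φ x) : EuclideanSpace ℝ (Fin m) →L[ℝ] EuclideanSpace ℝ (Fin m) →L[ℝ] ℝ) t t / 2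
        - n₂ * laplacian (𝓡 n₁) g₁ f x.1 / f x.1 + 1 / 2 * k * ((k : ℝ) + 2 * l - 1) * c - c := by
  have hn' : (n₁ : ℝ) + n₂ ≠ 0 := by exact_mod_cast hn
  have key (C : EuclideanSpace ℝ (Fin m) →L[ℝ] EuclideanSpace ℝ (Fin m) →L[ℝ] ℝ) :
      ((n₁ : ℝ) + n₂) ^ 2 / 2 * C ((1 / ((n₁ : ℝ) + n₂)) • t) ((1 / ((n₁ : ℝ) + n₂)) • t) =
        C t t / 2 := by
    simp only [map_smul, smul_apply, smul_eq_mul]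
    field_simp
  have hH : (meanCurvature ((𝓡 n₁).prod (𝓡 n₂)) g (𝓡 m) g' φ x : EuclideanSpace ℝ (Fin m)) =
      (1 / ((n₁ : ℝ) + n₂)) • t := by rw [ht, meanCurvature_eq hh]
  have := key (g' (φ x))
  rw [← hH] at this
  unfold chenBound
  exact congrArg (fun a : ℝ ↦ a - n₂ * laplacian (𝓡 n₁) g₁ f x.1 / f x.1
    + 1 / 2 * k * ((k : ℝ) + 2 * l - 1) * c - c) this

theorem isEqualityGeometry_of
    (hh : ∀ u v, h u v = secondFundamentalForm ((𝓡 n₁).prod (𝓡 n₂)) g (𝓡 m) g' φ x u v)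
    (h₀ : ∀ u ∈ leaf (𝓡 n₁) (𝓡 n₂) x, ∀ v ∈ fiber (𝓡 n₁) (𝓡 n₂) x, h u v = 0)
    (h₁ : traceOn (V := EuclideanSpace ℝ (Fin n₁) × EuclideanSpace ℝ (Fin n₂)) (g x)
      (leaf (𝓡 n₁) (𝓡 n₂) x) (fun u v ↦ h u v) = 0)
    (h₂ : traceOn (V := EuclideanSpace ℝ (Fin n₁) × EuclideanSpace ℝ (Fin n₂)) (g x)
      (fiber (𝓡 n₁) (𝓡 n₂) x) (fun u v ↦ h u v) = 0)
    (h₃ : traceOn (V := EuclideanSpace ℝ (Fin n₁) × EuclideanSpace ℝ (Fin n₂)) (g x)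
          (⊤ : Submodule ℝ (EuclideanSpace ℝ (Fin n₁) × EuclideanSpace ℝ (Fin n₂)))
      (fun u v ↦ h u v) = 0) :
    IsEqualityGeometry g g' φ x := by
  have e : (fun u v ↦ h u v) =
      secondFundamentalForm ((𝓡 n₁).prod (𝓡 n₂)) g (𝓡 m) g' φ x := by
    funext u v
    exact hh u v
  refine ⟨fun u hu v hv ↦ (hh u v).symm.trans (h₀ u hu v hv), ?_, ?_, ?_⟩
  · rw [e] at h₁
    exact h₁
  · rw [e] at h₂
    exact h₂
  · refine (meanCurvature_eq hh).trans ?_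
    rw [h₃, smul_zero]
    rfl

end Submanifold

/-! ### Comparison with the intrinsic Chen invariant of the first factor. -/

section Intrinsic

variable {n₁ n₂ : ℕ}
  {N₁ : Type*} [TopologicalSpace N₁] [ChartedSpace (EuclideanSpace ℝ (Fin n₁)) N₁]
  [IsManifold (𝓡 n₁) ∞ N₁]
  {N₂ : Type*} [TopologicalSpace N₂] [ChartedSpace (EuclideanSpace ℝ (Fin n₂)) N₂]
  [IsManifold (𝓡 n₂) ∞ N₂]
  {g₁ : ContMDiffRiemannianMetric (𝓡 n₁) ∞ (EuclideanSpace ℝ (Fin n₁))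
    (fun p : N₁ ↦ TangentSpace (𝓡 n₁) p)}
  {g₂ : ContMDiffRiemannianMetric (𝓡 n₂) ∞ (EuclideanSpace ℝ (Fin n₂))
    (fun p : N₂ ↦ TangentSpace (𝓡 n₂) p)}
  {f : N₁ → ℝ}
  {g : ∀ x : N₁ × N₂, TangentSpace ((𝓡 n₁).prod (𝓡 n₂)) x →L[ℝ]
    TangentSpace ((𝓡 n₁).prod (𝓡 n₂)) x →L[ℝ] ℝ}

/-- The chosen frames on the two sides are unrelated. The intrinsic one is pushed into the product,
where frame independence of the scalar curvature compares it with the other. -/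
theorem scalarOn_top_eq (hf : ContMDiff (𝓡 n₁) 𝓘(ℝ, ℝ) ∞ f) (hf_pos : ∀ p, 0 < f p)
    (hg : g = warpedMetric (𝓡 n₁) (𝓡 n₂) g₁.inner g₂.inner f) (x : N₁ × N₂)
    {W : Type*} [NormedAddCommGroup W] [NormedSpace ℝ W] {B' : W →L[ℝ] W →L[ℝ] ℝ}
    {h : (EuclideanSpace ℝ (Fin n₁) × EuclideanSpace ℝ (Fin n₂)) →ₗ[ℝ]
      (EuclideanSpace ℝ (Fin n₁) × EuclideanSpace ℝ (Fin n₂)) →ₗ[ℝ] W} {S : Submodule ℝ W}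
    {q : ℕ} {c D : ℝ}
    (H : IsSplitGauss (V := EuclideanSpace ℝ (Fin n₁) × EuclideanSpace ℝ (Fin n₂)) (g x) B' h
      (leaf (𝓡 n₁) (𝓡 n₂) x) (fiber (𝓡 n₁) (𝓡 n₂) x) S n₁ n₂ q c D
      (sectional ((𝓡 n₁).prod (𝓡 n₂)) g x)) :
    scalarOn (𝓡 n₁) g₁.inner x.1 ⊤ =
      scalarOn ((𝓡 n₁).prod (𝓡 n₂)) g x (leaf (𝓡 n₁) (𝓡 n₂) x) := by
  have hB₁ : IsInner (V := EuclideanSpace ℝ (Fin n₁)) (g₁.inner x.1) :=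
    isInner_of_isLocalMetric x.1 (isLocalMetric_chartMetric g₁ x.1)
  have k₁ := hB₁.isFrame_frameOf ⊤
  have k₂ := k₁.inl (E₂ := EuclideanSpace ℝ (Fin n₂)) (warpedMetric_leaf hg x)
  have k₃ := H.inner.isFrame_frameOf (leaf (𝓡 n₁) (𝓡 n₂) x)
  rw [← leaf_eq (I₁ := 𝓡 n₁) (I₂ := 𝓡 n₂) x] at k₂
  have k₄ := H.sum_curv_eq k₂ k₃
  refine Eq.trans ?_ k₄
  unfold scalarOn
  refine Finset.sum_congr rfl fun i _ ↦ Finset.sum_congr rfl fun j _ ↦ ?_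
  exact (sectional_leaf hf hf_pos hg x _ _).symm

theorem chenInvariant_top_eq (hf : ContMDiff (𝓡 n₁) 𝓘(ℝ, ℝ) ∞ f) (hf_pos : ∀ p, 0 < f p)
    (hg : g = warpedMetric (𝓡 n₁) (𝓡 n₂) g₁.inner g₂.inner f) (x : N₁ × N₂)
    (hs : scalarOn (𝓡 n₁) g₁.inner x.1 ⊤ =
      scalarOn ((𝓡 n₁).prod (𝓡 n₂)) g x (leaf (𝓡 n₁) (𝓡 n₂) x)) :
    chenInvariant (𝓡 n₁) g₁.inner x.1 ⊤ =
      chenInvariant ((𝓡 n₁).prod (𝓡 n₂)) g x (leaf (𝓡 n₁) (𝓡 n₂) x) := by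
  unfold chenInvariant
  rw [hs]
  congr 2
  have hl : ∀ w, w ∈ leaf (𝓡 n₁) (𝓡 n₂) x ↔ ∃ a : EuclideanSpace ℝ (Fin n₁),
      ((a, 0) : EuclideanSpace ℝ (Fin n₁) × EuclideanSpace ℝ (Fin n₂)) = w := fun w ↦
    iff_of_eq (congrArg (fun L : Submodule ℝ
      (EuclideanSpace ℝ (Fin n₁) × EuclideanSpace ℝ (Fin n₂)) ↦ w ∈ L) (leaf_eq x))
  have hi (a b : EuclideanSpace ℝ (Fin n₁)) : LinearIndependent ℝ
      ![((a, 0) : EuclideanSpace ℝ (Fin n₁) × EuclideanSpace ℝ (Fin n₂)), (b, 0)] ↔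
        LinearIndependent ℝ ![a, b] := by
    simp [LinearIndependent.pair_iff]
  ext k
  constructor
  · rintro ⟨u, -, v, -, huv, rfl⟩
    exact ⟨_, (hl _).mpr ⟨u, rfl⟩, _, (hl _).mpr ⟨v, rfl⟩, (hi u v).mpr huv,
      (sectional_leaf hf hf_pos hg x u v).symm⟩
  · rintro ⟨_, hu, _, hv, huv, rfl⟩
    obtain ⟨u, rfl⟩ := (hl _).mp hu
    obtain ⟨v, rfl⟩ := (hl _).mp hv
    exact ⟨u, trivial, v, trivial, (hi u v).mp huv, sectional_leaf hf hf_pos hg x u v⟩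

end Intrinsic

end WarpedChen

end

/-! ### Assembly of the two parts. -/

theorem theorem4p1 {n₁ n₂ m : ℕ}
    {N₁ : Type*} [TopologicalSpace N₁] [ChartedSpace (EuclideanSpace ℝ (Fin n₁)) N₁]
    [IsManifold (𝓡 n₁) ∞ N₁]
    {N₂ : Type*} [TopologicalSpace N₂] [ChartedSpace (EuclideanSpace ℝ (Fin n₂)) N₂]
    [IsManifold (𝓡 n₂) ∞ N₂]
    {M' : Type*} [TopologicalSpace M'] [ChartedSpace (EuclideanSpace ℝ (Fin m)) M']
    [IsManifold (𝓡 m) ∞ M']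
    (g₁ : ContMDiffRiemannianMetric (𝓡 n₁) ∞ (EuclideanSpace ℝ (Fin n₁))
      (fun p : N₁ ↦ TangentSpace (𝓡 n₁) p))
    (g₂ : ContMDiffRiemannianMetric (𝓡 n₂) ∞ (EuclideanSpace ℝ (Fin n₂))
      (fun p : N₂ ↦ TangentSpace (𝓡 n₂) p))
    (g' : ContMDiffRiemannianMetric (𝓡 m) ∞ (EuclideanSpace ℝ (Fin m))
      (fun p : M' ↦ TangentSpace (𝓡 m) p))
    (f : N₁ → ℝ) (hf : ContMDiff (𝓡 n₁) 𝓘(ℝ, ℝ) ∞ f) (hf_pos : ∀ p, 0 < f p)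
    (c : ℝ) (hc : WarpedChen.IsSpaceForm (𝓡 m) g'.inner c)
    (g : ∀ x : N₁ × N₂, TangentSpace ((𝓡 n₁).prod (𝓡 n₂)) x →L[ℝ]
      TangentSpace ((𝓡 n₁).prod (𝓡 n₂)) x →L[ℝ] ℝ)
    (hg : g = WarpedChen.warpedMetric (𝓡 n₁) (𝓡 n₂) g₁.inner g₂.inner f)
    (φ : N₁ × N₂ → M')
    (hφ : WarpedChen.IsIsometricImmersion ((𝓡 n₁).prod (𝓡 n₂)) g (𝓡 m) g'.inner φ)
    (x : N₁ × N₂) :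
    -- planes tangent to the first factor; the intrinsic invariant of `N₁` is the one of the
    -- subspace `T_x N₁` of the tangent space of the warped product
    (2 ≤ n₁ →
      WarpedChen.chenInvariant (𝓡 n₁) g₁.inner x.1 ⊤
          = WarpedChen.chenInvariant ((𝓡 n₁).prod (𝓡 n₂)) g x
              (WarpedChen.leaf (𝓡 n₁) (𝓡 n₂) x) ∧
      WarpedChen.chenInvariant (𝓡 n₁) g₁.inner x.1 ⊤
          ≤ WarpedChen.chenBound g g'.inner φ x g₁.inner f c n₁ n₂ ∧
      (WarpedChen.chenInvariant (𝓡 n₁) g₁.inner x.1 ⊤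
          = WarpedChen.chenBound g g'.inner φ x g₁.inner f c n₁ n₂ ↔
        ∃ e₁ e₂ ξ, WarpedChen.IsAdaptedFrame g g'.inner φ x e₁ e₂ ξ ∧
          WarpedChen.ShapeForms₁ g g'.inner φ x e₁ e₂ ξ) ∧
      (∀ u ∈ WarpedChen.leaf (𝓡 n₁) (𝓡 n₂) x, ∀ v ∈ WarpedChen.leaf (𝓡 n₁) (𝓡 n₂) x,
        LinearIndependent ℝ ![u, v] →
        WarpedChen.scalarOn ((𝓡 n₁).prod (𝓡 n₂)) g x (WarpedChen.leaf (𝓡 n₁) (𝓡 n₂) x)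
            - WarpedChen.sectional ((𝓡 n₁).prod (𝓡 n₂)) g x u v
            ≤ WarpedChen.chenBound g g'.inner φ x g₁.inner f c n₁ n₂ ∧
        (WarpedChen.scalarOn ((𝓡 n₁).prod (𝓡 n₂)) g x (WarpedChen.leaf (𝓡 n₁) (𝓡 n₂) x)
            - WarpedChen.sectional ((𝓡 n₁).prod (𝓡 n₂)) g x u v
            = WarpedChen.chenBound g g'.inner φ x g₁.inner f c n₁ n₂ ↔
          ∃ e₁ e₂ ξ, WarpedChen.IsAdaptedFrame g g'.inner φ x e₁ e₂ ξ ∧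
            Submodule.span ℝ (e₁ '' {i | i.val < 2}) = Submodule.span ℝ {u, v} ∧
            WarpedChen.ShapeForms₁ g g'.inner φ x e₁ e₂ ξ)) ∧
      (WarpedChen.chenInvariant (𝓡 n₁) g₁.inner x.1 ⊤
          = WarpedChen.chenBound g g'.inner φ x g₁.inner f c n₁ n₂ →
        WarpedChen.IsEqualityGeometry g g'.inner φ x)) ∧
    -- planes tangent to the second factor
    (2 ≤ n₂ →
      WarpedChen.chenInvariant ((𝓡 n₁).prod (𝓡 n₂)) g x (WarpedChen.fiber (𝓡 n₁) (𝓡 n₂) x)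
          ≤ WarpedChen.chenBound g g'.inner φ x g₁.inner f c n₂ n₁ ∧
      (WarpedChen.chenInvariant ((𝓡 n₁).prod (𝓡 n₂)) g x (WarpedChen.fiber (𝓡 n₁) (𝓡 n₂) x)
          = WarpedChen.chenBound g g'.inner φ x g₁.inner f c n₂ n₁ ↔
        ∃ e₁ e₂ ξ, WarpedChen.IsAdaptedFrame g g'.inner φ x e₁ e₂ ξ ∧
          WarpedChen.ShapeForms₂ g g'.inner φ x e₁ e₂ ξ) ∧
      (∀ u ∈ WarpedChen.fiber (𝓡 n₁) (𝓡 n₂) x, ∀ v ∈ WarpedChen.fiber (𝓡 n₁) (𝓡 n₂) x,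
        LinearIndependent ℝ ![u, v] →
        WarpedChen.scalarOn ((𝓡 n₁).prod (𝓡 n₂)) g x (WarpedChen.fiber (𝓡 n₁) (𝓡 n₂) x)
            - WarpedChen.sectional ((𝓡 n₁).prod (𝓡 n₂)) g x u v
            ≤ WarpedChen.chenBound g g'.inner φ x g₁.inner f c n₂ n₁ ∧
        (WarpedChen.scalarOn ((𝓡 n₁).prod (𝓡 n₂)) g x (WarpedChen.fiber (𝓡 n₁) (𝓡 n₂) x)
            - WarpedChen.sectional ((𝓡 n₁).prod (𝓡 n₂)) g x u v
            = WarpedChen.chenBound g g'.inner φ x g₁.inner f c n₂ n₁ ↔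
          ∃ e₁ e₂ ξ, WarpedChen.IsAdaptedFrame g g'.inner φ x e₁ e₂ ξ ∧
            Submodule.span ℝ (e₂ '' {i | i.val < 2}) = Submodule.span ℝ {u, v} ∧
            WarpedChen.ShapeForms₂ g g'.inner φ x e₁ e₂ ξ)) ∧
      (WarpedChen.chenInvariant ((𝓡 n₁).prod (𝓡 n₂)) g x (WarpedChen.fiber (𝓡 n₁) (𝓡 n₂) x)
          = WarpedChen.chenBound g g'.inner φ x g₁.inner f c n₂ n₁ →
        WarpedChen.IsEqualityGeometry g g'.inner φ x)) := by
  obtain ⟨h, hh, H⟩ := WarpedChen.exists_isSplitGauss hf hf_pos hc hg hφ x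
  have hβ (hn : n₁ + n₂ ≠ 0) (k l : ℕ) :=
    WarpedChen.chenBound_eq hn hh g₁.inner f c k l rfl
  refine ⟨fun hn ↦ ?_, fun hn ↦ ?_⟩
  · have hs := WarpedChen.scalarOn_top_eq hf hf_pos hg x H
    have hi := WarpedChen.chenInvariant_top_eq hf hf_pos hg x hs
    have hβ' := hβ (by omega) n₁ n₂
    obtain ⟨c₁, c₂, c₃⟩ := H.chen hn hβ' (δ := WarpedChen.chenInvariant ((𝓡 n₁).prod (𝓡 n₂)) g x
      (WarpedChen.leaf (𝓡 n₁) (𝓡 n₂) x)) rfl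
    rw [hi]
    refine ⟨rfl, c₁, c₂.trans ?_, fun u hu v hv huv ↦ ?_, fun hd ↦ ?_⟩
    · exact exists_congr fun e₁ ↦ exists_congr fun e₂ ↦ exists_congr fun ξ ↦
        and_congr Iff.rfl (WarpedChen.shapeForms₁_iff H.symm hh e₁ e₂ ξ).symm
    · obtain ⟨p₁, p₂⟩ := H.plane hn hu hv huv hβ'
      exact ⟨p₁, p₂.trans (exists_congr fun e₁ ↦ exists_congr fun e₂ ↦ exists_congr fun ξ ↦
        and_congr Iff.rfl (and_congr Iff.rfl
          (WarpedChen.shapeForms₁_iff H.symm hh e₁ e₂ ξ).symm))⟩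
    · obtain ⟨d₁, d₂, d₃, d₄⟩ := c₃ hd
      exact WarpedChen.isEqualityGeometry_of hh d₁ d₂ d₃ d₄
  · have hβ' := hβ (by omega) n₂ n₁
    obtain ⟨c₁, c₂, c₃⟩ := H.swap.chen hn hβ' (δ := WarpedChen.chenInvariant
      ((𝓡 n₁).prod (𝓡 n₂)) g x (WarpedChen.fiber (𝓡 n₁) (𝓡 n₂) x)) rfl
    refine ⟨c₁, c₂.trans ?_, fun u hu v hv huv ↦ ?_, fun hd ↦ ?_⟩
    -- After the swap the frame of the second factor is quantified first.
    · rw [exists_comm]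
      exact exists_congr fun e₁ ↦ exists_congr fun e₂ ↦ exists_congr fun ξ ↦
        and_congr and_left_comm (WarpedChen.shapeForms₂_iff H.symm hh e₁ e₂ ξ).symm
    · obtain ⟨p₁, p₂⟩ := H.swap.plane hn hu hv huv hβ'
      refine ⟨p₁, p₂.trans ?_⟩
      rw [exists_comm]
      exact exists_congr fun e₁ ↦ exists_congr fun e₂ ↦ exists_congr fun ξ ↦
        and_congr and_left_comm (and_congr Iff.rfl
          (WarpedChen.shapeForms₂_iff H.symm hh e₁ e₂ ξ).symm)
    · obtain ⟨d₁, d₂, d₃, d₄⟩ := c₃ hd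
      exact WarpedChen.isEqualityGeometry_of hh
        (fun u hu v hv ↦ (H.symm u v).trans (d₁ v hv u hu)) d₃ d₂ d₄
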